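/- Write $\mathbb C^\times=\mathbb C\setminus\{0\}$, and for $n\ge 1$ let $$D_n=\{(z_1,\dots,z_n)\in(\mathbb C^\times)^n : z_{k+1}/z_k\notin(0,\infty)\text{ for }1\le k<n\},$$ an open dense subset of $(\mathbb C^\times)^n$. (i) There is a unique series of holomorphic functions $F_n:D_n\to\mathbb C$, $n\ge 1$, such that $F_1\equiv(2\pi i)^{-1}$, such that $F_n(z_1,\dots,z_n)=0$ whenever $(z_1,\dots,z_n)\in D_n$ and $z_1+\cdots+z_n=0$, and such that for all $n\ge1$ $$dF_n(z_1,\dots,z_n)=\sum_{k=1}^{n-1}F_k(z_1,\dots,z_k)\,F_{n-k}(z_{k+1},\dots,z_n)\left[\frac{dz_{k+1}+\cdots+dz_n}{z_{k+1}+\cdots+z_n}-\frac{dz_1+\cdots+dz_k}{z_1+\cdots+z_k}\right]$$ at all points of $D_n$ at which no denominator vanishes. (ii) These functions $F_n$ extend to functions $F_n:(\mathbb C^\times)^n\to\mathbb C$, $n\ge1$, satisfying the following condition, and there is only one family of extensions which satisfies it. Condition. For all $n\ge 1$ and all $\tilde z=(\tilde z_1,\dots,\tilde z_n)\in(\mathbb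 C^\times)^n$ there is an open neighbourhood $N_{\tilde z}$ of $\tilde z$ in $(\mathbb C^\times)^n$, with $\mathrm{Re}(z_k\tilde z_k^{-1})>0$ for all $z\in N_{\tilde z}$ and $k=1,\dots,n$, and for all $m\ge1$ there are functions $G_m(x_1,\dots,x_m;u_1,\dots,u_m)$, such that for all $n$, $\tilde z$ and all $z\in N_{\tilde z}$ $$F_n(z_1,\dots,z_n)=\sum G_m\bigl(z_{a_0+1}+\cdots+z_{a_1},\dots,z_{a_{m-1}+1}+\cdots+z_{a_m};\ \tilde z_{a_0+1}+\cdots+\tilde z_{a_1},\dots,\tilde z_{a_{m-1}+1}+\cdots+\tilde z_{a_m}\bigr)\prod_{k=1}^m U_k,$$ where the sum is over all $m=1,\dots,n$, $0=a_0<a_1<\cdots<a_m=n$ and $c_1,\dots,c_m\in[0,2\pi)$ such that $\tilde z_a\in e^{ic_k}(0,\infty)$ whenever $a_{k-1}<a\le a_k$, and $$U_k=\sum\frac{(-1)^{l-1}}{l}\prod_{c=1}^{p}\frac1{|\psi^{-1}(c)|!}$$ is the sum over all $1\le l\le p\le a_k-a_{k-1}$ and all weakly increasing surjections $\psi:\{a_{k-1}+1,\dots,a_k\}\to\{1,\dots,p\}$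 and $\xi:\{1,\dots,p\}\to\{1,\dots,l\}$ such that $\psi(a)=\psi(b)$ implies $\arg z_a=\arg z_b$, and $\psi(a)<\psi(b)$ together with $\xi(\psi(a))=\xi(\psi(b))$ implies $\arg z_a>\arg z_b$, with $\arg z_a,\arg z_b$ taken in $(c_k-\pi/2,c_k+\pi/2)$. Moreover, for every $m\ge1$ and every fixed $u\in(\mathbb C^\times)^m$, the function $x\mapsto G_m(x;u)$ is continuous and holomorphic on the set of all $x$ for which $G_m(x;u)$ occurs in one of these formulas (for some $n$, $\tilde z$, $z\in N_{\tilde z}$ and $a_0,\dots,a_m$). -/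

import Mathlib

noncomputable section

namespace HolGen

/-- A family of functions of `n` complex variables, one for each `n`. Only the indices `n ≥ 1` and
the values on the domains considered below are ever used. -/
abbrev Family : Type := (n : ℕ) → (Fin n → ℂ) → ℂ

/-- The open ray `(0, ∞)` inside `ℂ`. -/
def posRay : Set ℂ := {w | ∃ r : ℝ, 0 < r ∧ w = (r : ℂ)}

/-- `(ℂ^×)^n` as a subset of `ℂ^n`. -/
def puncturedSpace (n : ℕ) : Set (Fin n → ℂ) := {z | ∀ k, z k ≠ 0}

/-- The open dense set of all `(z_1, …, z_n)` in `(ℂ^×)^n` with `z_{k+1} / z_k ∉ (0, ∞)` for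
`1 ≤ k < n`. -/
def slitDomain (n : ℕ) : Set (Fin n → ℂ) :=
  {z | z ∈ puncturedSpace n ∧ ∀ i j : Fin n, (j : ℕ) = (i : ℕ) + 1 → z j / z i ∉ posRay}

/-- The tuple `(z_{s+1}, …, z_{s+p})` (used only for `s + p ≤ n`). -/
def slice {n : ℕ} (z : Fin n → ℂ) (s p : ℕ) : Fin p → ℂ :=
  fun i => if h : s + (i : ℕ) < n then z ⟨s + (i : ℕ), h⟩ else 0

/-- `z_1 + ⋯ + z_k`. -/
def headSum {n : ℕ} (z : Fin n → ℂ) (k : ℕ) : ℂ := ∑ i, slice z 0 k i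

/-- `z_{k+1} + ⋯ + z_n`. -/
def tailSum {n : ℕ} (z : Fin n → ℂ) (k : ℕ) : ℂ := ∑ i, slice z k (n - k) i

/-- The conditions that characterize the functions `F_n` on `slitDomain n`: they are holomorphic,
`F_1 ≡ 1 / (2πi)`, `F_n` vanishes where `z_1 + ⋯ + z_n = 0`, and
`dF_n = ∑_{k=1}^{n-1} F_k(z_1, …, z_k) F_{n-k}(z_{k+1}, …, z_n)`
`⬝ [(dz_{k+1} + ⋯ + dz_n)/(z_{k+1} + ⋯ + z_n) - (dz_1 + ⋯ + dz_k)/(z_1 + ⋯ + z_k)]`.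
The 1-forms are evaluated on an arbitrary tangent vector `v`. The equation is imposed at the points
of the (dense, open) subset where no denominator vanishes; elsewhere its right hand side only has
a meaning by continuity. -/
structure IsPdeFamily (F : Family) : Prop where
  holomorphic : ∀ n, 1 ≤ n → DifferentiableOn ℂ (F n) (slitDomain n)
  first : ∀ z ∈ slitDomain 1, F 1 z = (2 * (Real.pi : ℂ) * Complex.I)⁻¹
  vanish : ∀ n, 1 ≤ n → ∀ z ∈ slitDomain n, ∑ i, z i = 0 → F n z = 0
  pde : ∀ n, 1 ≤ n → ∀ z ∈ slitDomain n,
    (∀ k ∈ Finset.Ico 1 n, headSum z k ≠ 0 ∧ tailSum z k ≠ 0) →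
    ∀ v : Fin n → ℂ, fderiv ℂ (F n) z v =
      ∑ k ∈ Finset.Ico 1 n, F k (slice z 0 k) * F (n - k) (slice z k (n - k)) *
        (tailSum v k / tailSum z k - headSum v k / headSum z k)

/-- A sequence `0 = a_0 < a_1 < ⋯ < a_m = n` is a composition `c` of `n` into `m = c.length` blocks
`{a_{k-1}+1, …, a_k}`. This is the tuple of block sums `z_{a_{k-1}+1} + ⋯ + z_{a_k}`. -/
def blockSum {n : ℕ} (c : Composition n) (z : Fin n → ℂ) : Fin c.length → ℂ :=
  fun k => ∑ j : Fin (c.blocksFun k), z (c.embedding k j)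

/-- Within each block `k` of `c` all the `z_a` lie on one open ray `e^{i c_k} (0, ∞)`. For nonzero
`z_a` such a `c_k ∈ [0, 2π)` is unique. -/
def Aligned {n : ℕ} (c : Composition n) (z : Fin n → ℂ) : Prop :=
  ∀ a b : Fin n, c.index a = c.index b → z b / z a ∈ posRay

open Classical in
/-- The coefficient
`∑ (-1)^(l-1) / l * ∏_{c=1}^m 1 / |ψ⁻¹(c)|!`
over all `1 ≤ l ≤ m ≤ p` and all monotone surjections `ψ : {1..p} → {1..m}`, `ξ : {1..m} → {1..l}`
such that `ψ a = ψ b` implies `θ a = θ b`, and `ψ a < ψ b` with `ξ (ψ a) = ξ (ψ b)` implies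
`θ a > θ b`. Here `θ a` is the argument of the `a`-th variable. -/
def coeff {p : ℕ} (θ : Fin p → ℝ) : ℚ :=
  ∑ m ∈ Finset.Icc 1 p, ∑ l ∈ Finset.Icc 1 m, ∑ ψ : Fin p → Fin m, ∑ ξ : Fin m → Fin l,
    if Function.Surjective ψ ∧ Function.Surjective ξ ∧ Monotone ψ ∧ Monotone ξ ∧
        (∀ a b, ψ a = ψ b → θ a = θ b) ∧
        (∀ a b, ψ a < ψ b → ξ (ψ a) = ξ (ψ b) → θ b < θ a)
    then (-1 : ℚ) ^ (l - 1) / (l : ℚ) *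
      ∏ i : Fin m, (1 : ℚ) / ((Finset.univ.filter fun a => ψ a = i).card.factorial : ℚ)
    else 0

/-- The arguments of the variables `z_a` in block `k`, shifted by `-c_k`: if `w_a` (the base point)
is in `e^{i c_k} (0, ∞)` and `Re (z_a / w_a) > 0`, then `Complex.arg (z_a / w_a)` is
`arg z_a - c_k`, where `arg z_a` is taken in `(c_k - π/2, c_k + π/2)`. -/
def blockArg {n : ℕ} (c : Composition n) (w z : Fin n → ℂ) (k : Fin c.length) :
    Fin (c.blocksFun k) → ℝ :=
  fun j => Complex.arg (z (c.embedding k j) / w (c.embedding k j))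

open Classical in
/-- The right hand side of the transformation formula at `z`, with base point `w`. The local
functions are written `G m w z` for `G_m(z_1, …, z_m; w_1, …, w_m)`. -/
def transformSum (G : (m : ℕ) → (Fin m → ℂ) → (Fin m → ℂ) → ℂ) (n : ℕ) (w z : Fin n → ℂ) : ℂ :=
  ∑ c : Composition n, if Aligned c w then
      G c.length (blockSum c w) (blockSum c z) *
        ∏ k : Fin c.length, ((coeff (blockArg c w z k) : ℚ) : ℂ)
    else 0

/-- `Required N m u x` says that `G_m(x; u)` occurs in the transformation formula for some `n`,
some base point `w ∈ (ℂ^×)^n` and some `z` in the neighbourhood `N n w` of `w`. -/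
inductive Required (N : (n : ℕ) → (Fin n → ℂ) → Set (Fin n → ℂ)) :
    (m : ℕ) → (Fin m → ℂ) → (Fin m → ℂ) → Prop
  | mk (n : ℕ) (hn : 1 ≤ n) (w : Fin n → ℂ) (hw : w ∈ puncturedSpace n) (z : Fin n → ℂ)
      (hz : z ∈ N n w) (c : Composition n) (hc : Aligned c w) :
      Required N c.length (blockSum c w) (blockSum c z)

/-- The condition on a family of functions `F_n : (ℂ^×)^n → ℂ`, `n ≥ 1`, for the generating
functions built from it to be continuous and holomorphic: there are open neighbourhoods `N n w` of
all points `w ∈ (ℂ^×)^n`, and functions `G_m(⬝; u)`, continuous and holomorphic on the set of all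
points where they are required, such that the transformation formula holds on each `N n w`. -/
def TransformCondition (F : Family) : Prop :=
  ∃ (N : (n : ℕ) → (Fin n → ℂ) → Set (Fin n → ℂ))
    (G : (m : ℕ) → (Fin m → ℂ) → (Fin m → ℂ) → ℂ),
    (∀ n, 1 ≤ n → ∀ w ∈ puncturedSpace n,
      IsOpen (N n w) ∧ w ∈ N n w ∧ N n w ⊆ puncturedSpace n ∧
      (∀ z ∈ N n w, ∀ k, 0 < (z k * (w k)⁻¹).re) ∧
      (∀ z ∈ N n w, F n z = transformSum G n w z)) ∧
    (∀ m, 1 ≤ m → ∀ u ∈ puncturedSpace m,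
      ContinuousOn (G m u) {x | Required N m u x} ∧
      DifferentiableOn ℂ (G m u) {x | Required N m u x})

/-- `E` extends the functions `F_n`, defined on `slitDomain n`. -/
def Extends (E F : Family) : Prop :=
  ∀ n, 1 ≤ n → Set.EqOn (E n) (F n) (slitDomain n)

end HolGen

end

/-!
The functions are given explicitly. For `(z_1, …, z_n)` in `slitDomain n` let `u_i` run through the
ray `z_i⁻¹ (0, ∞)`; adjacent rays are distinct, so `h(z) = ∫ exp (-(z_1 u_1 + ⋯ + z_n u_n)) ∏_{i<n}
1 / (u_i - u_{i+1}) du_1 ⋯ du_n` converges, and `F_n(z) = (z_1 + ⋯ + z_n) h(z) / (2πi)^n`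
(`rayIter`, `rayValue`). The integral does not change when the rays are turned, as long as adjacent
rays do not meet and the exponential decays, so it is holomorphic; it is homogeneous of degree
`-1`, and differentiating it in a direction `v` with `∑ v_i = 0` produces factors `u_k - u_{k+1}`
that cancel one denominator and split the integral into a product (`hasDerivAt_rayIter`). Together
these two facts are the differential equation (`isPdeFamily_extFamily`).

When one ray is turned across the next one, the residue of `1 / (u_i - u_{i+1})` merges the two
variables: up to a factor `2πi`, the difference is the integral in which `z_i, z_{i+1}` are
replaced by their sum. At a point `w` with aligned neighbours, tilt the rays slightly so that
within each run of aligned neighbours the angles increase; this defines a function `upValue` of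
`(w, z)`, holomorphic in `z` near `w`, and every other choice of tilts is a combination of values
of `upValue` at merged arguments (`rayValue_eq_blockOp`). The local functions `G_m(x; u)` are the
combinations `localFun` of these values over all mergings of aligned blocks, with coefficient
`(-1)^(p-1) / p!` for a block of length `p`, and the extension is `F_n(z) = G_n(z; z)`.

The combinatorics is that of the operators `blockOp σ κ`, which sum over all ways to cut a list
into blocks, weight each block by `κ` and replace it by its total `σ`. Such operators compose
(`blockOp_blockOp`), so the transformation formula amounts to an identity between weights, the
coefficients `coeff` on one side and the wall-crossing signs on the other
(`blockOp_alignWeight_upSign`, `localFun_diag`, `transformCondition_extFamily`).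

Uniqueness on `slitDomain n`: by induction the differential equation fixes the derivative off
finitely many hyperplanes, hence everywhere (`fderiv_eq_zero_of_off_hyperplanes`); the domain is
connected, and it contains points with vanishing coordinate sum, given by roots of unity
(`eqOn_of_isPdeFamily`). Uniqueness of the extension: in the transformation formula at the base
point `u` the function `G_m(⬝; u)` occurs with coefficient one and the other terms involve fewer
variables, so by induction on `m` its values near `u` are determined on a dense set and, by
continuity, everywhere near `u` (`eqOn_of_transformCondition`).
-/

namespace HolGen

open MeasureTheory Filter Topology Set

/-! ### Integrals depending holomorphically on parameters -/

lemma norm_fderiv_le_of_norm_le {E : Type*} [NormedAddCommGroup E] [NormedSpace ℂ E]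
    {f : E → ℂ} {x : E} {r C : ℝ} (hr : 0 < r)
    (hf : ∀ y ∈ Metric.closedBall x r, DifferentiableAt ℂ f y)
    (hC : ∀ y ∈ Metric.closedBall x r, ‖f y‖ ≤ C) : ‖fderiv ℂ f x‖ ≤ C / r := by
  have hC0 : 0 ≤ C := (norm_nonneg _).trans (hC x (Metric.mem_closedBall_self hr.le))
  refine ContinuousLinearMap.opNorm_le_of_unit_norm (𝕜 := ℂ) (by positivity) fun v hv => ?_
  have hmem : ∀ s : ℂ, ‖s‖ ≤ r → x + s • v ∈ Metric.closedBall x r := fun s hs => by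
    simpa [Metric.mem_closedBall, norm_smul, hv] using hs
  have hd : ∀ s : ℂ, ‖s‖ ≤ r → HasDerivAt (fun s : ℂ => f (x + s • v))
      (fderiv ℂ f (x + s • v) v) s := fun s hs => by
    have h1 : HasDerivAt (fun s : ℂ => x + s • v) v s := by
      simpa using ((hasDerivAt_id s).smul_const v).const_add x
    exact (hf _ (hmem s hs)).hasFDerivAt.comp_hasDerivAt s h1
  have h0 := (hd 0 (by simpa using hr.le)).deriv
  simp only [zero_smul, add_zero] at h0
  rw [← h0]
  refine Complex.norm_deriv_le_of_forall_mem_sphere_norm_le hr ?_ ?_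
  · refine DifferentiableOn.diffContOnCl fun s hs => ?_
    rw [closure_ball _ hr.ne', mem_closedBall_zero_iff] at hs
    exact (hd s hs).differentiableAt.differentiableWithinAt
  · intro s hs
    exact hC _ (hmem s (by simpa using (mem_sphere_zero_iff_norm.1 hs).le))

lemma aestronglyMeasurable_fderiv_apply {E : Type*} [NormedAddCommGroup E] [NormedSpace ℂ E]
    {α : Type*} [MeasurableSpace α] {μ : Measure α} {f : E → α → ℂ} {x : E} {U : Set E}
    (hU : U ∈ 𝓝 x) (hmeas : ∀ y ∈ U, AEStronglyMeasurable (f y) μ)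
    (hdiff : ∀ᵐ a ∂μ, DifferentiableAt ℂ (fun y => f y a) x) (v : E) :
    AEStronglyMeasurable (fun a => fderiv ℂ (fun y => f y a) x v) μ := by
  let u : ℕ → ℂ := fun n => ((n : ℂ) + 1)⁻¹
  have hu : Tendsto u atTop (𝓝 0) := by
    have := (tendsto_one_div_add_atTop_nhds_zero_nat (𝕜 := ℂ))
    simpa [u] using this
  have hu0 : ∀ n, u n ≠ 0 := fun n => inv_ne_zero (by exact_mod_cast n.succ_ne_zero)
  have hin : ∀ᶠ n in atTop, x + u n • v ∈ U := by
    have : Tendsto (fun n => x + u n • v) atTop (𝓝 (x + (0 : ℂ) • v)) :=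
      tendsto_const_nhds.add (hu.smul_const v)
    rw [zero_smul, add_zero] at this
    exact this hU
  obtain ⟨n0, hn0⟩ := eventually_atTop.1 hin
  refine aestronglyMeasurable_of_tendsto_ae (u := atTop)
    (f := fun (n : ℕ) a => (u (n + n0))⁻¹ • (f (x + u (n + n0) • v) a - f x a)) ?_ ?_
  · intro n
    exact AEStronglyMeasurable.const_smul
      ((hmeas _ (hn0 _ (Nat.le_add_left _ _))).sub (hmeas _ (mem_of_mem_nhds hU)))
      ((u (n + n0))⁻¹)
  · filter_upwards [hdiff] with a ha
    have h1 : HasDerivAt (fun s : ℂ => f (x + s • v) a) (fderiv ℂ (fun y => f y a) x v) 0 := by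
      have h2 : HasDerivAt (fun s : ℂ => x + s • v) v 0 := by
        simpa using ((hasDerivAt_id (0 : ℂ)).smul_const v).const_add x
      have h3 : HasFDerivAt (fun y => f y a) (fderiv ℂ (fun y => f y a) x) (x + (0 : ℂ) • v) := by
        simpa using ha.hasFDerivAt
      exact h3.comp_hasDerivAt (0 : ℂ) h2
    have h4 := h1.tendsto_slope_zero
    have h5 : Tendsto (fun n : ℕ => u (n + n0)) atTop (𝓝[≠] 0) :=
      tendsto_nhdsWithin_iff.2 ⟨hu.comp (tendsto_add_atTop_nat n0),
        Eventually.of_forall fun n => hu0 _⟩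
    simpa [Function.comp_def] using h4.comp h5

/-- An integral of holomorphic functions of finitely many variables which are dominated, locally
uniformly, by one integrable function is holomorphic, and may be differentiated under the integral
sign. The derivative of the integrand needs no bound, by the Cauchy estimates. -/
theorem hasFDerivAt_integral_of_differentiable {E : Type*} [NormedAddCommGroup E]
    [NormedSpace ℂ E] [FiniteDimensional ℂ E]
    {α : Type*} [MeasurableSpace α] {μ : Measure α} {f : E → α → ℂ} {x : E} {U : Set E}
    {g : α → ℝ} (hU : U ∈ 𝓝 x) (hmeas : ∀ y ∈ U, AEStronglyMeasurable (f y) μ)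
    (hdiff : ∀ᵐ a ∂μ, ∀ y ∈ U, DifferentiableAt ℂ (fun y => f y a) y)
    (hbound : ∀ᵐ a ∂μ, ∀ y ∈ U, ‖f y a‖ ≤ g a) (hg : Integrable g μ) :
    Integrable (fun a => fderiv ℂ (fun y => f y a) x) μ ∧
      HasFDerivAt (fun y => ∫ a, f y a ∂μ) (∫ a, fderiv ℂ (fun y => f y a) x ∂μ) x := by
  obtain ⟨r, hr, hrU⟩ := Metric.mem_nhds_iff.1 hU
  have hxU := mem_of_mem_nhds hU
  have hsub : ∀ y ∈ Metric.ball x (r / 2), ∀ z ∈ Metric.closedBall y (r / 3), z ∈ U := by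
    intro y hy z hz
    apply hrU
    rw [Metric.mem_ball] at hy ⊢
    rw [Metric.mem_closedBall] at hz
    linarith [dist_triangle z y x]
  have hnb : Metric.ball x (r / 2) ∈ 𝓝 x := Metric.ball_mem_nhds _ (by positivity)
  have hF'm : AEStronglyMeasurable (fun a => fderiv ℂ (fun y => f y a) x) μ := by
    let b := Module.finBasis ℂ E
    let A : Fin (Module.finrank ℂ E) → (E →L[ℂ] ℂ) := fun i =>
      LinearMap.toContinuousLinearMap (b.coord i)
    have hdec : ∀ L : E →L[ℂ] ℂ, L = ∑ i, (L (b i)) • A i := by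
      intro L
      ext v
      conv_lhs => rw [← b.sum_repr v, map_sum]
      simp [A, mul_comm]
    have : (fun a => fderiv ℂ (fun y => f y a) x) =
        fun a => ∑ i, (fderiv ℂ (fun y => f y a) x (b i)) • A i := by
      funext a
      exact hdec _
    rw [this]
    refine Finset.aestronglyMeasurable_fun_sum _ fun i _ => ?_
    exact (aestronglyMeasurable_fderiv_apply hU hmeas
      (hdiff.mono fun a ha => ha x hxU) (b i)).smul_const _
  have key := hasFDerivAt_integral_of_dominated_loc_of_lip' (𝕜 := ℂ) (F := f) (x₀ := x)
    (bound := fun a => g a / (r / 3)) (F' := fun a => fderiv ℂ (fun y => f y a) x) (μ := μ) hnb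
    (fun y hy => hmeas y (hsub y hy y (Metric.mem_closedBall_self (by positivity))))
    (hg.mono' (hmeas x hxU) (hbound.mono fun a ha => ha x hxU)) hF'm ?_ (hg.div_const _)
    (hdiff.mono fun a ha => (ha x hxU).hasFDerivAt)
  · exact key
  · filter_upwards [hdiff, hbound] with a h1 h2 y hy
    refine (convex_ball x (r / 2)).norm_image_sub_le_of_norm_fderiv_le (𝕜 := ℂ)
      (fun z hz => h1 z (hsub z hz z (Metric.mem_closedBall_self (by positivity))))
      (fun z hz => ?_) (Metric.mem_ball_self (by positivity)) hy
    exact norm_fderiv_le_of_norm_le (by positivity) (fun w hw => h1 w (hsub z hz w hw))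
      (fun w hw => h2 w (hsub z hz w hw))

theorem hasDerivAt_integral_of_differentiable
    {α : Type*} [MeasurableSpace α] {μ : Measure α} {f : ℂ → α → ℂ} {x : ℂ} {U : Set ℂ}
    {g : α → ℝ} (hU : U ∈ 𝓝 x) (hmeas : ∀ y ∈ U, AEStronglyMeasurable (f y) μ)
    (hdiff : ∀ᵐ a ∂μ, ∀ y ∈ U, DifferentiableAt ℂ (fun y => f y a) y)
    (hbound : ∀ᵐ a ∂μ, ∀ y ∈ U, ‖f y a‖ ≤ g a) (hg : Integrable g μ) :
    Integrable (fun a => deriv (fun y => f y a) x) μ ∧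
      HasDerivAt (fun y => ∫ a, f y a ∂μ) (∫ a, deriv (fun y => f y a) x ∂μ) x := by
  obtain ⟨h1, h2⟩ := hasFDerivAt_integral_of_differentiable hU hmeas hdiff hbound hg
  refine ⟨?_, ?_⟩
  · simpa only [← fderiv_apply_one_eq_deriv] using h1.apply_continuousLinearMap 1
  · have := h2.hasDerivAt
    rw [ContinuousLinearMap.integral_apply h1] at this
    simpa only [← fderiv_apply_one_eq_deriv] using this

/-! ### Iterated integrals along rays -/

/-- For `x = (d, z)`, the integral `∫ exp (-z u) g u du` along the ray `d (0, ∞)`. -/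
noncomputable def rayInt (x : ℂ × ℂ) (g : ℂ → ℂ) : ℂ :=
  ∫ v in Ioi (0 : ℝ), x.1 * Complex.exp (-(x.2 * (x.1 * v))) * g (x.1 * v)

/-- The iterated integral `∫ exp (-∑ z_i u_i) / ((t - u_1) (u_1 - u_2) ⋯ (u_{n-1} - u_n)) du`
over `u_i ∈ d_i (0, ∞)`, for a list of pairs `(d_i, z_i)`. -/
noncomputable def rayKernel : List (ℂ × ℂ) → ℂ → ℂ
  | [], _ => 1
  | x :: L, t => rayInt x fun u => rayKernel L u * (t - u)⁻¹

/-- The iterated integral `∫ exp (-∑ z_i u_i) / ((u_1 - u_2) ⋯ (u_{n-1} - u_n)) du` over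
`u_i ∈ d_i (0, ∞)`, for a nonempty list of pairs `(d_i, z_i)`. -/
noncomputable def rayIter : List (ℂ × ℂ) → ℂ
  | [] => 0
  | x :: L => rayInt x (rayKernel L)

/-- The directions `x` and `y` are different, quantitatively. -/
def Separated (c : ℝ) (x y : ℂ) : Prop :=
  ∀ a b : ℝ, 0 ≤ a → 0 ≤ b → c * (a + b) ≤ ‖(a : ℂ) * x - b * y‖

/-- `t` is not on the closed ray `d [0, ∞)`. -/
def OffRay (t d : ℂ) : Prop := ∀ r : ℝ, 0 ≤ r → t ≠ r * d

/-- Quantitative form of `Admissible`. -/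
def SepChain (c : ℝ) : ℂ → List (ℂ × ℂ) → Prop
  | _, [] => True
  | t, x :: L => Separated c t x.1 ∧ c ≤ (x.2 * x.1).re ∧ ‖x.1‖ ≤ c⁻¹ ∧ SepChain c x.1 L

/-- The conditions on `t` and on a list of pairs `(d_i, z_i)` for `rayKernel` to converge:
`exp (-z_i u)` decays along the ray through `d_i`, and consecutive rays are distinct. -/
def Admissible : ℂ → List (ℂ × ℂ) → Prop
  | _, [] => True
  | t, x :: L => OffRay t x.1 ∧ 0 < (x.2 * x.1).re ∧ Admissible x.1 L

/-- The conditions on a list of pairs `(d_i, z_i)` for `rayIter` to converge. -/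
def AdmissibleList : List (ℂ × ℂ) → Prop
  | [] => True
  | x :: L => 0 < (x.2 * x.1).re ∧ Admissible x.1 L

lemma ne_zero_of_re_mul_pos {z d : ℂ} (h : 0 < (z * d).re) : d ≠ 0 := by
  rintro rfl; simp at h

lemma OffRay.symm {t d : ℂ} (h : OffRay t d) (hd : d ≠ 0) : OffRay d t := by
  intro r hr he
  rcases hr.eq_or_lt with rfl | hr
  · simp at he; exact hd he
  · refine h r⁻¹ (by positivity) ?_
    have : (r : ℂ) ≠ 0 := by exact_mod_cast hr.ne'
    rw [he]; push_cast
    field_simp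

lemma OffRay.smul_left {t d : ℂ} (h : OffRay t d) {a : ℝ} (ha : 0 < a) : OffRay (t * a) d := by
  intro r hr he
  refine h (r / a) (by positivity) ?_
  have : (a : ℂ) ≠ 0 := by exact_mod_cast ha.ne'
  push_cast
  field_simp
  linear_combination he

lemma OffRay.smul_right {t d : ℂ} (h : OffRay t d) {a : ℝ} (ha : 0 < a) : OffRay t (d * a) := by
  intro r hr he
  refine h (r * a) (by positivity) ?_
  rw [he]; push_cast; ring

lemma OffRay.sub_ne_zero {t d : ℂ} (h : OffRay t d) {v : ℝ} (hv : 0 ≤ v) : t - d * v ≠ 0 := by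
  intro he
  exact h v hv (by linear_combination he)

lemma Admissible.smul {t : ℂ} {L : List (ℂ × ℂ)} (h : Admissible t L) {a : ℝ} (ha : 0 < a) :
    Admissible (t * a) L := by
  cases L with
  | nil => trivial
  | cons x L => exact ⟨h.1.smul_left ha, h.2⟩

lemma Separated.offRay {c : ℝ} {t d : ℂ} (hc : 0 < c) (h : Separated c t d) : OffRay t d := by
  intro r hr he
  have := h 1 r zero_le_one hr
  rw [he] at this
  simp at this
  nlinarith

lemma Separated.mono {c c' : ℝ} {t d : ℂ} (hc : c' ≤ c) (h : Separated c t d) :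
    Separated c' t d := fun a b ha hb =>
  (mul_le_mul_of_nonneg_right hc (add_nonneg ha hb)).trans (h a b ha hb)

lemma SepChain.mono {c c' : ℝ} (hc' : 0 < c') (hc : c' ≤ c) {L : List (ℂ × ℂ)} :
    ∀ {t : ℂ}, SepChain c t L → SepChain c' t L := by
  induction L with
  | nil => intros; trivial
  | cons x L ih =>
    rintro t ⟨h1, h2, h3, h4⟩
    exact ⟨h1.mono hc, hc.trans h2, h3.trans (inv_anti₀ hc' hc), ih h4⟩

lemma SepChain.admissible {c : ℝ} (hc : 0 < c) {L : List (ℂ × ℂ)} :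
    ∀ {t : ℂ}, SepChain c t L → Admissible t L := by
  induction L with
  | nil => intros; trivial
  | cons x L ih =>
    rintro t ⟨h1, h2, h3, h4⟩
    exact ⟨h1.offRay hc, hc.trans_le h2, ih h4⟩

lemma OffRay.exists_separated {t d : ℂ} (h : OffRay t d) (hd : d ≠ 0) :
    ∃ c > 0, Separated c t d := by
  have hpos : ∀ a ∈ Icc (0 : ℝ) 1, 0 < ‖(a : ℂ) * t - (1 - a : ℝ) * d‖ := by
    rintro a ⟨h0, h1⟩
    rw [norm_pos_iff]
    intro he
    rcases h0.eq_or_lt with rfl | h0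
    · simp at he; exact hd he
    · refine h ((1 - a) / a) (div_nonneg (by linarith) h0.le) ?_
      have : (a : ℂ) ≠ 0 := by exact_mod_cast h0.ne'
      push_cast at he ⊢
      field_simp
      linear_combination he
  obtain ⟨a0, ha0, hmin⟩ := isCompact_Icc.exists_isMinOn (nonempty_Icc.2 zero_le_one)
    (f := fun a : ℝ => ‖(a : ℂ) * t - (1 - a : ℝ) * d‖) (by fun_prop)
  refine ⟨_, hpos a0 ha0, fun a b ha hb => ?_⟩
  rcases (add_nonneg ha hb).eq_or_lt with h0 | h0
  · rw [← h0]; simp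
  · have h1 := hmin (show a / (a + b) ∈ Icc (0 : ℝ) 1 from
      ⟨by positivity, (div_le_one h0).2 (by linarith)⟩)
    simp only [mem_ofPred_eq] at h1
    have h2 : (a : ℂ) * t - b * d = ((a + b : ℝ) : ℂ) *
        (((a / (a + b) : ℝ) : ℂ) * t - (1 - a / (a + b) : ℝ) * d) := by
      have : (a : ℂ) + b ≠ 0 := by exact_mod_cast h0.ne'
      push_cast
      field_simp
      ring
    rw [h2, norm_mul, Complex.norm_real, Real.norm_of_nonneg h0.le, mul_comm]
    exact mul_le_mul_of_nonneg_left h1 h0.le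

lemma OffRay.eventually_separated {X : Type*} [TopologicalSpace X] {t d : X → ℂ} {x : X}
    (h : OffRay (t x) (d x)) (hd : d x ≠ 0) (ht : ContinuousAt t x) (hd' : ContinuousAt d x) :
    ∃ c > 0, ∀ᶠ y in 𝓝 x, Separated c (t y) (d y) := by
  obtain ⟨c, hc, hs⟩ := h.exists_separated hd
  refine ⟨c / 2, by positivity, ?_⟩
  have h1 := Metric.continuousAt_iff'.1 ht (c / 2) (by positivity)
  have h2 := Metric.continuousAt_iff'.1 hd' (c / 2) (by positivity)
  filter_upwards [h1, h2] with y h1 h2 a b ha hb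
  rw [dist_eq_norm] at h1 h2
  have h3 := hs a b ha hb
  have h4 : (a : ℂ) * t x - b * d x =
      ((a : ℂ) * t y - b * d y) - (a * (t y - t x) - b * (d y - d x)) := by ring
  have h5 : ‖(a : ℂ) * (t y - t x) - b * (d y - d x)‖ ≤ a * (c / 2) + b * (c / 2) := by
    refine (norm_sub_le _ _).trans ?_
    rw [norm_mul, norm_mul, Complex.norm_real, Complex.norm_real, Real.norm_of_nonneg ha,
      Real.norm_of_nonneg hb]
    gcongr
  rw [h4] at h3
  have h6 := norm_sub_le ((a : ℂ) * t y - b * d y) (a * (t y - t x) - b * (d y - d x))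
  linarith

/-- The value at `y` of a list of pairs of functions. -/
def evalList {Y : Type*} (L : List ((Y → ℂ) × (Y → ℂ))) (y : Y) : List (ℂ × ℂ) :=
  L.map fun q => (q.1 y, q.2 y)

lemma Admissible.eventually_sepChain {X : Type*} [TopologicalSpace X] {x : X}
    {L : List ((X → ℂ) × (X → ℂ))} :
    ∀ {t : X → ℂ}, ContinuousAt t x → (∀ q ∈ L, ContinuousAt q.1 x ∧ ContinuousAt q.2 x) →
    Admissible (t x) (evalList L x) → ∃ c > 0, ∀ᶠ y in 𝓝 x, SepChain c (t y) (evalList L y) := by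
  induction L with
  | nil => intro t _ _ _; exact ⟨1, one_pos, Eventually.of_forall fun _ => trivial⟩
  | cons q L ih =>
    intro t ht hL h
    obtain ⟨h1, h2, h3⟩ := h
    obtain ⟨hq1, hq2⟩ := hL q (by simp)
    obtain ⟨c1, hc1, he1⟩ := h1.eventually_separated (ne_zero_of_re_mul_pos h2) ht hq1
    obtain ⟨c2, hc2, he2⟩ := ih hq1 (fun q' hq' => hL q' (by simp [hq'])) h3
    have hre : ContinuousAt (fun y => (q.2 y * q.1 y).re) x :=
      Complex.continuous_re.continuousAt.comp (hq2.mul hq1)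
    have he3 : ∀ᶠ y in 𝓝 x, (q.2 x * q.1 x).re / 2 < (q.2 y * q.1 y).re :=
      hre.eventually (lt_mem_nhds (half_lt_self h2))
    have he4 : ∀ᶠ y in 𝓝 x, ‖q.1 y‖ < ‖q.1 x‖ + 1 :=
      hq1.norm.eventually (gt_mem_nhds (lt_add_one _))
    refine ⟨min (min c1 c2) (min ((q.2 x * q.1 x).re / 2) (‖q.1 x‖ + 1)⁻¹), ?_, ?_⟩
    · have : 0 < (q.2 x * q.1 x).re := h2
      positivity
    · filter_upwards [he1, he2, he3, he4] with y e1 e2 e3 e4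
      have hpos : 0 < min (min c1 c2) (min ((q.2 x * q.1 x).re / 2) (‖q.1 x‖ + 1)⁻¹) := by
        have : 0 < (q.2 x * q.1 x).re := h2
        positivity
      refine ⟨e1.mono (by simp), ((min_le_right _ _).trans (min_le_left _ _)).trans e3.le, ?_,
        e2.mono hpos (by simp)⟩
      refine e4.le.trans ?_
      rw [le_inv_comm₀ (by positivity) hpos]
      exact (min_le_right _ _).trans (min_le_right _ _)

/-! ### Bounds for the iterated integrals -/

lemma integrableOn_rpow_mul_exp {c s : ℝ} (hc : 0 < c) (hs : -1 < s) :
    IntegrableOn (fun v : ℝ => v ^ s * Real.exp (-c * v)) (Ioi 0) := by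
  have := integrableOn_rpow_mul_exp_neg_mul_rpow (p := 1) hs one_pos hc
  simpa using this

/-- The dominating function for all integrands along rays. -/
noncomputable def rayBound (c β v : ℝ) : ℝ := (1 + v ^ (-β)) * Real.exp (-c * v)

lemma integrableOn_rayBound {c β : ℝ} (hc : 0 < c) (hβ : β < 1) :
    IntegrableOn (rayBound c β) (Ioi 0) := by
  have h1 := integrableOn_rpow_mul_exp (s := 0) hc (by norm_num)
  have h2 := integrableOn_rpow_mul_exp (s := -β) hc (by linarith)
  refine (h1.add h2).congr_fun (fun v _ => ?_) measurableSet_Ioi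
  simp [rayBound]; ring

lemma norm_exp_neg_mul_le {c v : ℝ} {z d : ℂ} (h : c ≤ (z * d).re) (hv : 0 ≤ v) :
    ‖Complex.exp (-(z * (d * v)))‖ ≤ Real.exp (-c * v) := by
  rw [Complex.norm_exp]
  apply Real.exp_le_exp.2
  have : (-(z * (d * v))).re = -((z * d).re * v) := by
    rw [← mul_assoc, Complex.neg_re, Complex.re_mul_ofReal]
  rw [this]
  nlinarith

lemma norm_rayInt_integrand_le {c β v A : ℝ} {x : ℂ × ℂ} {g : ℂ} (hv : 0 < v)
    (h1 : c ≤ (x.2 * x.1).re) (h2 : ‖x.1‖ ≤ c⁻¹) (hg : ‖g‖ ≤ A * (1 + v ^ (-β))) :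
    ‖x.1 * Complex.exp (-(x.2 * (x.1 * v))) * g‖ ≤ c⁻¹ * A * rayBound c β v := by
  rw [norm_mul, norm_mul]
  have h3 := norm_exp_neg_mul_le h1 hv.le
  have h0 : 0 ≤ c⁻¹ := (norm_nonneg _).trans h2
  calc ‖x.1‖ * ‖Complex.exp (-(x.2 * (x.1 * v)))‖ * ‖g‖
      ≤ c⁻¹ * Real.exp (-c * v) * (A * (1 + v ^ (-β))) := by gcongr
    _ = c⁻¹ * A * rayBound c β v := by unfold rayBound; ring

/-- The singularity of the kernel at `0` is weaker than any power, uniformly over all lists with a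
given separation constant. The induction uses `|t - u| ≥ c |t|^β |u|^(1 - β)` for the first variable
and the exponent `β / 2` for the remaining ones, which leaves the integrable power `v ^ (β / 2 - 1)`. -/
lemma norm_rayKernel_le (n : ℕ) {c : ℝ} (hc : 0 < c) :
    ∀ β : ℝ, 0 < β → β < 1 → ∃ C ≥ 0, ∀ L : List (ℂ × ℂ), L.length = n → ∀ (x : ℂ) (a : ℝ), 0 < a →
      SepChain c x L → ‖rayKernel L (x * a)‖ ≤ C * (1 + a ^ (-β)) := by
  induction n with
  | zero =>
    intro β _ _
    refine ⟨1, zero_le_one, fun L hL x a ha _ => ?_⟩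
    rw [List.length_eq_zero_iff] at hL
    subst hL
    simp only [rayKernel, norm_one, one_mul]
    have : 0 < a ^ (-β) := by positivity
    linarith
  | succ n ih =>
    intro β h0 h1
    obtain ⟨C, hC0, hC⟩ := ih (β / 2) (by positivity) (by linarith)
    let b : ℝ → ℝ := fun v => (v ^ (β - 1) + v ^ (β / 2 - 1)) * Real.exp (-c * v)
    have hb : IntegrableOn b (Ioi 0) := by
      refine ((integrableOn_rpow_mul_exp (s := β - 1) hc (by linarith)).add
        (integrableOn_rpow_mul_exp (s := β / 2 - 1) hc (by linarith))).congr_fun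
        (fun v _ => ?_) measurableSet_Ioi
      simp [b]; ring
    have hbn : 0 ≤ ∫ v in Ioi 0, b v := setIntegral_nonneg measurableSet_Ioi fun v hv => by
      have : (0 : ℝ) < v := hv
      positivity
    refine ⟨c⁻¹ * C * c⁻¹ * ∫ v in Ioi 0, b v, by positivity, fun L hL x a ha hs => ?_⟩
    obtain _ | ⟨y, L⟩ := L
    · simp at hL
    obtain ⟨hs1, hs2, hs3, hs4⟩ := hs
    have key : ‖rayKernel (y :: L) (x * a)‖ ≤
        ∫ v in Ioi 0, (c⁻¹ * C * c⁻¹ * a ^ (-β)) * b v := by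
      refine norm_integral_le_of_norm_le (hb.const_mul _) ?_
      filter_upwards [ae_restrict_mem measurableSet_Ioi] with v hv
      have hv : (0 : ℝ) < v := hv
      have e1 := hC L (by simpa using hL) y.1 v hv hs4
      have e2 : c * (a ^ β * v ^ (1 - β)) ≤ ‖x * a - y.1 * v‖ := by
        have e3 := hs1 a v ha.le hv.le
        rw [mul_comm x, mul_comm y.1]
        refine le_trans (mul_le_mul_of_nonneg_left ?_ hc.le) e3
        have := Real.geom_mean_le_arith_mean2_weighted h0.le (by linarith : (0:ℝ) ≤ 1 - β) ha.le
          hv.le (by ring)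
        nlinarith
      have e4 : ‖(x * a - y.1 * v)⁻¹‖ ≤ c⁻¹ * (a ^ (-β) * v ^ (β - 1)) := by
        rw [norm_inv]
        refine (inv_anti₀ (by positivity) e2).trans_eq ?_
        rw [mul_inv, mul_inv, ← Real.rpow_neg ha.le, ← Real.rpow_neg hv.le, neg_sub]
      have e5 := norm_exp_neg_mul_le hs2 hv.le
      rw [norm_mul, norm_mul, norm_mul]
      calc ‖y.1‖ * ‖Complex.exp (-(y.2 * (y.1 * v)))‖ *
            (‖rayKernel L (y.1 * v)‖ * ‖(x * a - y.1 * v)⁻¹‖)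
          ≤ c⁻¹ * Real.exp (-c * v) *
            ((C * (1 + v ^ (-(β / 2)))) * (c⁻¹ * (a ^ (-β) * v ^ (β - 1)))) := by gcongr
        _ = c⁻¹ * C * c⁻¹ * a ^ (-β) * b v := by
          have : v ^ (β / 2 - 1) = v ^ (-(β / 2)) * v ^ (β - 1) := by
            rw [← Real.rpow_add hv]; ring_nf
          simp only [b, this]; ring
    rw [integral_const_mul] at key
    refine key.trans ?_
    have : c⁻¹ * C * c⁻¹ * a ^ (-β) * ∫ v in Ioi 0, b v =
      (c⁻¹ * C * c⁻¹ * ∫ v in Ioi 0, b v) * a ^ (-β) := by ring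
    rw [this]
    gcongr
    linarith

/-! ### Holomorphic dependence on the parameters -/

/-- The hypotheses under which `∫ f y v dv` over `(0, ∞)` may be differentiated with respect to the
parameters `y` at `y₀`: on the neighbourhood `U` of `y₀` the integrands are holomorphic in `y` and
dominated by the integrable function `g`. -/
structure Dominated {Y : Type*} [NormedAddCommGroup Y] [NormedSpace ℂ Y] (f : Y → ℝ → ℂ)
    (y₀ : Y) (U : Set Y) (g : ℝ → ℝ) : Prop where
  mem : U ∈ 𝓝 y₀
  meas : ∀ y ∈ U, AEStronglyMeasurable (f y) (volume.restrict (Ioi 0))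
  diff : ∀ᵐ v ∂(volume.restrict (Ioi (0 : ℝ))), ∀ y ∈ U, DifferentiableAt ℂ (fun y => f y v) y
  bound : ∀ᵐ v ∂(volume.restrict (Ioi (0 : ℝ))), ∀ y ∈ U, ‖f y v‖ ≤ g v
  integrable : IntegrableOn g (Ioi 0)

lemma Dominated.differentiableAt {Y : Type*} [NormedAddCommGroup Y] [NormedSpace ℂ Y]
    [FiniteDimensional ℂ Y] {f : Y → ℝ → ℂ} {y₀ : Y} {U : Set Y} {g : ℝ → ℝ}
    (h : Dominated f y₀ U g) : DifferentiableAt ℂ (fun y => ∫ v in Ioi 0, f y v) y₀ :=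
  (hasFDerivAt_integral_of_differentiable h.mem h.meas h.diff h.bound h.integrable).2
    |>.differentiableAt

lemma Dominated.hasDerivAt {f : ℂ → ℝ → ℂ} {y₀ : ℂ} {U : Set ℂ} {g : ℝ → ℝ}
    (h : Dominated f y₀ U g) :
    IntegrableOn (fun v => deriv (fun y => f y v) y₀) (Ioi 0) ∧
    HasDerivAt (fun y => ∫ v in Ioi 0, f y v) (∫ v in Ioi 0, deriv (fun y => f y v) y₀) y₀ :=
  hasDerivAt_integral_of_differentiable h.mem h.meas h.diff h.bound h.integrable

lemma Dominated.integrableOn {Y : Type*} [NormedAddCommGroup Y] [NormedSpace ℂ Y]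
    {f : Y → ℝ → ℂ} {y₀ : Y} {U : Set Y} {g : ℝ → ℝ}
    (h : Dominated f y₀ U g) : IntegrableOn (f y₀) (Ioi 0) :=
  h.integrable.mono' (h.meas _ (mem_of_mem_nhds h.mem))
    (h.bound.mono fun _ ha => ha _ (mem_of_mem_nhds h.mem))

/-- One step of the induction for `differentiableAt_rayKernel`: the kernel of the remaining list is
already known to be holomorphic. -/
lemma dominated_of_kernel {Y : Type} [NormedAddCommGroup Y] [NormedSpace ℂ Y]
    {L : List ((Y → ℂ) × (Y → ℂ))} {d z : Y → ℂ} (k : Y → ℂ → ℂ) {y₀ : Y}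
    (hker : ∀ (t : Y → ℂ), Differentiable ℂ t → ∀ y, Admissible (t y) (evalList L y) →
      DifferentiableAt ℂ (fun y => rayKernel (evalList L y) (t y)) y)
    (hcont : ∀ y, ∀ t : ℂ, Admissible t (evalList L y) →
      ContinuousAt (rayKernel (evalList L y)) t)
    (hL : ∀ q ∈ L, Differentiable ℂ q.1 ∧ Differentiable ℂ q.2) (hd : Differentiable ℂ d)
    (hz : Differentiable ℂ z) (hre : 0 < (z y₀ * d y₀).re) (hadm : Admissible (d y₀) (evalList L y₀))
    {K : ℝ} (hk : ∀ᶠ y in 𝓝 y₀, ∀ v : ℝ, 0 < v → ‖k y (d y * v)‖ ≤ K ∧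
      DifferentiableAt ℂ (fun y => k y (d y * v)) y ∧ ContinuousAt (k y) (d y * v)) :
    ∃ U g, Dominated (fun y v => d y * Complex.exp (-(z y * (d y * v))) *
      (rayKernel (evalList L y) (d y * v) * k y (d y * v))) y₀ U g := by
  obtain ⟨c, hc, hev⟩ := Admissible.eventually_sepChain (x := y₀) (t := d) (L := L)
    hd.continuous.continuousAt (fun q hq => ⟨(hL q hq).1.continuous.continuousAt,
      (hL q hq).2.continuous.continuousAt⟩) hadm
  have hre' : ∀ᶠ y in 𝓝 y₀, (z y₀ * d y₀).re / 2 < (z y * d y).re :=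
    (Complex.continuous_re.comp (hz.continuous.mul hd.continuous)).continuousAt.eventually
      (lt_mem_nhds (half_lt_self hre))
  have hnorm : ∀ᶠ y in 𝓝 y₀, ‖d y‖ < ‖d y₀‖ + 1 :=
    hd.continuous.norm.continuousAt.eventually (gt_mem_nhds (lt_add_one _))
  set c' := min c (min ((z y₀ * d y₀).re / 2) (‖d y₀‖ + 1)⁻¹) with hc'
  have hc'0 : 0 < c' := by positivity
  obtain ⟨C, hC0, hC⟩ := norm_rayKernel_le L.length hc'0 (1 / 2) (by norm_num) (by norm_num)
  refine ⟨_, fun v => c'⁻¹ * (C * K) * rayBound c' (1 / 2) v,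
    ⟨hev.and (hre'.and (hnorm.and hk)), ?_, ?_, ?_,
      (integrableOn_rayBound hc'0 (by norm_num)).const_mul _⟩⟩
  · rintro y ⟨h1, h2, h3, h4⟩
    refine ContinuousOn.aestronglyMeasurable (fun v hv => ?_) measurableSet_Ioi
    have hv : (0 : ℝ) < v := hv
    have e1 : ContinuousAt (rayKernel (evalList L y)) (d y * v) :=
      hcont y _ ((h1.admissible hc).smul hv)
    have e2 : ContinuousAt (fun v : ℝ => d y * v) v := by fun_prop
    exact ((by fun_prop : ContinuousAt (fun v : ℝ => d y * Complex.exp (-(z y * (d y * v)))) v).mul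
      ((ContinuousAt.comp (f := fun v : ℝ => d y * v) e1 e2).mul
        (ContinuousAt.comp (f := fun v : ℝ => d y * v) (h4 v hv).2.2 e2))).continuousWithinAt
  · filter_upwards [ae_restrict_mem measurableSet_Ioi] with v hv
    rintro y ⟨h1, h2, h3, h4⟩
    have hv : (0 : ℝ) < v := hv
    have e1 := hker (fun y => d y * v) (by fun_prop) y ((h1.admissible hc).smul hv)
    have e2 := (h4 v hv).2.1
    have e3 : DifferentiableAt ℂ (fun y => d y * Complex.exp (-(z y * (d y * v)))) y := by
      fun_prop
    exact e3.mul (e1.mul e2)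
  · filter_upwards [ae_restrict_mem measurableSet_Ioi] with v hv
    rintro y ⟨h1, h2, h3, h4⟩
    have hv : (0 : ℝ) < v := hv
    refine norm_rayInt_integrand_le (x := (d y, z y)) hv ?_ ?_ ?_
    · exact ((min_le_right _ _).trans (min_le_left _ _)).trans h2.le
    · refine h3.le.trans ?_
      rw [le_inv_comm₀ (by positivity) hc'0]
      exact (min_le_right _ _).trans (min_le_right _ _)
    · have e1 := hC (evalList L y) (by simp [evalList]) (d y) v hv
        (h1.mono hc'0 (min_le_left _ _))
      have e2 := (h4 v hv).1
      have hK : 0 ≤ K := (norm_nonneg _).trans e2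
      rw [norm_mul]
      calc _ ≤ C * (1 + v ^ (-(1 / 2 : ℝ))) * K := by gcongr
        _ = _ := by ring

lemma eventually_kernel_bound {Y : Type} [NormedAddCommGroup Y] [NormedSpace ℂ Y]
    {t d : Y → ℂ} {y₀ : Y} (ht : Differentiable ℂ t) (hd : Differentiable ℂ d)
    (h : OffRay (t y₀) (d y₀)) (h0 : d y₀ ≠ 0) :
    ∃ K : ℝ, ∀ᶠ y in 𝓝 y₀, ∀ v : ℝ, 0 < v → ‖(t y - d y * v)⁻¹‖ ≤ K ∧
      DifferentiableAt ℂ (fun y => (t y - d y * v)⁻¹) y ∧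
      ContinuousAt (fun u => (t y - u)⁻¹) (d y * v) := by
  obtain ⟨c, hc, hev⟩ := h.eventually_separated h0 ht.continuous.continuousAt
    hd.continuous.continuousAt
  refine ⟨c⁻¹, ?_⟩
  filter_upwards [hev] with y hy v hv
  have h1 := hy 1 v zero_le_one hv.le
  have h2 : c ≤ ‖t y - d y * v‖ := by
    rw [Complex.ofReal_one, one_mul, mul_comm] at h1
    rw [mul_comm (d y)]
    nlinarith
  have h3 : t y - d y * v ≠ 0 := norm_pos_iff.1 (hc.trans_le h2)
  refine ⟨?_, ?_, ?_⟩
  · rw [norm_inv]; exact inv_anti₀ hc h2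
  · exact ((ht y).sub ((hd y).mul_const _)).inv h3
  · exact ContinuousAt.inv₀ (by fun_prop) h3

theorem differentiableAt_rayKernel (n : ℕ) : ∀ (Y : Type) [NormedAddCommGroup Y] [NormedSpace ℂ Y]
    [FiniteDimensional ℂ Y] (L : List ((Y → ℂ) × (Y → ℂ))), L.length = n →
    (∀ q ∈ L, Differentiable ℂ q.1 ∧ Differentiable ℂ q.2) →
    ∀ t : Y → ℂ, Differentiable ℂ t → ∀ y, Admissible (t y) (evalList L y) →
      DifferentiableAt ℂ (fun y => rayKernel (evalList L y) (t y)) y := by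
  induction n with
  | zero =>
    intro Y _ _ _ L hn hL t ht y _
    rw [List.length_eq_zero_iff] at hn
    subst hn
    exact differentiableAt_const _
  | succ n ih =>
    intro Y _ _ _ L hn hL t ht y h
    obtain _ | ⟨q, L⟩ := L
    · simp at hn
    have hn' : L.length = n := by simpa using hn
    have hL' : ∀ q ∈ L, Differentiable ℂ q.1 ∧ Differentiable ℂ q.2 :=
      fun q' hq' => hL q' (by simp [hq'])
    obtain ⟨hq1, hq2⟩ := hL q (by simp)
    obtain ⟨h1, h2, h3⟩ := h
    obtain ⟨K, hK⟩ := eventually_kernel_bound ht hq1 h1 (ne_zero_of_re_mul_pos h2)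
    obtain ⟨U, g, hdom⟩ := dominated_of_kernel (d := q.1) (z := q.2) (L := L) (y₀ := y)
      (fun y u => (t y - u)⁻¹)
      (fun t ht y hy => ih Y L hn' hL' t ht y hy) (fun y t₀ hy => by
        have := ih ℂ ((evalList L y).map fun p => (fun _ => p.1, fun _ => p.2))
          (by simp [evalList, hn']) (by
            intro q hq
            simp only [List.mem_map] at hq
            obtain ⟨p, _, rfl⟩ := hq
            exact ⟨differentiable_const _, differentiable_const _⟩) id differentiable_id t₀ (by
              simpa [evalList, Function.comp_def] using hy)
        simpa [evalList, Function.comp_def] using this.continuousAt) hL' hq1 hq2 h2 h3 hK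
    exact hdom.differentiableAt

lemma continuousAt_rayKernel {L : List (ℂ × ℂ)} {t : ℂ} (h : Admissible t L) :
    ContinuousAt (rayKernel L) t := by
  have := differentiableAt_rayKernel L.length ℂ (L.map fun p => (fun _ => p.1, fun _ => p.2))
    (by simp) (by
      intro q hq
      simp only [List.mem_map] at hq
      obtain ⟨p, _, rfl⟩ := hq
      exact ⟨differentiable_const _, differentiable_const _⟩) id differentiable_id t (by
        simpa [evalList, Function.comp_def] using h)
  simpa [evalList, Function.comp_def] using this.continuousAt

lemma exists_dominated {Y : Type} [NormedAddCommGroup Y] [NormedSpace ℂ Y]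
    [FiniteDimensional ℂ Y] {L : List ((Y → ℂ) × (Y → ℂ))} {q : (Y → ℂ) × (Y → ℂ)}
    (k : Y → ℂ → ℂ) {y₀ : Y} (hL : ∀ q' ∈ q :: L, Differentiable ℂ q'.1 ∧ Differentiable ℂ q'.2)
    (h : AdmissibleList (evalList (q :: L) y₀))
    {K : ℝ} (hk : ∀ᶠ y in 𝓝 y₀, ∀ v : ℝ, 0 < v → ‖k y (q.1 y * v)‖ ≤ K ∧
      DifferentiableAt ℂ (fun y => k y (q.1 y * v)) y ∧ ContinuousAt (k y) (q.1 y * v)) :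
    ∃ U g, Dominated (fun y v => q.1 y * Complex.exp (-(q.2 y * (q.1 y * v))) *
      (rayKernel (evalList L y) (q.1 y * v) * k y (q.1 y * v))) y₀ U g :=
  dominated_of_kernel k
    (fun t ht y hy => differentiableAt_rayKernel L.length Y L rfl
      (fun q' hq' => hL q' (by simp [hq'])) t ht y hy)
    (fun _ _ hy => continuousAt_rayKernel hy)
    (fun q' hq' => hL q' (by simp [hq'])) (hL q (by simp)).1 (hL q (by simp)).2 h.1 h.2 hk

theorem differentiableAt_rayIter {Y : Type} [NormedAddCommGroup Y] [NormedSpace ℂ Y]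
    [FiniteDimensional ℂ Y] {L : List ((Y → ℂ) × (Y → ℂ))} {y : Y}
    (hL : ∀ q ∈ L, Differentiable ℂ q.1 ∧ Differentiable ℂ q.2)
    (h : AdmissibleList (evalList L y)) :
    DifferentiableAt ℂ (fun y => rayIter (evalList L y)) y := by
  obtain _ | ⟨q, L⟩ := L
  · exact differentiableAt_const _
  obtain ⟨U, g, hdom⟩ := exists_dominated (q := q) (L := L) (fun _ _ => 1) (K := 1) hL h
    (Eventually.of_forall fun y v _ => ⟨by simp, differentiableAt_const _, continuousAt_const⟩)
  simpa [rayIter, rayInt, evalList] using hdom.differentiableAt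

/-! ### Scaling, and independence of the directions -/

lemma rayInt_congr {x : ℂ × ℂ} {g g' : ℂ → ℂ} (h : ∀ v : ℝ, 0 < v → g (x.1 * v) = g' (x.1 * v)) :
    rayInt x g = rayInt x g' := by
  unfold rayInt
  refine setIntegral_congr_fun measurableSet_Ioi fun v hv => ?_
  rw [h v hv]

lemma rayInt_scale {d z : ℂ} (g : ℂ → ℂ) {r : ℝ} (hr : 0 < r) :
    rayInt (d * r, z) g = rayInt (d, z) g := by
  have h := integral_comp_mul_left_Ioi
    (fun v : ℝ => d * Complex.exp (-(z * (d * v))) * g (d * v)) 0 hr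
  rw [mul_zero] at h
  unfold rayInt
  rw [← (smul_right_injective ℂ (inv_ne_zero hr.ne')).eq_iff]
  simp only
  rw [← h, ← integral_smul]
  refine integral_congr_ae (Eventually.of_forall fun v => ?_)
  have : (r : ℂ) ≠ 0 := by exact_mod_cast hr.ne'
  simp only [Complex.real_smul, Complex.ofReal_mul, Complex.ofReal_inv]
  rw [show d * (r : ℂ) * v = d * (r * v) by ring]
  field_simp

lemma rayInt_rotate {d z : ℂ} (g : ℂ → ℂ) {a : ℂ} (ha : a ≠ 0) :
    rayInt (d * a, z / a) g = a * rayInt (d, z) fun u => g (u * a) := by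
  unfold rayInt
  rw [← integral_const_mul]
  refine integral_congr_ae (Eventually.of_forall fun v => ?_)
  simp only
  rw [show z / a * (d * a * v) = z * (d * v) by field_simp,
    show d * a * (v : ℂ) = d * v * a by ring]
  ring

/-- The pairs in the two lists differ by positive scalings of the directions. -/
def SameRays (L L' : List (ℂ × ℂ)) : Prop :=
  List.Forall₂ (fun x y : ℂ × ℂ => ∃ r : ℝ, 0 < r ∧ y = (x.1 * r, x.2)) L L'

lemma SameRays.rayKernel_eq {L L' : List (ℂ × ℂ)} (h : SameRays L L') :
    rayKernel L' = rayKernel L := by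
  induction h with
  | nil => rfl
  | cons h _ ih =>
    obtain ⟨r, hr, rfl⟩ := h
    funext t
    simp only [rayKernel, ih]
    exact rayInt_scale _ hr

lemma SameRays.rayIter_eq {L L' : List (ℂ × ℂ)} (h : SameRays L L') :
    rayIter L' = rayIter L := by
  obtain _ | ⟨⟨r, hr, rfl⟩, h⟩ := h
  · rfl
  · simp only [rayIter, SameRays.rayKernel_eq h]
    exact rayInt_scale _ hr

lemma rayKernel_rotate {a : ℂ} (ha : a ≠ 0) (L : List (ℂ × ℂ)) (t : ℂ) :
    rayKernel (L.map fun x => (x.1 * a, x.2 / a)) (t * a) = rayKernel L t := by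
  induction L generalizing t with
  | nil => rfl
  | cons x L ih =>
    simp only [rayKernel, List.map_cons]
    rw [rayInt_rotate _ ha]
    simp only [ih]
    unfold rayInt
    rw [← integral_const_mul]
    refine integral_congr_ae (Eventually.of_forall fun v => ?_)
    simp only
    rw [← sub_mul, mul_inv]
    field_simp

lemma rayIter_rotate {a : ℂ} (ha : a ≠ 0) (L : List (ℂ × ℂ)) :
    rayIter (L.map fun x => (x.1 * a, x.2 / a)) = a * rayIter L := by
  cases L with
  | nil => simp [rayIter]
  | cons x L =>
    simp only [rayIter, List.map_cons]
    rw [rayInt_rotate _ ha]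
    congr 1
    exact rayInt_congr fun v _ => rayKernel_rotate ha L _

lemma sameRays_map {α : Type*} {f g : α → ℂ × ℂ} (M : List α)
    (h : ∀ m ∈ M, ∃ r : ℝ, 0 < r ∧ g m = ((f m).1 * r, (f m).2)) :
    SameRays (M.map f) (M.map g) := by
  unfold SameRays
  rw [List.forall₂_map_left_iff, List.forall₂_map_right_iff, List.forall₂_same]
  exact h

/-- The iterated integral is homogeneous of degree `-1` in the variables `z_i`. -/
lemma rayIter_smul {r : ℝ} (hr : 0 < r) (L : List (ℂ × ℂ)) :
    rayIter (L.map fun x => (x.1, x.2 * r)) = (r : ℂ)⁻¹ * rayIter L := by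
  have hr' : (r : ℂ)⁻¹ ≠ 0 := inv_ne_zero (by exact_mod_cast hr.ne')
  rw [← rayIter_rotate hr']
  refine (SameRays.rayIter_eq (sameRays_map L fun m _ => ⟨r⁻¹, by positivity, ?_⟩)).symm
  simp

lemma fderiv_eq_zero_of_shift {n : ℕ} {f : (Fin n → ℂ) → ℂ} {y : Fin n → ℂ}
    (hf : DifferentiableAt ℂ f y)
    (h : ∀ (j : Fin n) (r : ℝ), f (y + Pi.single j (r : ℂ)) = f y) : fderiv ℂ f y = 0 := by
  have hj : ∀ j, fderiv ℂ f y (Pi.single j 1) = 0 := by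
    intro j
    have h1 : HasDerivAt (fun r : ℝ => y + Pi.single j (r : ℂ)) (Pi.single j (1 : ℂ)) 0 := by
      have h2 : HasDerivAt (fun r : ℝ => y + r • (Pi.single j (1 : ℂ) : Fin n → ℂ))
          (Pi.single j (1 : ℂ)) 0 := by
        simpa using ((hasDerivAt_id (0 : ℝ)).smul_const
          (Pi.single j (1 : ℂ) : Fin n → ℂ)).const_add y
      convert h2 using 2 with r
      rw [← Pi.single_smul]; simp
    have h3 : HasFDerivAt f ((fderiv ℂ f y).restrictScalars ℝ)
        (y + Pi.single j (((0 : ℝ) : ℂ))) := by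
      simpa using hf.hasFDerivAt.restrictScalars ℝ
    have h4 := h3.comp_hasDerivAt (0 : ℝ) h1
    have h5 : (f ∘ fun r : ℝ => y + Pi.single j (r : ℂ)) = fun _ => f y := funext fun r => h j r
    rw [h5] at h4
    exact h4.unique (hasDerivAt_const _ _)
  ext v
  have hv : v = ∑ j, v j • (Pi.single j (1 : ℂ) : Fin n → ℂ) := by
    funext i
    simp [Finset.sum_apply, Pi.single_apply]
  rw [hv, map_sum]
  simp [hj]

lemma eq_of_shift_of_segment {n : ℕ} {f : (Fin n → ℂ) → ℂ} {α α' : Fin n → ℝ}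
    (hf : ∀ τ ∈ Icc (0 : ℝ) 1,
      DifferentiableAt ℂ f fun j => Complex.I * (α j + τ * (α' j - α j) : ℝ))
    (h : ∀ (y : Fin n → ℂ) (j : Fin n) (r : ℝ), f (y + Pi.single j (r : ℂ)) = f y) :
    f (fun j => Complex.I * α j) = f (fun j => Complex.I * α' j) := by
  let γ : ℝ → (Fin n → ℂ) := fun τ j => Complex.I * (α j + τ * (α' j - α j) : ℝ)
  have hγ : ∀ τ, HasDerivAt γ (fun j => Complex.I * (α' j - α j : ℝ)) τ := by
    intro τ
    rw [hasDerivAt_pi]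
    intro j
    have h1 : HasDerivAt (fun τ : ℝ => α j + τ * (α' j - α j)) (α' j - α j) τ := by
      simpa using ((hasDerivAt_id τ).mul_const (α' j - α j)).const_add (α j)
    exact h1.ofReal_comp.const_mul Complex.I
  have hd : ∀ τ ∈ Icc (0 : ℝ) 1, HasDerivAt (f ∘ γ) 0 τ := by
    intro τ hτ
    have h1 := (hf τ hτ).hasFDerivAt
    rw [fderiv_eq_zero_of_shift (hf τ hτ) (h _)] at h1
    simpa using (h1.restrictScalars ℝ).comp_hasDerivAt τ (hγ τ)
  have := constant_of_has_deriv_right_zero (f := f ∘ γ) (a := 0) (b := 1)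
    (fun τ hτ => (hd τ hτ).continuousAt.continuousWithinAt)
    (fun τ hτ => (hd τ ⟨hτ.1, hτ.2.le⟩).hasDerivWithinAt) 1 (by simp)
  simpa [γ] using this.symm

/-- The pair of the direction `b exp (i α)` and of `z`. -/
noncomputable def rotPair (b z : ℂ) (α : ℝ) : ℂ × ℂ := (b * Complex.exp (Complex.I * α), z)

lemma differentiable_rot {n : ℕ} (b : Fin n → ℂ) (z : Fin n → ℂ) :
    ∀ q ∈ List.ofFn (fun j : Fin n => ((fun y : Fin n → ℂ => b j * Complex.exp (y j)),
      fun _ : Fin n → ℂ => z j)), Differentiable ℂ q.1 ∧ Differentiable ℂ q.2 := by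
  intro q hq
  obtain ⟨j, rfl⟩ := List.mem_ofFn.1 hq
  exact ⟨by fun_prop, by fun_prop⟩

lemma sameRays_shift {n : ℕ} (b z y : Fin n → ℂ) (i : Fin n) (r : ℝ) :
    SameRays (List.ofFn fun j => (b j * Complex.exp (y j), z j))
      (List.ofFn fun j => (b j * Complex.exp ((y + Pi.single (M := fun _ => ℂ) i (r : ℂ)) j), z j)) := by
  have hmap : ∀ f : Fin n → ℂ × ℂ, List.ofFn f = (List.ofFn id).map f := fun f => by
    rw [List.map_ofFn]; rfl
  rw [hmap, hmap fun j => _]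
  refine sameRays_map _ fun j _ => ?_
  by_cases h : j = i
  · subst h
    exact ⟨Real.exp r, Real.exp_pos _, by simp [Complex.exp_add, mul_assoc]⟩
  · exact ⟨1, one_pos, by simp [h]⟩

/-- The iterated integral does not change when the directions are rotated through admissible
positions: it is holomorphic in the directions, and invariant under their real scalings. -/
theorem rayIter_eq_of_segment (M : List (ℂ × ℂ × ℝ × ℝ))
    (h : ∀ τ ∈ Icc (0 : ℝ) 1, AdmissibleList
      (M.map fun m => rotPair m.1 m.2.1 (m.2.2.1 + τ * (m.2.2.2 - m.2.2.1)))) :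
    rayIter (M.map fun m => rotPair m.1 m.2.1 m.2.2.1) =
      rayIter (M.map fun m => rotPair m.1 m.2.1 m.2.2.2) := by
  have key := eq_of_shift_of_segment
    (f := fun y : Fin M.length → ℂ => rayIter
      (List.ofFn fun j => ((M.get j).1 * Complex.exp (y j), (M.get j).2.1)))
    (α := fun j => (M.get j).2.2.1) (α' := fun j => (M.get j).2.2.2) ?_ ?_
  · rw [← List.ofFn_get M, List.map_ofFn, List.map_ofFn]
    exact key
  · intro τ hτ
    have h1 := h τ hτ
    rw [← List.ofFn_get M, List.map_ofFn] at h1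
    have h2 := differentiableAt_rayIter (y := fun j : Fin M.length =>
        Complex.I * (((M.get j).2.2.1 + τ * ((M.get j).2.2.2 - (M.get j).2.2.1) : ℝ) : ℂ))
      (differentiable_rot (fun j => (M.get j).1) (fun j => (M.get j).2.1)) (by
        simp only [evalList, List.map_ofFn]
        exact h1)
    simp only [evalList, List.map_ofFn] at h2
    exact h2
  · intro y j r
    exact (sameRays_shift _ _ y j r).rayIter_eq

theorem rayKernel_eq_of_segment (M : List (ℂ × ℂ × ℝ × ℝ)) (t : ℂ)
    (h : ∀ τ ∈ Icc (0 : ℝ) 1, Admissible t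
      (M.map fun m => rotPair m.1 m.2.1 (m.2.2.1 + τ * (m.2.2.2 - m.2.2.1)))) :
    rayKernel (M.map fun m => rotPair m.1 m.2.1 m.2.2.1) t =
      rayKernel (M.map fun m => rotPair m.1 m.2.1 m.2.2.2) t := by
  have key := eq_of_shift_of_segment
    (f := fun y : Fin M.length → ℂ => rayKernel
      (List.ofFn fun j => ((M.get j).1 * Complex.exp (y j), (M.get j).2.1)) t)
    (α := fun j => (M.get j).2.2.1) (α' := fun j => (M.get j).2.2.2) ?_ ?_
  · rw [← List.ofFn_get M, List.map_ofFn, List.map_ofFn]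
    exact key
  · intro τ hτ
    have h1 := h τ hτ
    rw [← List.ofFn_get M, List.map_ofFn] at h1
    have h2 := differentiableAt_rayKernel M.length _ _ (by simp)
      (differentiable_rot (fun j => (M.get j).1) (fun j => (M.get j).2.1)) (fun _ => t)
      (differentiable_const _) (fun j : Fin M.length =>
        Complex.I * (((M.get j).2.2.1 + τ * ((M.get j).2.2.2 - (M.get j).2.2.1) : ℝ) : ℂ)) (by
        simp only [evalList, List.map_ofFn]
        exact h1)
    simp only [evalList, List.map_ofFn] at h2
    exact h2
  · intro y j r
    exact congrFun (sameRays_shift _ _ y j r).rayKernel_eq t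

/-! ### The differential equation for the iterated integrals -/

lemma integrableOn_rayInt {x : ℂ × ℂ} {L : List (ℂ × ℂ)} (h : AdmissibleList (x :: L))
    {k : ℂ → ℂ} {K : ℝ} (hk : ∀ v : ℝ, 0 < v → ‖k (x.1 * v)‖ ≤ K ∧ ContinuousAt k (x.1 * v)) :
    IntegrableOn (fun v : ℝ => x.1 * Complex.exp (-(x.2 * (x.1 * v))) *
      (rayKernel L (x.1 * v) * k (x.1 * v))) (Ioi 0) := by
  obtain ⟨U, g, hdom⟩ := exists_dominated (Y := ℂ) (y₀ := 0) (K := K)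
    (q := (fun _ => x.1, fun _ => x.2))
    (L := L.map fun p => (fun _ => p.1, fun _ => p.2)) (fun _ => k) (by
      intro q hq
      rw [List.mem_cons, List.mem_map] at hq
      obtain rfl | ⟨p, _, rfl⟩ := hq <;> exact ⟨differentiable_const _, differentiable_const _⟩)
    (by simpa [evalList, Function.comp_def] using h)
    (Eventually.of_forall fun y v hv =>
      ⟨(hk v hv).1, differentiableAt_const (k (x.1 * v)), (hk v hv).2⟩)
  simpa [evalList, Function.comp_def] using hdom.integrableOn

lemma Admissible.list {t : ℂ} {L : List (ℂ × ℂ)} (h : Admissible t L) : AdmissibleList L := by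
  cases L with
  | nil => trivial
  | cons x L => exact h.2

lemma Admissible.kernel_bound {t : ℂ} {x : ℂ × ℂ} {L : List (ℂ × ℂ)}
    (h : Admissible t (x :: L)) : ∃ K : ℝ, ∀ v : ℝ, 0 < v →
      ‖(t - x.1 * v)⁻¹‖ ≤ K ∧ ContinuousAt (fun u => (t - u)⁻¹) (x.1 * v) := by
  obtain ⟨K, hK⟩ := eventually_kernel_bound (Y := ℂ) (y₀ := 0) (differentiable_const t)
    (differentiable_const x.1) h.1 (ne_zero_of_re_mul_pos h.2.1)
  exact ⟨K, fun v hv => ⟨(hK.self_of_nhds v hv).1, (hK.self_of_nhds v hv).2.2⟩⟩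

lemma Admissible.integrableOn {t : ℂ} {x : ℂ × ℂ} {L : List (ℂ × ℂ)}
    (h : Admissible t (x :: L)) :
    IntegrableOn (fun v : ℝ => x.1 * Complex.exp (-(x.2 * (x.1 * v))) *
      (rayKernel L (x.1 * v) * (t - x.1 * v)⁻¹)) (Ioi 0) := by
  obtain ⟨K, hK⟩ := h.kernel_bound
  exact integrableOn_rayInt (k := fun u => (t - u)⁻¹) h.list hK

lemma AdmissibleList.integrableOn {x : ℂ × ℂ} {L : List (ℂ × ℂ)}
    (h : AdmissibleList (x :: L)) :
    IntegrableOn (fun v : ℝ => x.1 * Complex.exp (-(x.2 * (x.1 * v))) *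
      rayKernel L (x.1 * v)) (Ioi 0) := by
  simpa using integrableOn_rayInt h (k := fun _ => 1) (K := 1)
    (fun v _ => ⟨by simp, continuousAt_const⟩)

lemma Admissible.take {t : ℂ} {L : List (ℂ × ℂ)} (h : Admissible t L) (k : ℕ) :
    Admissible t (L.take k) := by
  induction L generalizing t k with
  | nil => simpa using h
  | cons x L ih =>
    cases k with
    | zero => trivial
    | succ k => exact ⟨h.1, h.2.1, ih h.2.2 k⟩

/-- The list of the pairs `(d_i, z_i + s v_i)`, for a list of triples `(d_i, z_i, v_i)`. -/
def lineList (M : List (ℂ × ℂ × ℂ)) (s : ℂ) : List (ℂ × ℂ) :=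
  M.map fun m => (m.1, m.2.1 + s * m.2.2)

lemma lineList_eq (M : List (ℂ × ℂ × ℂ)) (s : ℂ) : lineList M s =
    evalList (M.map fun m => (fun _ => m.1, fun s => m.2.1 + s * m.2.2)) s := by
  simp [lineList, evalList, Function.comp_def]

/-- The sum of the components `v_i` of a list of triples `(d_i, z_i, v_i)`. -/
def velSum (M : List (ℂ × ℂ × ℂ)) : ℂ := (M.map fun m => m.2.2).sum

lemma differentiable_lineList (M : List (ℂ × ℂ × ℂ)) :
    ∀ q ∈ M.map (fun m => ((fun _ => m.1 : ℂ → ℂ), fun s : ℂ => m.2.1 + s * m.2.2)),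
      Differentiable ℂ q.1 ∧ Differentiable ℂ q.2 := by
  intro q hq
  obtain ⟨m, _, rfl⟩ := List.mem_map.1 hq
  exact ⟨by fun_prop, by fun_prop⟩

/-- The derivative of `rayKernel` when the variables move along a line with velocities `v_i`. The
factor `-∑ v_i u_i` from the exponential is a combination of `t` and of the differences of
consecutive elements of `t, u_1, …, u_n`, each of which cancels one factor of the integrand. -/
theorem hasDerivAt_rayKernel (M : List (ℂ × ℂ × ℂ)) : ∀ (t s : ℂ), Admissible t (lineList M s) →
    HasDerivAt (fun s => rayKernel (lineList M s) t)
      (-(velSum M * t * rayKernel (lineList M s) t) + ∑ k ∈ Finset.range M.length,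
        velSum (M.drop k) * rayKernel (lineList (M.take k) s) t *
          rayIter (lineList (M.drop k) s)) s := by
  induction M with
  | nil =>
    intro t s _
    simpa [lineList, rayKernel, velSum] using hasDerivAt_const s (1 : ℂ)
  | cons m M ih =>
    intro t s h
    obtain ⟨h1, h2, h3⟩ := id h
    obtain ⟨K, hK⟩ := eventually_kernel_bound (Y := ℂ) (y₀ := s) (differentiable_const t)
      (differentiable_const m.1) h1 (ne_zero_of_re_mul_pos h2)
    obtain ⟨U, g, hdom⟩ := exists_dominated (Y := ℂ) (y₀ := s) (K := K)
      (q := (fun _ => m.1, fun s => m.2.1 + s * m.2.2))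
      (L := M.map fun m => (fun _ => m.1, fun s => m.2.1 + s * m.2.2)) (fun _ u => (t - u)⁻¹)
      (differentiable_lineList (m :: M)) (by
        have := h.list
        rw [lineList_eq] at this
        exact this) hK
    obtain ⟨-, hder⟩ := hdom.hasDerivAt
    simp only [← lineList_eq] at hder
    refine hder.congr_deriv ?_
    set S := velSum (m :: M) with hS
    let e : ℝ → ℂ := fun v => m.1 * Complex.exp (-((m.2.1 + s * m.2.2) * (m.1 * v)))
    have i1 : IntegrableOn (fun v : ℝ => e v * rayKernel (lineList M s) (m.1 * v)) (Ioi 0) :=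
      AdmissibleList.integrableOn (x := (m.1, m.2.1 + s * m.2.2)) h.list
    have i2 : IntegrableOn (fun v : ℝ => e v * (rayKernel (lineList M s) (m.1 * v) *
        (t - m.1 * v)⁻¹)) (Ioi 0) :=
      Admissible.integrableOn (x := (m.1, m.2.1 + s * m.2.2)) h
    have i3 : ∀ k, IntegrableOn (fun v : ℝ => e v *
        (rayKernel (lineList (M.take k) s) (m.1 * v) * (t - m.1 * v)⁻¹)) (Ioi 0) := by
      intro k
      refine Admissible.integrableOn (x := (m.1, m.2.1 + s * m.2.2)) (L := lineList (M.take k) s) ?_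
      refine ⟨h1, h2, ?_⟩
      have := h3.take k
      simpa [lineList, List.map_take] using this
    -- With `u = m.1 * v`, the terms proportional to `u` are rewritten by
    -- `-u / (t - u) = 1 - t / (t - u)`.
    have hint : ∀ v ∈ Ioi (0 : ℝ), deriv (fun y => m.1 *
        Complex.exp (-((m.2.1 + y * m.2.2) * (m.1 * v))) *
          (rayKernel (lineList M y) (m.1 * v) * (t - m.1 * v)⁻¹)) s =
        S * (e v * rayKernel (lineList M s) (m.1 * v)) -
          S * t * (e v * (rayKernel (lineList M s) (m.1 * v) * (t - m.1 * v)⁻¹)) +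
          ∑ k ∈ Finset.range M.length, velSum (M.drop k) * rayIter (lineList (M.drop k) s) *
            (e v * (rayKernel (lineList (M.take k) s) (m.1 * v) * (t - m.1 * v)⁻¹)) := by
      intro v hv
      have hv : (0 : ℝ) < v := hv
      have d1 := ih (m.1 * v) s (h3.smul hv)
      have d2 : HasDerivAt (fun y : ℂ => m.1 * Complex.exp (-((m.2.1 + y * m.2.2) * (m.1 * v))))
          (e v * (-(m.2.2 * (m.1 * v)))) s := by
        have d3 : HasDerivAt (fun y : ℂ => -((m.2.1 + y * m.2.2) * (m.1 * v)))
            (-(m.2.2 * (m.1 * v))) s := by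
          simpa using ((((hasDerivAt_id s).mul_const m.2.2).const_add m.2.1).mul_const
            (m.1 * (v : ℂ))).fun_neg
        simpa [e, mul_assoc] using d3.cexp.const_mul m.1
      rw [(d2.fun_mul (d1.mul_const _)).deriv]
      have hne := h1.sub_ne_zero hv.le
      have hinv : (t - m.1 * v)⁻¹ * (t - m.1 * v) = 1 := inv_mul_cancel₀ hne
      have hSum : (∑ k ∈ Finset.range M.length, velSum (M.drop k) *
            rayIter (lineList (M.drop k) s) *
            (e v * (rayKernel (lineList (M.take k) s) (m.1 * v) * (t - m.1 * v)⁻¹))) =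
          e v * (t - m.1 * v)⁻¹ * ∑ k ∈ Finset.range M.length, velSum (M.drop k) *
            rayKernel (lineList (M.take k) s) (m.1 * v) * rayIter (lineList (M.drop k) s) := by
        rw [Finset.mul_sum]
        exact Finset.sum_congr rfl fun k _ => by ring
      rw [hSum]
      have hS' : S = m.2.2 + velSum M := by simp [hS, velSum]
      rw [hS']
      simp only [e]
      linear_combination (m.1 * Complex.exp (-((m.2.1 + s * m.2.2) * (m.1 * v))) *
        rayKernel (lineList M s) (m.1 * v) * (m.2.2 + velSum M)) * hinv
    rw [setIntegral_congr_fun measurableSet_Ioi hint, integral_add, integral_sub,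
      integral_finsetSum, List.length_cons, Finset.sum_range_succ']
    · simp only [integral_const_mul]
      have e1 : ∫ v in Ioi (0 : ℝ), e v * rayKernel (lineList M s) (m.1 * v) =
        rayIter (lineList (m :: M) s) := rfl
      have e2 : ∫ v in Ioi (0 : ℝ), e v * (rayKernel (lineList M s) (m.1 * v) *
        (t - m.1 * v)⁻¹) = rayKernel (lineList (m :: M) s) t := rfl
      have e3 : ∀ k, ∫ v in Ioi (0 : ℝ), e v * (rayKernel (lineList (M.take k) s) (m.1 * v) *
        (t - m.1 * v)⁻¹) = rayKernel (lineList ((m :: M).take (k + 1)) s) t := fun k => rfl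
      rw [e1, e2]
      simp only [e3, List.drop_succ_cons, List.drop_zero, List.take_zero]
      have e4 : rayKernel (lineList [] s) t = 1 := rfl
      rw [e4]
      have e5 : ∀ k, velSum (M.drop k) * rayIter (lineList (M.drop k) s) *
          rayKernel (lineList ((m :: M).take (k + 1)) s) t =
          velSum (M.drop k) * rayKernel (lineList ((m :: M).take (k + 1)) s) t *
          rayIter (lineList (M.drop k) s) := fun k => by ring
      simp only [e5]
      rw [hS]
      ring
    · exact fun k _ => (i3 k).const_mul _
    · exact i1.const_mul _
    · exact i2.const_mul _
    · exact (i1.const_mul _).sub (i2.const_mul _)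
    · exact integrable_finsetSum _ fun k _ => (i3 k).const_mul _

/-- In a direction `v` with `∑ v_i = 0`, the derivative of the exponent is a linear combination of
the differences `u_k - u_{k+1}`, and each of these cancels one factor of the integrand, so that the
integral becomes a product. -/
theorem hasDerivAt_rayIter (M : List (ℂ × ℂ × ℂ)) (s : ℂ) (h : AdmissibleList (lineList M s))
    (hS : velSum M = 0) :
    HasDerivAt (fun s => rayIter (lineList M s))
      (∑ k ∈ Finset.Ico 1 M.length, velSum (M.drop k) * rayIter (lineList (M.take k) s) *
          rayIter (lineList (M.drop k) s)) s := by
  obtain _ | ⟨m, M⟩ := M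
  · simpa [lineList, rayIter] using hasDerivAt_const s (0 : ℂ)
  obtain ⟨h2, h3⟩ := id h
  obtain ⟨U, g, hdom⟩ := exists_dominated (Y := ℂ) (y₀ := s) (K := 1)
    (q := (fun _ => m.1, fun s => m.2.1 + s * m.2.2))
    (L := M.map fun m => (fun _ => m.1, fun s => m.2.1 + s * m.2.2)) (fun _ _ => 1)
    (differentiable_lineList (m :: M)) (by
      have := h
      rw [lineList_eq] at this
      exact this)
    (Eventually.of_forall fun y v _ => ⟨by simp, differentiableAt_const _, continuousAt_const⟩)
  obtain ⟨-, hder⟩ := hdom.hasDerivAt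
  simp only [← lineList_eq, mul_one] at hder
  refine hder.congr_deriv ?_
  let e : ℝ → ℂ := fun v => m.1 * Complex.exp (-((m.2.1 + s * m.2.2) * (m.1 * v)))
  have i3 : ∀ k, IntegrableOn (fun v : ℝ => e v *
      rayKernel (lineList (M.take k) s) (m.1 * v)) (Ioi 0) := by
    intro k
    refine AdmissibleList.integrableOn (x := (m.1, m.2.1 + s * m.2.2))
      (L := lineList (M.take k) s) ⟨h2, ?_⟩
    have := h3.take k
    simpa [lineList, List.map_take] using this
  have hint : ∀ v ∈ Ioi (0 : ℝ), deriv (fun y => m.1 *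
      Complex.exp (-((m.2.1 + y * m.2.2) * (m.1 * v))) * rayKernel (lineList M y) (m.1 * v)) s =
      ∑ k ∈ Finset.range M.length, velSum (M.drop k) * rayIter (lineList (M.drop k) s) *
          (e v * rayKernel (lineList (M.take k) s) (m.1 * v)) := by
    intro v hv
    have hv : (0 : ℝ) < v := hv
    have d1 := hasDerivAt_rayKernel M (m.1 * v) s (h3.smul hv)
    have d2 : HasDerivAt (fun y : ℂ => m.1 * Complex.exp (-((m.2.1 + y * m.2.2) * (m.1 * v))))
        (e v * (-(m.2.2 * (m.1 * v)))) s := by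
      have d3 : HasDerivAt (fun y : ℂ => -((m.2.1 + y * m.2.2) * (m.1 * v)))
          (-(m.2.2 * (m.1 * v))) s := by
        simpa using ((((hasDerivAt_id s).mul_const m.2.2).const_add m.2.1).mul_const
          (m.1 * (v : ℂ))).fun_neg
      simpa [e, mul_assoc] using d3.cexp.const_mul m.1
    rw [(d2.fun_mul d1).deriv]
    have hSum : (∑ k ∈ Finset.range M.length, velSum (M.drop k) *
          rayIter (lineList (M.drop k) s) *
          (e v * rayKernel (lineList (M.take k) s) (m.1 * v))) =
        e v * ∑ k ∈ Finset.range M.length, velSum (M.drop k) *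
          rayKernel (lineList (M.take k) s) (m.1 * v) * rayIter (lineList (M.drop k) s) := by
      rw [Finset.mul_sum]
      exact Finset.sum_congr rfl fun k _ => by ring
    rw [hSum]
    have hS' : m.2.2 + velSum M = 0 := by simpa [velSum] using hS
    simp only [e]
    linear_combination (-(m.1 * Complex.exp (-((m.2.1 + s * m.2.2) * (m.1 * v))) *
      rayKernel (lineList M s) (m.1 * v) * (m.1 * v))) * hS'
  rw [setIntegral_congr_fun measurableSet_Ioi hint, integral_finsetSum]
  · simp only [integral_const_mul]
    have e3 : ∀ k, ∫ v in Ioi (0 : ℝ), e v * rayKernel (lineList (M.take k) s) (m.1 * v) =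
      rayIter (lineList ((m :: M).take (k + 1)) s) := fun k => rfl
    simp only [e3]
    rw [Finset.sum_Ico_eq_sum_range, List.length_cons, Nat.add_sub_cancel]
    refine Finset.sum_congr rfl fun k _ => ?_
    rw [add_comm 1 k, List.drop_succ_cons]
    ring
  · exact fun k _ => (i3 k).const_mul _

/-! ### The residue picked up when a ray crosses a pole -/

/-- The direction `exp (i α)`. -/
noncomputable def dir (α : ℝ) : ℂ := Complex.exp (Complex.I * α)

lemma dir_eq (α : ℝ) : dir α = (Real.cos α : ℂ) + Real.sin α * Complex.I := by
  rw [dir, mul_comm, Complex.exp_mul_I]; simp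

lemma dir_ne_zero (α : ℝ) : dir α ≠ 0 := Complex.exp_ne_zero _

@[simp] lemma dir_zero : dir 0 = 1 := by simp [dir]

lemma dir_add (α β : ℝ) : dir (α + β) = dir α * dir β := by
  simp [dir, mul_add, Complex.exp_add]

lemma dir_re (α : ℝ) : (dir α).re = Real.cos α := by simp [dir_eq, -Complex.ofReal_cos, -Complex.ofReal_sin]

lemma dir_im (α : ℝ) : (dir α).im = Real.sin α := by simp [dir_eq, -Complex.ofReal_cos, -Complex.ofReal_sin]

lemma norm_dir (α : ℝ) : ‖dir α‖ = 1 := by rw [dir, mul_comm]; exact Complex.norm_exp_ofReal_mul_I α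

lemma mul_add_ofReal_ne_zero {d : ℂ} (him : d.im ≠ 0) (v : ℝ) {c : ℝ} (hc : c ≠ 0) :
    d * v + c ≠ 0 := by
  intro he
  have h1 := congrArg Complex.im he
  have h2 := congrArg Complex.re he
  simp at h1 h2
  rcases h1 with h1 | h1
  · exact him h1
  · subst h1; simp at h2; exact hc h2

/-- The value at `s = 0` of the integral of `exp (-s z (u - 1)) 2 / (u² - 1)` along a ray in the
upper (`σ = 1`) or lower (`σ = -1`) half plane. -/
lemma integral_ray_two_div {d : ℂ} {σ : ℝ} (hσ : σ = 1 ∨ σ = -1) (hd : 0 < σ * d.im)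
    (hint : IntegrableOn (fun v : ℝ => d * (2 / ((d * v - 1) * (d * v + 1)))) (Ioi 0)) :
    ∫ v in Ioi (0 : ℝ), d * (2 / ((d * v - 1) * (d * v + 1))) = -(σ * Real.pi * Complex.I) := by
  have hσ0 : (σ : ℂ) ≠ 0 := by rcases hσ with rfl | rfl <;> simp
  have him : d.im ≠ 0 := by rintro h; simp [h] at hd
  have hne : ∀ (v : ℝ) (c : ℝ), c ≠ 0 → d * v + c ≠ 0 := fun v c =>
    mul_add_ofReal_ne_zero him v
  have hp : ∀ v : ℝ, 1 + d * v ≠ 0 := fun v => by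
    have := hne v 1 one_ne_zero; rwa [add_comm] at this; 
  have hm : ∀ v : ℝ, 1 - d * v ≠ 0 := fun v h => by
    have := hne v (-1) (by norm_num)
    apply this; push_cast; linear_combination -h
  -- An antiderivative is `log ((1 - d v) / (1 + d v))`; the factor `σ i` keeps the argument of the
  -- logarithm in the right half plane, away from the branch cut.
  have hslit : ∀ v : ℝ, 0 ≤ v →
      (σ * Complex.I * ((1 - d * v) / (1 + d * v)) : ℂ) ∈ Complex.slitPlane := by
    intro v hv
    rcases hv.eq_or_lt with rfl | hv
    · right
      rcases hσ with rfl | rfl <;> simp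
    · left
      have h1 : (1 - d * v) / (1 + d * v) =
          ((1 - d * v) * (starRingEnd ℂ) (1 + d * v)) / (Complex.normSq (1 + d * v) : ℂ) := by
        rw [← Complex.mul_conj]
        have h2 := (map_ne_zero (starRingEnd ℂ)).2 (hp v)
        rw [mul_div_mul_right _ _ h2]
      have h2 : (σ * Complex.I * ((1 - d * v) / (1 + d * v)) : ℂ).re =
          2 * (σ * d.im) * v / Complex.normSq (1 + d * v) := by
        rw [h1, mul_div_assoc', Complex.div_ofReal_re]
        simp
        ring
      rw [h2]
      have := Complex.normSq_pos.2 (hp v)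
      positivity
  have hder : ∀ v ∈ Ici (0 : ℝ), HasDerivAt
      (fun v : ℝ => Complex.log (σ * Complex.I * ((1 - d * v) / (1 + d * v))))
      (d * (2 / ((d * v - 1) * (d * v + 1)))) v := by
    intro v hv
    have e0 : HasDerivAt (fun v : ℝ => d * (v : ℂ)) d v := by
      simpa using (Complex.ofRealCLM.hasDerivAt (x := v)).const_mul d
    have e1 : HasDerivAt (fun v : ℝ => (1 - d * v : ℂ)) (-d) v := by
      simpa using e0.const_sub 1
    have e2 : HasDerivAt (fun v : ℝ => (1 + d * v : ℂ)) d v := e0.const_add 1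
    have e3 := ((e1.fun_div e2 (hp v)).const_mul (σ * Complex.I)).clog_real (hslit v hv)
    refine e3.congr_deriv ?_
    have h3 : d * v - 1 ≠ 0 := fun h => hm v (by linear_combination -h)
    have h4 : d * v + 1 ≠ 0 := fun h => hp v (by linear_combination h)
    have h5 := hp v
    have h6 := hm v
    field_simp [Complex.I_ne_zero]
    ring
  have hlim : Tendsto (fun v : ℝ => Complex.log (σ * Complex.I * ((1 - d * v) / (1 + d * v))))
      atTop (𝓝 (Complex.log (σ * Complex.I * (-1)))) := by
    have h1 : Tendsto (fun v : ℝ => ((v : ℂ)⁻¹)) atTop (𝓝 0) := by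
      have := (Complex.continuous_ofReal.tendsto 0).comp tendsto_inv_atTop_zero
      simpa [Function.comp_def] using this
    have hd0 : d ≠ 0 := by rintro rfl; simp at him
    have h2 : Tendsto (fun v : ℝ => ((v : ℂ)⁻¹ - d) / ((v : ℂ)⁻¹ + d)) atTop
        (𝓝 ((0 - d) / (0 + d))) :=
      (h1.sub_const d).div (h1.add_const d) (by simpa using hd0)
    have h3 : (0 - d) / (0 + d) = -1 := by rw [zero_sub, zero_add, neg_div, div_self hd0]
    rw [h3] at h2
    have h4 : Tendsto (fun v : ℝ => (σ * Complex.I * ((1 - d * v) / (1 + d * v)) : ℂ)) atTop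
        (𝓝 (σ * Complex.I * (-1))) := by
      refine (h2.const_mul _).congr' ?_
      filter_upwards [eventually_gt_atTop 0] with v hv
      have hv' : (v : ℂ) ≠ 0 := by exact_mod_cast hv.ne'
      have h5 := hp v
      have h6 : (v : ℂ)⁻¹ + d ≠ 0 := by
        intro h
        apply h5
        have : (1 : ℂ) + d * v = ((v : ℂ)⁻¹ + d) * v := by field_simp
        rw [this, h, zero_mul]
      congr 1
      rw [div_eq_div_iff h6 h5]
      field_simp
    refine (continuousAt_clog ?_).tendsto.comp h4
    right
    rcases hσ with rfl | rfl <;> simp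
  have key := integral_Ioi_of_hasDerivAt_of_tendsto (a := 0)
    (hder 0 (by simp)).continuousAt.continuousWithinAt
    (fun v hv => hder v (Ioi_subset_Ici_self hv)) hint hlim
  rw [key]
  rcases hσ with rfl | rfl
  · simp only [Complex.ofReal_one, one_mul, mul_neg, mul_one, Complex.ofReal_zero, mul_zero,
      sub_zero, add_zero, div_one, Complex.log_neg_I, Complex.log_I]
    ring
  · simp only [Complex.ofReal_neg, Complex.ofReal_one, neg_mul, one_mul, mul_neg, mul_one,
      neg_neg, Complex.ofReal_zero, mul_zero, sub_zero, add_zero, div_one, Complex.log_neg_I,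
      Complex.log_I]
    ring

/-- The bound holds since `1` is separated from the ray through `d²`. -/
lemma exists_quadratic_bound {d : ℂ} (him : d.im ≠ 0) :
    ∃ C ≥ 0, ∀ v : ℝ, ‖d * (2 / ((d * v - 1) * (d * v + 1)))‖ ≤ C * (1 + v ^ 2)⁻¹ := by
  have hd : d ≠ 0 := by rintro rfl; simp at him
  have hoff : OffRay 1 (d ^ 2) := by
    intro r hr he
    have h1 : (d * (Real.sqrt r : ℂ) - 1) * (d * (Real.sqrt r : ℂ) + 1) = 0 := by
      have : ((Real.sqrt r : ℝ) : ℂ) ^ 2 = r := by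
        rw [← Complex.ofReal_pow, Real.sq_sqrt hr]
      linear_combination d ^ 2 * this - he
    have aux : ∀ c : ℝ, c ≠ 0 → d * (Real.sqrt r : ℂ) + c ≠ 0 := by
      intro c hc h
      have e1 := congrArg Complex.im h
      have e2 := congrArg Complex.re h
      simp only [Complex.add_im, Complex.im_mul_ofReal, Complex.ofReal_im, add_zero,
        Complex.zero_im, mul_eq_zero, Complex.add_re, Complex.re_mul_ofReal, Complex.ofReal_re,
        Complex.zero_re] at e1 e2
      rcases e1 with e1 | e1
      · exact him e1
      · rw [e1] at e2; simp at e2; exact hc e2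
    rcases mul_eq_zero.1 h1 with h | h
    · exact aux (-1) (by norm_num) (by push_cast; linear_combination h)
    · exact aux 1 one_ne_zero (by push_cast; linear_combination h)
  obtain ⟨c, hc, hs⟩ := hoff.exists_separated (pow_ne_zero 2 hd)
  refine ⟨‖d‖ * 2 * c⁻¹, by positivity, fun v => ?_⟩
  have h1 := hs 1 (v ^ 2) zero_le_one (sq_nonneg v)
  have h2 : ‖(d * v - 1) * (d * v + 1)‖ = ‖((1 : ℝ) : ℂ) * 1 - ((v ^ 2 : ℝ) : ℂ) * d ^ 2‖ := by
    rw [← norm_neg]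
    congr 1
    push_cast
    ring
  rw [norm_mul, norm_div, h2, div_eq_mul_inv]
  have h3 : (‖((1 : ℝ) : ℂ) * 1 - ((v ^ 2 : ℝ) : ℂ) * d ^ 2‖)⁻¹ ≤ (c * (1 + v ^ 2))⁻¹ :=
    inv_anti₀ (by positivity) h1
  rw [mul_inv] at h3
  calc _ ≤ ‖d‖ * (2 * (c⁻¹ * (1 + v ^ 2)⁻¹)) := by
        gcongr
        simp
    _ = _ := by ring

/-- The integral of `exp (-s z (u - 1)) 2 / ((u - 1) (u + 1))` along the ray through `d`. -/
noncomputable def twoPole (d z s : ℂ) : ℂ :=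
  ∫ v in Ioi (0 : ℝ), Complex.exp (-(s * z * (d * v - 1))) *
    (d * (2 / ((d * v - 1) * (d * v + 1))))

lemma continuous_twoPole_integrand {d : ℂ} (him : d.im ≠ 0) (z s : ℂ) :
    Continuous (fun v : ℝ => Complex.exp (-(s * z * (d * v - 1))) *
      (d * (2 / ((d * v - 1) * (d * v + 1))))) := by
  have hne : ∀ (v : ℝ) (c : ℝ), c ≠ 0 → d * v + c ≠ 0 := fun v c =>
    mul_add_ofReal_ne_zero him v
  have h1 : ∀ v : ℝ, (d * v - 1) * (d * v + 1) ≠ 0 := fun v => mul_ne_zero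
    (by simpa [sub_eq_add_neg] using hne v (-1) (by norm_num)) (by simpa using hne v 1 one_ne_zero)
  have h2 : Continuous fun v : ℝ => (2 : ℂ) / ((d * v - 1) * (d * v + 1)) :=
    Continuous.div (by fun_prop) (by fun_prop) h1
  fun_prop

lemma norm_twoPole_integrand_le {d z s : ℂ} {C : ℝ}
    (hC : ∀ v : ℝ, ‖d * (2 / ((d * v - 1) * (d * v + 1)))‖ ≤ C * (1 + v ^ 2)⁻¹)
    (hre : 0 ≤ (s * z * d).re) (hs : ‖s‖ ≤ 2) {v : ℝ} (hv : 0 < v) :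
    ‖Complex.exp (-(s * z * (d * v - 1))) * (d * (2 / ((d * v - 1) * (d * v + 1))))‖ ≤
      Real.exp (2 * ‖z‖) * (C * (1 + v ^ 2)⁻¹) := by
  rw [norm_mul]
  refine mul_le_mul ?_ (hC v) (norm_nonneg _) (Real.exp_pos _).le
  rw [Complex.norm_exp]
  apply Real.exp_le_exp.2
  have h1 : -(s * z * (d * v - 1)) = s * z - s * z * d * (v : ℂ) := by ring
  rw [h1, Complex.sub_re, Complex.re_mul_ofReal]
  have h2 : (s * z).re ≤ ‖s‖ * ‖z‖ := (Complex.re_le_norm _).trans (norm_mul _ _).le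
  have h3 : ‖s‖ * ‖z‖ ≤ 2 * ‖z‖ := by gcongr
  nlinarith [mul_nonneg hre hv.le]

lemma integrableOn_bound (a C : ℝ) : IntegrableOn (fun v : ℝ => a * (C * (1 + v ^ 2)⁻¹)) (Ioi 0) :=
  ((integrable_inv_one_add_sq.const_mul C).const_mul a).integrableOn

lemma hasDerivAt_twoPole {d z : ℂ} (him : d.im ≠ 0) {s : ℝ} (hs0 : 0 < s) (hs1 : s ≤ 1)
    (hre : 0 < (z * d).re) :
    HasDerivAt (fun s : ℝ => twoPole d z s)
      (2 * z * Complex.exp (s * z) * rayKernel [(d, s * z)] (-1)) s := by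
  obtain ⟨C, hC0, hC⟩ := exists_quadratic_bound him
  have hUo : IsOpen {w : ℂ | 0 < (w * z * d).re ∧ ‖w‖ < 2} :=
    (isOpen_lt continuous_const (Complex.continuous_re.comp (by fun_prop))).inter
      (isOpen_lt continuous_norm continuous_const)
  have hmem : (s : ℂ) ∈ {w : ℂ | 0 < (w * z * d).re ∧ ‖w‖ < 2} := by
    refine ⟨?_, ?_⟩
    · rw [mul_assoc, Complex.re_ofReal_mul]; positivity
    · rw [Complex.norm_real, Real.norm_of_nonneg hs0.le]; linarith
  obtain ⟨-, h⟩ := hasDerivAt_integral_of_differentiable (x := (s : ℂ))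
    (μ := volume.restrict (Ioi (0 : ℝ)))
    (f := fun w v => Complex.exp (-(w * z * (d * v - 1))) *
      (d * (2 / ((d * (v : ℂ) - 1) * (d * v + 1)))))
    (hUo.mem_nhds hmem)
    (fun w _ => (continuous_twoPole_integrand him z w).aestronglyMeasurable)
    (Eventually.of_forall fun v w _ => by fun_prop)
    (by
      filter_upwards [ae_restrict_mem measurableSet_Ioi] with v hv w hw
      exact norm_twoPole_integrand_le hC hw.1.le hw.2.le hv)
    (integrableOn_bound _ _)
  have h' : HasDerivAt (fun s : ℝ => twoPole d z s) _ s := h.comp_ofReal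
  refine h'.congr_deriv ?_
  simp only [rayKernel, rayInt, one_mul]
  rw [← integral_const_mul]
  refine setIntegral_congr_fun measurableSet_Ioi fun v hv => ?_
  have e1 : HasDerivAt (fun w : ℂ => Complex.exp (-(w * z * (d * v - 1))))
      (Complex.exp (-(s * z * (d * v - 1))) * (-(z * (d * v - 1)))) s := by
    have : HasDerivAt (fun w : ℂ => -(w * z * (d * v - 1))) (-(z * (d * v - 1))) (s : ℂ) := by
      simpa using (((hasDerivAt_id (s : ℂ)).mul_const z).mul_const (d * (v : ℂ) - 1)).fun_neg
    exact this.cexp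
  rw [(e1.mul_const _).deriv]
  have e2 : Complex.exp (-(s * z * (d * v - 1))) =
      Complex.exp (s * z) * Complex.exp (-(s * z * (d * v))) := by
    rw [← Complex.exp_add]; ring_nf
  rw [e2]
  have hne : ∀ c : ℝ, c ≠ 0 → d * v + c ≠ 0 := fun c => mul_add_ofReal_ne_zero him v
  have n1 : d * v - 1 ≠ 0 := by simpa [sub_eq_add_neg] using hne (-1) (by norm_num)
  have n2 : d * v + 1 ≠ 0 := by simpa using hne 1 one_ne_zero
  have n3 : -1 - d * v ≠ 0 := fun h => n2 (by linear_combination -h)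
  field_simp
  ring

lemma continuousOn_twoPole {d z : ℂ} (him : d.im ≠ 0) (hre : 0 < (z * d).re) :
    ContinuousOn (fun s : ℝ => twoPole d z s) (Icc 0 1) := by
  obtain ⟨C, hC0, hC⟩ := exists_quadratic_bound him
  refine continuousOn_of_dominated (bound := fun v => Real.exp (2 * ‖z‖) * (C * (1 + v ^ 2)⁻¹))
    ?_ ?_ (integrableOn_bound _ _) ?_
  · exact fun s _ => (continuous_twoPole_integrand him z s).aestronglyMeasurable
  · intro s hs
    filter_upwards [ae_restrict_mem measurableSet_Ioi] with v hv
    refine norm_twoPole_integrand_le hC ?_ ?_ hv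
    · rw [mul_assoc, Complex.re_ofReal_mul]; exact mul_nonneg hs.1 hre.le
    · rw [Complex.norm_real, Real.norm_of_nonneg hs.1]; linarith [hs.2]
  · exact Eventually.of_forall fun v => Continuous.continuousOn (by fun_prop)

lemma rayKernel_neg_one_eq {z : ℂ} {α β : ℝ} (hα : α < Real.pi) (hβ : -Real.pi < β) (hβα : β ≤ α)
    (hre : ∀ τ ∈ Icc β α, 0 < (z * dir τ).re) :
    rayKernel [(dir α, z)] (-1) = rayKernel [(dir β, z)] (-1) := by
  have h := rayKernel_eq_of_segment [(1, z, α, β)] (-1) (fun τ hτ => by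
    have hmem : α + τ * (β - α) ∈ Icc β α := by
      constructor <;> nlinarith [hτ.1, hτ.2]
    refine ⟨?_, ?_, trivial⟩
    · intro r hr he
      have he' : (-1 : ℂ) = r * dir (α + τ * (β - α)) := by
        simpa [rotPair, dir] using he
      have hn := congrArg norm he'
      rw [norm_mul, norm_dir, Complex.norm_real, Real.norm_of_nonneg hr] at hn
      have hr1 : r = 1 := by simpa using hn.symm
      have hre := congrArg Complex.re he'
      rw [hr1, Complex.ofReal_one, one_mul, dir_re] at hre
      have hre' : Real.cos (α + τ * (β - α)) = -1 := by simpa using hre.symm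
      have hc := Real.cos_lt_cos_of_nonneg_of_le_pi (abs_nonneg (α + τ * (β - α))) le_rfl
        (abs_lt.2 ⟨by linarith [hmem.1], by linarith [hmem.2]⟩)
      rw [Real.cos_pi, Real.cos_abs, hre'] at hc
      exact lt_irrefl _ hc
    · have := hre _ hmem
      simpa [rotPair, dir] using this)
  simpa [rotPair, dir] using h

lemma twoPole_one {d z : ℂ} (him : d.im ≠ 0) (hre : 0 < (z * d).re) :
    twoPole d z 1 = Complex.exp z * (rayKernel [(d, z)] (-1) - rayKernel [(d, z)] 1) := by
  have hadm : ∀ c : ℝ, c ≠ 0 → Admissible (c : ℂ) [(d, z)] := by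
    refine fun c hc => ⟨?_, hre, trivial⟩
    intro r hr he
    have h1 := congrArg Complex.im he
    have h2 := congrArg Complex.re he
    simp at h1 h2
    rcases h1 with h1 | h1
    · subst h1; simp at h2; exact hc h2
    · exact him h1
  have i1 := (hadm (-1) (by norm_num)).integrableOn
  have i2 := (hadm 1 one_ne_zero).integrableOn
  simp only [Complex.ofReal_neg, Complex.ofReal_one] at i1 i2
  simp only [rayKernel, rayInt] at i1 i2 ⊢
  rw [← integral_sub i1 i2, ← integral_const_mul]
  refine setIntegral_congr_fun measurableSet_Ioi fun v hv => ?_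
  have e2 : Complex.exp (-(1 * z * (d * v - 1))) =
      Complex.exp z * Complex.exp (-(z * (d * v))) := by
    rw [← Complex.exp_add]; ring_nf
  rw [e2]
  have hne : ∀ c : ℝ, c ≠ 0 → d * v + c ≠ 0 := fun c => mul_add_ofReal_ne_zero him v
  have n1 : d * v - 1 ≠ 0 := by simpa [sub_eq_add_neg] using hne (-1) (by norm_num)
  have n2 : d * v + 1 ≠ 0 := by simpa using hne 1 one_ne_zero
  have n3 : -1 - d * v ≠ 0 := fun h => n2 (by linear_combination -h)
  have n4 : 1 - d * v ≠ 0 := fun h => n1 (by linear_combination -h)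
  field_simp
  ring

/-- The jump of `∫ exp (-z u) / (1 - u) du` as the ray of integration crosses the pole `u = 1`. The
integral of `exp (-s z (u - 1)) 2 / ((u - 1) (u + 1))` has a jump which does not depend on `s`,
since its derivative has no pole at `u = 1`, and it is elementary for `s = 0`. -/
lemma rayKernel_jump_one {z : ℂ} {α β : ℝ} (hα0 : 0 < α) (hα : α < Real.pi) (hβ0 : β < 0)
    (hβ : -Real.pi < β) (hre : ∀ τ ∈ Icc β α, 0 < (z * dir τ).re) :
    rayKernel [(dir α, z)] 1 - rayKernel [(dir β, z)] 1 =
      2 * Real.pi * Complex.I * Complex.exp (-z) := by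
  have hβα : β ≤ α := by linarith
  have imα : 0 < (dir α).im := by rw [dir_im]; exact Real.sin_pos_of_pos_of_lt_pi hα0 hα
  have imβ : (dir β).im < 0 := by rw [dir_im]; exact Real.sin_neg_of_neg_of_neg_pi_lt hβ0 hβ
  have reα := hre α ⟨hβα, le_rfl⟩
  have reβ := hre β ⟨le_rfl, hβα⟩
  have hcont : ContinuousOn (fun s : ℝ => twoPole (dir α) z s - twoPole (dir β) z s) (Icc 0 1) :=
    (continuousOn_twoPole imα.ne' reα).sub (continuousOn_twoPole imβ.ne reβ)
  have hd : ∀ s ∈ Ioo (0 : ℝ) 1, HasDerivAt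
      (fun s : ℝ => twoPole (dir α) z s - twoPole (dir β) z s) 0 s := by
    intro s hs
    refine ((hasDerivAt_twoPole imα.ne' hs.1 hs.2.le reα).sub
      (hasDerivAt_twoPole imβ.ne hs.1 hs.2.le reβ)).congr_deriv ?_
    rw [rayKernel_neg_one_eq hα hβ hβα, sub_self]
    intro τ hτ
    rw [mul_assoc, Complex.re_ofReal_mul]
    exact mul_pos hs.1 (hre τ hτ)
  -- The jump is constant on `(0, 1]`, and at `s = 0` it is reached by continuity only, since the
  -- exponential does not decay there.
  have h10 : twoPole (dir α) z (1 : ℝ) - twoPole (dir β) z (1 : ℝ) =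
      twoPole (dir α) z (0 : ℝ) - twoPole (dir β) z (0 : ℝ) := by
    have h1 : ∀ s ∈ Ioo (0 : ℝ) 1, twoPole (dir α) z s - twoPole (dir β) z s =
        twoPole (dir α) z (1 : ℝ) - twoPole (dir β) z (1 : ℝ) := fun s hs =>
      (constant_of_has_deriv_right_zero (a := s) (b := 1)
        (hcont.mono (Icc_subset_Icc_left hs.1.le))
        (fun x hx => (hd x ⟨hs.1.trans_le hx.1, hx.2⟩).hasDerivWithinAt) 1 ⟨hs.2.le, le_rfl⟩).symm
    have h2 := ((hcont 0 (by simp)).mono Ioo_subset_Icc_self).tendsto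
    rw [nhdsWithin_Ioo_eq_nhdsGT one_pos] at h2
    refine (tendsto_nhds_unique h2 (tendsto_const_nhds.congr' ?_)).symm
    filter_upwards [Ioo_mem_nhdsGT one_pos] with s hs using (h1 s hs).symm
  have h0 : ∀ (d : ℂ) (σ : ℝ), (σ = 1 ∨ σ = -1) → 0 < σ * d.im →
      twoPole d z (0 : ℝ) = -(σ * Real.pi * Complex.I) := by
    intro d σ hσ hd
    have him : d.im ≠ 0 := by rintro h; simp [h] at hd
    obtain ⟨C, hC0, hC⟩ := exists_quadratic_bound him
    have hint : IntegrableOn (fun v : ℝ => d * (2 / ((d * v - 1) * (d * v + 1)))) (Ioi 0) := by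
      have := continuous_twoPole_integrand him 0 0
      simp only [zero_mul, neg_zero, Complex.exp_zero, one_mul] at this
      refine Integrable.mono' (g := fun v => C * (1 + v ^ 2)⁻¹)
        (integrable_inv_one_add_sq.const_mul C).integrableOn this.aestronglyMeasurable
        (Eventually.of_forall hC)
    rw [← integral_ray_two_div hσ hd hint]
    simp [twoPole]
  rw [h0 _ 1 (Or.inl rfl) (by simpa using imα), h0 _ (-1) (Or.inr rfl) (by simpa using imβ),
    Complex.ofReal_one, twoPole_one imα.ne' reα, twoPole_one imβ.ne reβ,
    rayKernel_neg_one_eq hα hβ hβα hre] at h10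
  have he : Complex.exp z * Complex.exp (-z) = 1 := by rw [← Complex.exp_add]; simp
  push_cast at h10
  linear_combination (-Complex.exp (-z)) * h10 -
    (rayKernel [(dir α, z)] 1 - rayKernel [(dir β, z)] 1) * he

/-! ### Wall crossing for the iterated integrals -/

lemma rayKernel_cons (x : ℂ × ℂ) (L : List (ℂ × ℂ)) (t : ℂ) :
    rayKernel (x :: L) t = rayInt x fun u => rayKernel L u * (t - u)⁻¹ := rfl

lemma rayKernel_jump {p z : ℂ} (hp : p ≠ 0) {α β : ℝ} (hα0 : 0 < α) (hα : α < Real.pi)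
    (hβ0 : β < 0) (hβ : -Real.pi < β) (hre : ∀ τ ∈ Icc β α, 0 < (z * (p * dir τ)).re) :
    rayKernel [(p * dir α, z)] p - rayKernel [(p * dir β, z)] p =
      2 * Real.pi * Complex.I * Complex.exp (-(z * p)) := by
  have h := fun τ => rayKernel_rotate hp [(dir τ, z * p)] 1
  simp only [List.map_cons, List.map_nil, mul_comm _ p, mul_div_cancel_left₀ _ hp, mul_one] at h
  have e := rayKernel_jump_one (z := p * z) hα0 hα hβ0 hβ (fun τ hτ => by
    have := hre τ hτ
    rwa [show p * z * dir τ = z * (p * dir τ) by ring])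
  rw [h, h, e, mul_comm p z]

lemma rayKernel_eq_of_offRay {p z t : ℂ} {α β : ℝ} (hβα : β ≤ α)
    (hoff : ∀ τ ∈ Icc β α, OffRay t (p * dir τ))
    (hre : ∀ τ ∈ Icc β α, 0 < (z * (p * dir τ)).re) :
    rayKernel [(p * dir α, z)] t = rayKernel [(p * dir β, z)] t := by
  have h := rayKernel_eq_of_segment [(p, z, α, β)] t (fun τ hτ => by
    have hmem : α + τ * (β - α) ∈ Icc β α := by
      constructor <;> nlinarith [hτ.1, hτ.2]
    have h1 := hoff _ hmem
    have h2 := hre _ hmem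
    exact ⟨by simpa [rotPair, dir] using h1, by simpa [rotPair, dir] using h2, trivial⟩)
  simpa [rotPair, dir] using h

lemma offRay_mul_dir {d : ℂ} (hd : d ≠ 0) {α : ℝ} (h : Real.sin α ≠ 0) : OffRay (d * dir α) d := by
  intro r _ he
  have h1 : dir α = r := mul_left_cancel₀ hd (by rw [he, mul_comm])
  have h2 := congrArg Complex.im h1
  rw [dir_im] at h2
  simp at h2
  exact h h2

lemma rayInt_sub {x : ℂ × ℂ} (f g : ℂ → ℂ)
    (hf : IntegrableOn (fun v : ℝ => x.1 * Complex.exp (-(x.2 * (x.1 * v))) * f (x.1 * v)) (Ioi 0))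
    (hg : IntegrableOn (fun v : ℝ => x.1 * Complex.exp (-(x.2 * (x.1 * v))) * g (x.1 * v)) (Ioi 0)) :
    rayInt x f - rayInt x g = rayInt x fun u => f u - g u := by
  unfold rayInt
  rw [← integral_sub hf hg]
  exact integral_congr_ae (Eventually.of_forall fun v => by simp only; ring)

lemma rayInt_const_mul (x : ℂ × ℂ) (f : ℂ → ℂ) (a : ℂ) :
    rayInt x (fun u => a * f u) = a * rayInt x f := by
  unfold rayInt
  rw [← integral_const_mul]
  exact integral_congr_ae (Eventually.of_forall fun v => by simp only; ring)

/-- The kernels used for a ray which has a neighbour `t` on its left, or none. -/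
noncomputable def leftKernel : Option ℂ → ℂ → ℂ
  | none, _ => 1
  | some t, u => (t - u)⁻¹

/-- The condition on a ray direction to have the neighbour `t` on its left, or none. -/
def leftOff : Option ℂ → ℂ → Prop
  | none, _ => True
  | some t, d => OffRay t d

lemma leftKernel_bound {o : Option ℂ} {d : ℂ} (hd : d ≠ 0) (h : leftOff o d) : ∃ K : ℝ,
    ∀ v : ℝ, 0 < v → ‖leftKernel o (d * v)‖ ≤ K ∧ ContinuousAt (leftKernel o) (d * v) := by
  cases o with
  | none => exact ⟨1, fun v _ => ⟨by simp [leftKernel], continuousAt_const⟩⟩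
  | some t =>
    obtain ⟨K, hK⟩ := eventually_kernel_bound (Y := ℂ) (y₀ := 0) (differentiable_const t)
      (differentiable_const d) h hd
    exact ⟨K, fun v hv => ⟨(hK.self_of_nhds v hv).1, (hK.self_of_nhds v hv).2.2⟩⟩

/-- The jump of the integral of `exp (-z u) k(u) / (u - p)` as the ray crosses the pole `p`. For
`k(u) = 1 / (t - u)` partial fractions reduce it to the jump of the simple pole at `p`, because the
rays avoid the pole at `t`. -/
lemma rayInt_leftKernel_jump {o : Option ℂ} {p z : ℂ} (hp : p ≠ 0) {α β : ℝ} (hα0 : 0 < α)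
    (hα : α < Real.pi) (hβ0 : β < 0) (hβ : -Real.pi < β)
    (hre : ∀ τ ∈ Icc β α, 0 < (z * (p * dir τ)).re) (hoff : ∀ τ ∈ Icc β α, leftOff o (p * dir τ)) :
    rayInt (p * dir α, z) (fun u => leftKernel o u * (u - p)⁻¹) -
      rayInt (p * dir β, z) (fun u => leftKernel o u * (u - p)⁻¹) =
      -(2 * Real.pi * Complex.I) * (Complex.exp (-(z * p)) * leftKernel o p) := by
  have hβα : β ≤ α := by linarith
  have hjump := rayKernel_jump hp hα0 hα hβ0 hβ hre
  have offp : ∀ τ : ℝ, Real.sin τ ≠ 0 → OffRay p (p * dir τ) := fun τ hτ =>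
    (offRay_mul_dir hp hτ).symm hp
  have sα : Real.sin α ≠ 0 := (Real.sin_pos_of_pos_of_lt_pi hα0 hα).ne'
  have sβ : Real.sin β ≠ 0 := (Real.sin_neg_of_neg_of_neg_pi_lt hβ0 hβ).ne
  cases o with
  | none =>
    have h : ∀ d : ℂ, rayInt (d, z) (fun u => leftKernel none u * (u - p)⁻¹) =
        (-1) * rayKernel [(d, z)] p := by
      intro d
      simp only [rayKernel]
      rw [← rayInt_const_mul]
      refine rayInt_congr fun v _ => ?_
      rw [leftKernel, ← neg_sub p, inv_neg]
      ring
    rw [h, h]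
    simp only [leftKernel]
    linear_combination -hjump
  | some t =>
    -- The part of the partial fraction with the pole `t` has no jump.
    have hside := rayKernel_eq_of_offRay hβα hoff hre
    have h : ∀ τ ∈ Icc β α, Real.sin τ ≠ 0 →
        rayInt (p * dir τ, z) (fun u => leftKernel (some t) u * (u - p)⁻¹) =
        (t - p)⁻¹ * (rayKernel [(p * dir τ, z)] t - rayKernel [(p * dir τ, z)] p) := by
      intro τ hτ hs
      have o1 : OffRay t (p * dir τ) := hoff τ hτ
      have o2 := offp τ hs
      have o3 : t - p ≠ 0 := by
        have := hoff 0 ⟨hβ0.le, hα0.le⟩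
        have h1 := OffRay.sub_ne_zero this zero_le_one
        simpa using h1
      simp only [rayKernel]
      rw [rayInt_sub (fun u => 1 * (t - u)⁻¹) (fun u => 1 * (p - u)⁻¹),
        ← rayInt_const_mul]
      · refine rayInt_congr fun v hv => ?_
        have e1 := o1.sub_ne_zero hv.le
        have e2 := o2.sub_ne_zero hv.le
        have ha := mul_inv_cancel₀ e1
        have hb := mul_inv_cancel₀ e2
        have hc := mul_inv_cancel₀ o3
        have hn : (p * dir τ * v - p)⁻¹ = -(p - p * dir τ * v)⁻¹ := by rw [← neg_sub, inv_neg]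
        simp only [leftKernel, one_mul]
        rw [hn]
        linear_combination (t - p * dir τ * v)⁻¹ * (p - p * dir τ * v)⁻¹ * hc +
          (t - p)⁻¹ * (t - p * dir τ * v)⁻¹ * hb - (t - p)⁻¹ * (p - p * dir τ * v)⁻¹ * ha
      · exact Admissible.integrableOn (L := []) (x := (p * dir τ, z)) ⟨o1, hre τ hτ, trivial⟩
      · exact Admissible.integrableOn (L := []) (x := (p * dir τ, z)) ⟨o2, hre τ hτ, trivial⟩
    rw [h α ⟨hβα, le_rfl⟩ sα, h β ⟨le_rfl, hβα⟩ sβ, hside]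
    simp only [leftKernel]
    linear_combination -(t - p)⁻¹ * hjump

/-- The integrand of the double integral over the rays through `x.1` and `y.1`. -/
noncomputable def doubleIntegrand (x y : ℂ × ℂ) (L : List (ℂ × ℂ)) (k : ℂ → ℂ) (v w : ℝ) : ℂ :=
  (x.1 * Complex.exp (-(x.2 * (x.1 * v)))) * (y.1 * Complex.exp (-(y.2 * (y.1 * w)))) *
    (rayKernel L (y.1 * w) * (x.1 * v - y.1 * w)⁻¹ * k (x.1 * v))

/-- The separation of the two rays gives `|u - u'| ≥ c |u|^(1/2) |u'|^(1/2)`, so that the double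
integral converges absolutely. -/
lemma integrable_doubleIntegrand {x y : ℂ × ℂ} {L : List (ℂ × ℂ)}
    (h : AdmissibleList (x :: y :: L)) {k : ℂ → ℂ} {K : ℝ}
    (hk : ∀ v : ℝ, 0 < v → ‖k (x.1 * v)‖ ≤ K ∧ ContinuousAt k (x.1 * v)) :
    Integrable (Function.uncurry (doubleIntegrand x y L k))
      ((volume.restrict (Ioi (0 : ℝ))).prod (volume.restrict (Ioi (0 : ℝ)))) := by
  obtain ⟨hx, hxy, hy, hL⟩ := h
  have hx0 := ne_zero_of_re_mul_pos hx
  have hy0 := ne_zero_of_re_mul_pos hy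
  obtain ⟨c1, hc1, hsep⟩ := hxy.exists_separated hy0
  obtain ⟨c2, hc2, hch⟩ := Admissible.eventually_sepChain (x := (0 : ℂ)) (t := fun _ => y.1)
    (L := L.map fun p => (fun _ => p.1, fun _ => p.2)) continuousAt_const (by
      intro q hq
      obtain ⟨p, _, rfl⟩ := List.mem_map.1 hq
      exact ⟨continuousAt_const, continuousAt_const⟩)
    (by simpa [evalList, Function.comp_def] using hL)
  have hch' : SepChain c2 y.1 L := by
    simpa [evalList, Function.comp_def] using hch.self_of_nhds
  obtain ⟨C, hC0, hC⟩ := norm_rayKernel_le L.length hc2 (1 / 4) (by norm_num) (by norm_num)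
  set cx := (x.2 * x.1).re
  set cy := (y.2 * y.1).re
  have hK0 : 0 ≤ K := (norm_nonneg _).trans (hk 1 one_pos).1
  let gx : ℝ → ℝ := fun v => v ^ (-(1 / 2) : ℝ) * Real.exp (-cx * v)
  let gy : ℝ → ℝ := fun w => w ^ (-(1 / 2) : ℝ) * Real.exp (-cy * w) +
    w ^ (-(3 / 4) : ℝ) * Real.exp (-cy * w)
  have hgx : IntegrableOn gx (Ioi 0) := integrableOn_rpow_mul_exp hx (by norm_num)
  have hgy : IntegrableOn gy (Ioi 0) := (integrableOn_rpow_mul_exp hy (by norm_num)).add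
    (integrableOn_rpow_mul_exp hy (by norm_num))
  have hprod := (Integrable.mul_prod hgx hgy).const_mul (‖x.1‖ * ‖y.1‖ * C * c1⁻¹ * K)
  refine hprod.mono' ?_ ?_
  · rw [Measure.prod_restrict]
    refine ContinuousOn.aestronglyMeasurable ?_ (measurableSet_Ioi.prod measurableSet_Ioi)
    rintro ⟨v, w⟩ ⟨hv, hw⟩
    have hv : (0 : ℝ) < v := hv
    have hw : (0 : ℝ) < w := hw
    have hne : x.1 * v - y.1 * w ≠ 0 := (hxy.smul_left hv).sub_ne_zero hw.le
    have c1 : ContinuousAt (fun q : ℝ × ℝ => rayKernel L (y.1 * q.2)) (v, w) :=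
      ContinuousAt.comp (f := fun q : ℝ × ℝ => y.1 * (q.2 : ℂ)) (g := rayKernel L)
        (continuousAt_rayKernel (hL.smul hw)) (by fun_prop)
    have c2 : ContinuousAt (fun q : ℝ × ℝ => k (x.1 * q.1)) (v, w) :=
      ContinuousAt.comp (f := fun q : ℝ × ℝ => x.1 * (q.1 : ℂ)) (g := k)
        (hk v hv).2 (by fun_prop)
    have c3 : ContinuousAt (fun q : ℝ × ℝ => (x.1 * (q.1 : ℂ) - y.1 * q.2)⁻¹) (v, w) :=
      ContinuousAt.inv₀ (by fun_prop) hne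
    have c4 : ContinuousAt (fun q : ℝ × ℝ => (x.1 * Complex.exp (-(x.2 * (x.1 * (q.1 : ℂ))))) *
      (y.1 * Complex.exp (-(y.2 * (y.1 * (q.2 : ℂ)))))) (v, w) := by fun_prop
    exact (c4.mul ((c1.mul c3).mul c2)).continuousWithinAt
  · rw [Measure.prod_restrict]
    filter_upwards [ae_restrict_mem (measurableSet_Ioi.prod measurableSet_Ioi)] with q hq
    obtain ⟨v, w⟩ := q
    obtain ⟨hv, hw⟩ := hq
    have hv : (0 : ℝ) < v := hv
    have hw : (0 : ℝ) < w := hw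
    have e1 := hC L rfl y.1 w hw hch'
    have e2 : c1 * (v ^ (1 / 2 : ℝ) * w ^ (1 / 2 : ℝ)) ≤ ‖x.1 * v - y.1 * w‖ := by
      have e3 := hsep v w hv.le hw.le
      rw [mul_comm x.1, mul_comm y.1]
      refine le_trans (mul_le_mul_of_nonneg_left ?_ hc1.le) e3
      have := Real.geom_mean_le_arith_mean2_weighted (by norm_num : (0 : ℝ) ≤ 1 / 2)
        (by norm_num : (0 : ℝ) ≤ 1 / 2) hv.le hw.le (by norm_num)
      linarith
    have e4 : ‖(x.1 * v - y.1 * w)⁻¹‖ ≤ c1⁻¹ * (v ^ (-(1 / 2) : ℝ) * w ^ (-(1 / 2) : ℝ)) := by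
      rw [norm_inv]
      refine (inv_anti₀ (by positivity) e2).trans_eq ?_
      rw [mul_inv, mul_inv, ← Real.rpow_neg hv.le, ← Real.rpow_neg hw.le]
    have e5 := norm_exp_neg_mul_le (le_refl cx) hv.le
    have e6 := norm_exp_neg_mul_le (le_refl cy) hw.le
    have e7 := (hk v hv).1
    simp only [Function.uncurry, doubleIntegrand, norm_mul]
    calc _ ≤ (‖x.1‖ * Real.exp (-cx * v)) * (‖y.1‖ * Real.exp (-cy * w)) *
          (C * (1 + w ^ (-(1 / 4) : ℝ)) *
            (c1⁻¹ * (v ^ (-(1 / 2) : ℝ) * w ^ (-(1 / 2) : ℝ))) * K) := by gcongr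
      _ = _ := by
        have : w ^ (-(3 / 4) : ℝ) = w ^ (-(1 / 4) : ℝ) * w ^ (-(1 / 2) : ℝ) := by
          rw [← Real.rpow_add hw]; norm_num
        simp only [gx, gy, this]; ring

/-- The integrations over the first two rays may be interchanged. -/
lemma rayInt_swap {x y : ℂ × ℂ} {L : List (ℂ × ℂ)}
    (h : AdmissibleList (x :: y :: L)) {k : ℂ → ℂ} {K : ℝ}
    (hk : ∀ v : ℝ, 0 < v → ‖k (x.1 * v)‖ ≤ K ∧ ContinuousAt k (x.1 * v)) :
    IntegrableOn (fun w : ℝ => y.1 * Complex.exp (-(y.2 * (y.1 * w))) *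
      (rayKernel L (y.1 * w) * rayInt x fun u => k u * (u - y.1 * w)⁻¹)) (Ioi 0) ∧
    rayInt x (fun u => rayKernel (y :: L) u * k u) =
      rayInt y fun p => rayKernel L p * rayInt x fun u => k u * (u - p)⁻¹ := by
  have hint := integrable_doubleIntegrand h hk
  have e : ∀ w : ℝ, (y.1 * Complex.exp (-(y.2 * (y.1 * w))) *
      (rayKernel L (y.1 * w) * rayInt x fun u => k u * (u - y.1 * w)⁻¹)) =
      ∫ v in Ioi (0 : ℝ), doubleIntegrand x y L k v w := by
    intro w
    unfold rayInt
    rw [← mul_assoc, ← integral_const_mul]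
    refine integral_congr_ae (Eventually.of_forall fun v => ?_)
    simp only [doubleIntegrand]; ring
  constructor
  · simp only [e]
    exact hint.integral_prod_right
  · have e2 : ∀ v : ℝ, (x.1 * Complex.exp (-(x.2 * (x.1 * v))) *
        (rayKernel (y :: L) (x.1 * v) * k (x.1 * v))) =
        ∫ w in Ioi (0 : ℝ), doubleIntegrand x y L k v w := by
      intro v
      rw [rayKernel]
      unfold rayInt
      rw [mul_comm _ (k _), ← mul_assoc, ← integral_const_mul]
      refine integral_congr_ae (Eventually.of_forall fun w => ?_)
      simp only [doubleIntegrand]; ring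
    conv_lhs => rw [rayInt]
    conv_rhs => rw [rayInt]
    simp only [e, e2]
    exact integral_integral_swap hint

/-- The change of an iterated integral as its first ray crosses the second one, from its
anticlockwise to its clockwise side. -/
lemma rayInt_wall {o : Option ℂ} {d z z₂ : ℂ} {L : List (ℂ × ℂ)} {α β : ℝ} (hα0 : 0 < α)
    (hα : α < Real.pi) (hβ0 : β < 0) (hβ : -Real.pi < β)
    (hre : ∀ τ ∈ Icc β α, 0 < (z * (d * dir τ)).re) (hoff : ∀ τ ∈ Icc β α, leftOff o (d * dir τ))
    (h2 : 0 < (z₂ * d).re) (hL : Admissible d L) :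
    rayInt (d * dir α, z) (fun u => rayKernel ((d, z₂) :: L) u * leftKernel o u) -
      rayInt (d * dir β, z) (fun u => rayKernel ((d, z₂) :: L) u * leftKernel o u) =
      -(2 * Real.pi * Complex.I) * rayInt (d, z + z₂) fun u => rayKernel L u * leftKernel o u := by
  have hd := ne_zero_of_re_mul_pos h2
  have hβα : β ≤ α := by linarith
  have sα : Real.sin α ≠ 0 := (Real.sin_pos_of_pos_of_lt_pi hα0 hα).ne'
  have sβ : Real.sin β ≠ 0 := (Real.sin_neg_of_neg_of_neg_pi_lt hβ0 hβ).ne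
  have mα : α ∈ Icc β α := ⟨hβα, le_rfl⟩
  have mβ : β ∈ Icc β α := ⟨le_rfl, hβα⟩
  obtain ⟨K1, hK1⟩ := leftKernel_bound (mul_ne_zero hd (dir_ne_zero α)) (hoff α mα)
  obtain ⟨K2, hK2⟩ := leftKernel_bound (mul_ne_zero hd (dir_ne_zero β)) (hoff β mβ)
  obtain ⟨i1, s1⟩ := rayInt_swap (x := (d * dir α, z)) (y := (d, z₂)) (L := L)
    (k := leftKernel o) (K := K1) ⟨hre α mα, offRay_mul_dir hd sα, h2, hL⟩ hK1
  obtain ⟨i2, s2⟩ := rayInt_swap (x := (d * dir β, z)) (y := (d, z₂)) (L := L)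
    (k := leftKernel o) (K := K2) ⟨hre β mβ, offRay_mul_dir hd sβ, h2, hL⟩ hK2
  rw [s1, s2, rayInt_sub
    (fun p => rayKernel L p * rayInt (d * dir α, z) fun u => leftKernel o u * (u - p)⁻¹)
    (fun p => rayKernel L p * rayInt (d * dir β, z) fun u => leftKernel o u * (u - p)⁻¹) i1 i2,
    ← rayInt_const_mul, rayInt, rayInt]
  refine setIntegral_congr_fun measurableSet_Ioi fun w hw => ?_
  have hw : (0 : ℝ) < w := hw
  have hw' : (w : ℂ) ≠ 0 := by exact_mod_cast hw.ne'
  have hscale : ∀ τ, rayInt (d * w * dir τ, z) (fun u => leftKernel o u * (u - d * w)⁻¹) =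
      rayInt (d * dir τ, z) (fun u => leftKernel o u * (u - d * w)⁻¹) := fun τ => by
    rw [mul_right_comm]; exact rayInt_scale _ hw
  -- For every point `d w` of the second ray, the first ray crosses the pole `d w`.
  have hj := rayInt_leftKernel_jump (o := o) (p := d * w) (z := z) (mul_ne_zero hd hw') hα0 hα
    hβ0 hβ (fun τ hτ => by
      rw [show z * (d * w * dir τ) = z * (d * dir τ) * (w : ℂ) by ring, Complex.re_mul_ofReal]
      exact mul_pos (hre τ hτ) hw)
    (fun τ hτ => by
      have := hoff τ hτ
      cases o with
      | none => trivial
      | some t =>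
        rw [mul_right_comm]
        exact OffRay.smul_right this hw)
  rw [hscale, hscale] at hj
  have hexp : Complex.exp (-((z + z₂) * (d * w))) =
      Complex.exp (-(z * (d * w))) * Complex.exp (-(z₂ * (d * w))) := by
    rw [← Complex.exp_add]; ring_nf
  simp only
  rw [← mul_sub, hj, hexp]
  ring

lemma admissible_append {t d z : ℂ} {pre L : List (ℂ × ℂ)}
    (h : Admissible t (pre ++ [(d, z)])) {z' : ℂ} (hz : 0 < (z' * d).re) (hL : Admissible d L) :
    Admissible t (pre ++ (d, z') :: L) := by
  induction pre generalizing t with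
  | nil => exact ⟨h.1, hz, hL⟩
  | cons x pre ih => exact ⟨h.1, h.2.1, ih h.2.2⟩

lemma rayKernel_wall {d z z₂ : ℂ} {L : List (ℂ × ℂ)} {α β : ℝ} (hα0 : 0 < α)
    (hα : α < Real.pi) (hβ0 : β < 0) (hβ : -Real.pi < β)
    (hre : ∀ τ ∈ Icc β α, 0 < (z * (d * dir τ)).re)
    (h2 : 0 < (z₂ * d).re) (hL : Admissible d L) (pre : List (ℂ × ℂ)) :
    ∀ t, (∀ τ ∈ Icc β α, Admissible t (pre ++ [(d * dir τ, z)])) →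
    rayKernel (pre ++ (d * dir α, z) :: (d, z₂) :: L) t -
      rayKernel (pre ++ (d * dir β, z) :: (d, z₂) :: L) t =
      -(2 * Real.pi * Complex.I) * rayKernel (pre ++ (d, z + z₂) :: L) t := by
  have hd := ne_zero_of_re_mul_pos h2
  have hβα : β ≤ α := by linarith
  have sα : Real.sin α ≠ 0 := (Real.sin_pos_of_pos_of_lt_pi hα0 hα).ne'
  have sβ : Real.sin β ≠ 0 := (Real.sin_neg_of_neg_of_neg_pi_lt hβ0 hβ).ne
  induction pre with
  | nil =>
    intro t ht
    have := rayInt_wall (o := some t) hα0 hα hβ0 hβ hre (fun τ hτ => (ht τ hτ).1) h2 hL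
    simpa [leftKernel, rayKernel] using this
  | cons x pre ih =>
    intro t ht
    have mα : α ∈ Icc β α := ⟨hβα, le_rfl⟩
    have mβ : β ∈ Icc β α := ⟨le_rfl, hβα⟩
    have a1 : Admissible t (x :: pre ++ (d * dir α, z) :: (d, z₂) :: L) :=
      admissible_append (ht α mα) (hre α mα) ⟨offRay_mul_dir hd sα, h2, hL⟩
    have a2 : Admissible t (x :: pre ++ (d * dir β, z) :: (d, z₂) :: L) :=
      admissible_append (ht β mβ) (hre β mβ) ⟨offRay_mul_dir hd sβ, h2, hL⟩
    simp only [List.cons_append]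
    rw [rayKernel_cons x, rayKernel_cons x, rayKernel_cons x]
    rw [rayInt_sub
      (fun u => rayKernel (pre ++ (d * dir α, z) :: (d, z₂) :: L) u * (t - u)⁻¹)
      (fun u => rayKernel (pre ++ (d * dir β, z) :: (d, z₂) :: L) u * (t - u)⁻¹)
      a1.integrableOn a2.integrableOn, ← rayInt_const_mul]
    refine rayInt_congr fun v hv => ?_
    have := ih (x.1 * v) (fun τ hτ => (ht τ hτ).2.2.smul hv)
    linear_combination (t - x.1 * v)⁻¹ * this

/-- The change of an iterated integral as one of its rays crosses the next one, from its
anticlockwise to its clockwise side, is `-2πi` times the integral in which the residue has merged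
the two variables into one. -/
theorem rayIter_wall {d z z₂ : ℂ} {L : List (ℂ × ℂ)} {α β : ℝ} (hα0 : 0 < α)
    (hα : α < Real.pi) (hβ0 : β < 0) (hβ : -Real.pi < β)
    (hre : ∀ τ ∈ Icc β α, 0 < (z * (d * dir τ)).re)
    (h2 : 0 < (z₂ * d).re) (hL : Admissible d L) (pre : List (ℂ × ℂ))
    (hpre : ∀ τ ∈ Icc β α, AdmissibleList (pre ++ [(d * dir τ, z)])) :
    rayIter (pre ++ (d * dir α, z) :: (d, z₂) :: L) -
      rayIter (pre ++ (d * dir β, z) :: (d, z₂) :: L) =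
      -(2 * Real.pi * Complex.I) * rayIter (pre ++ (d, z + z₂) :: L) := by
  have hd := ne_zero_of_re_mul_pos h2
  have hβα : β ≤ α := by linarith
  have sα : Real.sin α ≠ 0 := (Real.sin_pos_of_pos_of_lt_pi hα0 hα).ne'
  have sβ : Real.sin β ≠ 0 := (Real.sin_neg_of_neg_of_neg_pi_lt hβ0 hβ).ne
  cases pre with
  | nil =>
    have := rayInt_wall (o := none) hα0 hα hβ0 hβ hre (fun τ hτ => trivial) h2 hL
    simpa [leftKernel, rayIter] using this
  | cons x pre =>
    have mα : α ∈ Icc β α := ⟨hβα, le_rfl⟩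
    have mβ : β ∈ Icc β α := ⟨le_rfl, hβα⟩
    have a1 : AdmissibleList (x :: (pre ++ (d * dir α, z) :: (d, z₂) :: L)) :=
      ⟨(hpre α mα).1, admissible_append (hpre α mα).2 (hre α mα) ⟨offRay_mul_dir hd sα, h2, hL⟩⟩
    have a2 : AdmissibleList (x :: (pre ++ (d * dir β, z) :: (d, z₂) :: L)) :=
      ⟨(hpre β mβ).1, admissible_append (hpre β mβ).2 (hre β mβ) ⟨offRay_mul_dir hd sβ, h2, hL⟩⟩
    simp only [List.cons_append, rayIter]
    rw [rayInt_sub (rayKernel (pre ++ (d * dir α, z) :: (d, z₂) :: L))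
      (rayKernel (pre ++ (d * dir β, z) :: (d, z₂) :: L))
      a1.integrableOn a2.integrableOn, ← rayInt_const_mul]
    refine rayInt_congr fun v hv => ?_
    exact rayKernel_wall hα0 hα hβ0 hβ hre h2 hL pre (x.1 * v)
      (fun τ hτ => (hpre τ hτ).2.smul hv)

/-! ### Sums over the ways of cutting a list into blocks -/

section Splittings

variable {α β γ : Type*}

/-- The sum of `f A D` over all ways of writing the list as `A ++ D` with `A ≠ []`. -/
def prefixSum {R : Type*} [AddCommMonoid R] : (List α → List α → R) → List α → R
  | _, [] => 0
  | f, x :: L => f [x] L + prefixSum (fun A D => f (x :: A) D) L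

/-- `consHead x f` sends a list of blocks to the value of `f` after `x` has been added to the first
block; it is zero if there is no block. -/
def consHead {R : Type*} [Zero R] (x : α) (f : List (List α) → R) : List (List α) → R
  | [] => 0
  | A :: D => f ((x :: A) :: D)

/-- The sum of `f D` over all ways `D` of cutting the list into consecutive nonempty blocks. -/
def splitSum {R : Type*} [AddCommMonoid R] : (List (List α) → R) → List α → R
  | f, [] => f []
  | f, x :: L => splitSum (fun D => f ([x] :: D)) L + splitSum (consHead x f) L

/-- All ways of cutting a list into consecutive nonempty blocks. -/
def splittings : List α → List (List (List α))
  | [] => [[]]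
  | x :: L => (splittings L).map (fun D => [x] :: D) ++
      (splittings L).flatMap fun D => match D with
        | [] => []
        | A :: D' => [(x :: A) :: D']

section AddCommMonoid
variable {R : Type*} [AddCommMonoid R]

theorem prefixSum_congr {f g : List α → List α → R} :
    ∀ {L : List α}, (∀ A D, A ≠ [] → A ++ D = L → f A D = g A D) → prefixSum f L = prefixSum g L
  | [], _ => rfl
  | x :: L, h => by
    simp only [prefixSum]
    congr 1
    · exact h _ _ (by simp) rfl
    · exact prefixSum_congr fun A D _ hD => h _ _ (by simp) (by simp [hD])

theorem prefixSum_add (f g : List α → List α → R) (L : List α) :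
    prefixSum (fun A D => f A D + g A D) L = prefixSum f L + prefixSum g L := by
  induction L generalizing f g with
  | nil => simp [prefixSum]
  | cons x L ih => simp only [prefixSum, ih]; abel

theorem prefixSum_zero (L : List α) : prefixSum (fun _ _ => (0 : R)) L = 0 := by
  induction L with
  | nil => rfl
  | cons x L ih => simp [prefixSum, ih]

theorem prefixSum_map (σ : β → α) (f : List α → List α → R) (L : List β) :
    prefixSum f (L.map σ) = prefixSum (fun A D => f (A.map σ) (D.map σ)) L := by
  induction L generalizing f with
  | nil => rfl
  | cons x L ih => simp [prefixSum, ih]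

theorem prefixSum_eq_sum (f : List α → List α → R) (L : List α) :
    prefixSum f L = ∑ k ∈ Finset.range L.length, f (L.take (k + 1)) (L.drop (k + 1)) := by
  induction L generalizing f with
  | nil => rfl
  | cons x L ih =>
    simp only [prefixSum, ih, List.length_cons, Finset.sum_range_succ']
    simpa using add_comm _ _

theorem splitSum_congr {f g : List (List α) → R} :
    ∀ {L : List α}, (∀ D : List (List α), D.flatten = L → [] ∉ D → f D = g D) →
      splitSum f L = splitSum g L
  | [], h => h _ rfl (by simp)
  | x :: L, h => by
    simp only [splitSum]
    congr 1
    · exact splitSum_congr fun D hD hn => h _ (by simp [hD]) (by simp [hn])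
    · refine splitSum_congr fun D hD hn => ?_
      cases D with
      | nil => rfl
      | cons A D =>
        simp only [consHead]
        refine h _ (by simpa using hD) ?_
        simp only [List.mem_cons, not_or] at hn ⊢
        exact ⟨by simp, hn.2⟩

theorem splitSum_add (f g : List (List α) → R) (L : List α) :
    splitSum (fun D => f D + g D) L = splitSum f L + splitSum g L := by
  induction L generalizing f g with
  | nil => rfl
  | cons x L ih =>
    have : consHead x (fun D => f D + g D) = fun D => consHead x f D + consHead x g D := by
      funext D; cases D <;> simp [consHead]
    simp only [splitSum, this, ih]; abel

theorem splitSum_zero (L : List α) : splitSum (fun _ => (0 : R)) L = 0 := by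
  induction L with
  | nil => rfl
  | cons x L ih =>
    have : consHead x (fun _ : List (List α) => (0 : R)) = fun _ => 0 := by
      funext D; cases D <;> rfl
    simp [splitSum, this, ih]

theorem splitSum_map (σ : β → α) (f : List (List α) → R) (L : List β) :
    splitSum f (L.map σ) = splitSum (fun D => f (D.map (List.map σ))) L := by
  induction L generalizing f with
  | nil => rfl
  | cons x L ih =>
    simp only [List.map_cons, splitSum, ih]
    congr 1
    refine splitSum_congr fun D _ _ => ?_
    cases D <;> rfl

/-- Splitting off the first block. -/
theorem splitSum_eq_prefixSum (f : List (List α) → R) {L : List α} (hL : L ≠ []) :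
    splitSum f L = prefixSum (fun A D => splitSum (fun M => f (A :: M)) D) L := by
  induction L generalizing f with
  | nil => exact absurd rfl hL
  | cons x L ih =>
    simp only [splitSum, prefixSum]
    congr 1
    cases L with
    | nil => rfl
    | cons y L => exact ih _ (by simp)

/-- Splitting off the first part of a decomposition commutes with cutting into blocks. -/
theorem splitSum_prefixSum (g : List (List α) → List (List α) → R) (L : List α) :
    splitSum (fun M => prefixSum g M) L =
      prefixSum (fun A D => splitSum (fun C => splitSum (fun M => g C M) D) A) L := by
  induction L generalizing g with
  | nil => rfl
  | cons x L ih =>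
    set g' : List (List α) → List (List α) → R := fun C M => consHead x (fun C => g C M) C with hg'
    have h1 : splitSum (consHead x fun M => prefixSum g M) L = splitSum (fun M => prefixSum g' M) L := by
      refine splitSum_congr fun D _ _ => ?_
      cases D with
      | nil => rfl
      | cons A D => rfl
    have h2 : ∀ D A : List α, splitSum (consHead x fun C => splitSum (fun M => g C M) D) A =
        splitSum (fun C => splitSum (fun M => g' C M) D) A := by
      intro D A
      refine splitSum_congr fun C _ _ => ?_
      cases C with
      | nil => simp [hg', consHead, splitSum_zero]
      | cons A D => rfl
    simp only [splitSum, prefixSum, h1, h2, prefixSum_add, splitSum_add, ih]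
    simp only [consHead, add_zero]
    abel

theorem splitSum_eq_sum_splittings (f : List (List α) → R) (L : List α) :
    splitSum f L = ((splittings L).map f).sum := by
  induction L generalizing f with
  | nil => simp [splitSum, splittings]
  | cons x L ih =>
    simp only [splitSum, splittings, ih, List.map_append, List.map_map, List.sum_append]
    congr 1
    induction splittings L with
    | nil => rfl
    | cons D S ihS => cases D <;> simp [consHead, ihS]

theorem mem_splittings {L : List α} {D : List (List α)} :
    D ∈ splittings L ↔ D.flatten = L ∧ [] ∉ D := by
  induction L generalizing D with
  | nil =>
    simp only [splittings, List.mem_singleton]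
    constructor
    · rintro rfl; simp
    · rintro ⟨h1, h2⟩
      cases D with
      | nil => rfl
      | cons A D => simp at h1 h2; exact absurd h1.1 h2.1
  | cons x L ih =>
    simp only [splittings, List.mem_append, List.mem_map, List.mem_flatMap, ih]
    constructor
    · rintro (⟨E, ⟨h1, h2⟩, rfl⟩ | ⟨E, ⟨h1, h2⟩, h3⟩)
      · simp [h1, h2]
      · cases E with
        | nil => simp at h3
        | cons A E =>
          simp only [List.mem_singleton] at h3
          subst h3
          simp at h1 h2
          simp [h1, h2]
    · rintro ⟨h1, h2⟩
      match D, h1, h2 with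
      | [] :: D, _, h2 => simp at h2
      | [y] :: D, h1, h2 =>
        simp at h1 h2
        exact Or.inl ⟨D, ⟨h1.2, h2⟩, by rw [h1.1]⟩
      | (y :: y' :: A) :: D, h1, h2 =>
        simp at h1 h2
        refine Or.inr ⟨(y' :: A) :: D, ⟨by simpa using h1.2, by simp [h2]⟩, by simp [h1.1]⟩

theorem nodup_splittings (L : List α) : (splittings L).Nodup := by
  induction L with
  | nil => simp [splittings]
  | cons x L ih =>
    rw [splittings, List.nodup_append']
    refine ⟨ih.map fun a b h => by simpa using h, ?_, ?_⟩
    · rw [List.nodup_flatMap]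
      refine ⟨fun D _ => by cases D <;> simp, ih.imp ?_⟩
      intro D E hne
      cases D <;> cases E <;> simp_all [Function.onFun]
      exact fun h h' => hne h.symm h'.symm
    · intro D hD hE
      simp only [List.mem_map, List.mem_flatMap] at hD hE
      obtain ⟨D', _, rfl⟩ := hD
      obtain ⟨E, hE, h⟩ := hE
      cases E with
      | nil => simp at h
      | cons A E =>
        simp at h
        rw [mem_splittings] at hE
        simp [h.1] at hE

/-- Compositions of `n` index the ways of cutting a list of length `n` into blocks. -/
theorem sum_composition_splitWrt (f : List (List α) → R) (L : List α) {n : ℕ} (hn : L.length = n) :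
    ∑ c : Composition n, f (L.splitWrtComposition c) = splitSum f L := by
  subst hn
  classical
  rw [splitSum_eq_sum_splittings, ← List.sum_toFinset _ (nodup_splittings L)]
  refine Finset.sum_bij (fun c _ => L.splitWrtComposition c) ?_ ?_ ?_ (fun _ _ => rfl)
  · intro c _
    rw [List.mem_toFinset, mem_splittings]
    refine ⟨List.flatten_splitWrtComposition _ _, fun h => ?_⟩
    have := List.length_pos_of_mem_splitWrtComposition h
    simp at this
  · intro c _ c' _ h
    have := congrArg (List.map List.length) h
    rw [List.map_length_splitWrtComposition, List.map_length_splitWrtComposition] at this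
    exact Composition.ext this
  · intro D hD
    rw [List.mem_toFinset, mem_splittings] at hD
    refine ⟨⟨D.map List.length, ?_, ?_⟩, Finset.mem_univ _, ?_⟩
    · intro i hi
      obtain ⟨A, hA, rfl⟩ := List.mem_map.1 hi
      rw [List.length_pos_iff]
      rintro rfl
      exact hD.2 hA
    · rw [← hD.1, List.length_flatten]
    · obtain ⟨rfl, _⟩ := hD
      exact List.splitWrtComposition_flatten _ _ rfl

end AddCommMonoid

section CommRing
variable {R : Type*} [CommRing R]

theorem prefixSum_mul_left (a : R) (f : List α → List α → R) (L : List α) :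
    prefixSum (fun A D => a * f A D) L = a * prefixSum f L := by
  induction L generalizing f with
  | nil => simp [prefixSum]
  | cons x L ih => simp only [prefixSum, ih, mul_add]

theorem splitSum_mul_left (a : R) (f : List (List α) → R) (L : List α) :
    splitSum (fun D => a * f D) L = a * splitSum f L := by
  induction L generalizing f with
  | nil => rfl
  | cons x L ih =>
    have : consHead x (fun D => a * f D) = fun D => a * consHead x f D := by
      funext D; cases D <;> simp [consHead]
    simp only [splitSum, this, ih, mul_add]

/-- The block operator: the sum over all ways of cutting a list into blocks of the product of the
weights `κ` of the blocks, times the value of `Φ` on the list of the merged blocks `σ`. -/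
def blockOp (σ : List α → β) (κ : List α → R) (Φ : List β → R) (L : List α) : R :=
  splitSum (fun D => (D.map κ).prod * Φ (D.map σ)) L

@[simp] theorem blockOp_nil (σ : List α → β) (κ : List α → R) (Φ : List β → R) :
    blockOp σ κ Φ [] = Φ [] := by simp [blockOp, splitSum]

theorem blockOp_eq_prefixSum (σ : List α → β) (κ : List α → R) (Φ : List β → R) {L : List α}
    (hL : L ≠ []) : blockOp σ κ Φ L =
      prefixSum (fun A D => κ A * blockOp σ κ (fun M => Φ (σ A :: M)) D) L := by
  rw [blockOp, splitSum_eq_prefixSum _ hL]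
  refine prefixSum_congr fun A D _ _ => ?_
  rw [blockOp, ← splitSum_mul_left]
  refine splitSum_congr fun M _ _ => ?_
  simp [mul_assoc]

theorem blockOp_congr {σ : List α → β} {σ' : List α → γ} {κ κ' : List α → R} {Φ : List β → R}
    {Φ' : List γ → R} {L : List α}
    (h : ∀ D : List (List α), D.flatten = L → [] ∉ D →
      (D.map κ).prod * Φ (D.map σ) = (D.map κ').prod * Φ' (D.map σ')) :
    blockOp σ κ Φ L = blockOp σ' κ' Φ' L := splitSum_congr h

theorem blockOp_map (τ : γ → α) (σ : List α → β) (κ : List α → R) (Φ : List β → R) (L : List γ) :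
    blockOp σ κ Φ (L.map τ) =
      blockOp (fun A => σ (A.map τ)) (fun A => κ (A.map τ)) Φ L := by
  rw [blockOp, splitSum_map, blockOp]
  simp only [List.map_map, Function.comp_def]

theorem blockOp_mul_left (σ : List α → β) (κ : List α → R) (Φ : List β → R) (a : R) (L : List α) :
    blockOp σ κ (fun M => a * Φ M) L = a * blockOp σ κ Φ L := by
  rw [blockOp, blockOp, ← splitSum_mul_left]
  exact splitSum_congr fun D _ _ => by ring

/-- Block operators compose. -/
theorem blockOp_blockOp {δ : Type*} (σ : List α → β) (κ : List α → R) (τ : List β → δ)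
    (l : List β → R) (ρ : List α → δ) (Φ : List δ → R) (L : List α)
    (h : ∀ C : List (List α), C ≠ [] → C.flatten <:+: L → [] ∉ C →
      τ (C.map σ) = ρ C.flatten) :
    blockOp σ κ (blockOp τ l Φ) L = blockOp ρ (blockOp σ κ l) Φ L := by
  induction hn : L.length using Nat.strong_induction_on generalizing L Φ with
  | _ n ih =>
    subst hn
    rcases eq_or_ne L [] with rfl | hL
    · simp
    rw [blockOp_eq_prefixSum ρ _ _ hL]
    have h1 : blockOp σ κ (blockOp τ l Φ) L = splitSum (fun D => prefixSum (fun C M =>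
        ((C.map κ).prod * l (C.map σ)) * ((M.map κ).prod *
          blockOp τ l (fun M' => Φ (τ (C.map σ) :: M')) (M.map σ))) D) L := by
      refine splitSum_congr fun D hD _ => ?_
      have hD' : D.map σ ≠ [] := by
        rintro h0
        rw [List.map_eq_nil_iff] at h0
        subst h0
        exact hL hD.symm
      rw [blockOp_eq_prefixSum _ _ _ hD', prefixSum_map, ← prefixSum_mul_left]
      refine prefixSum_congr fun C M _ hCM => ?_
      rw [← hCM]
      simp only [List.map_append, List.prod_append]
      ring
    rw [h1, splitSum_prefixSum]
    refine prefixSum_congr fun A D hA hAD => ?_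
    have hlen : D.length < L.length := by
      rw [← hAD, List.length_append]
      have := List.length_pos_iff.2 hA
      omega
    rw [← ih _ hlen (fun M => Φ (ρ A :: M)) D (fun C hC hC' hn => h C hC
      (hC'.trans (hAD ▸ (List.suffix_append A D).isInfix)) hn) rfl]
    have h2 : blockOp σ κ l A * blockOp σ κ (blockOp τ l fun M => Φ (ρ A :: M)) D =
        splitSum (fun C => ((C.map κ).prod * l (C.map σ)) *
          blockOp σ κ (blockOp τ l fun M => Φ (ρ A :: M)) D) A := by
      rw [mul_comm, show blockOp σ κ l A = splitSum (fun C => (C.map κ).prod * l (C.map σ)) A from rfl,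
        ← splitSum_mul_left]
      exact splitSum_congr fun C _ _ => mul_comm _ _
    rw [h2]
    refine splitSum_congr fun C hC hCn => ?_
    rw [splitSum_mul_left, blockOp]
    have : τ (C.map σ) = ρ A := by
      rw [← hC]
      refine h C ?_ ?_ hCn
      · rintro rfl; exact hA hC.symm
      · rw [hC, ← hAD]; exact (List.prefix_append A D).isInfix
    rw [this]

theorem map_blockOp {S : Type*} [CommRing S] (φ : R →+* S) (σ : List α → β) (κ : List α → R)
    (Φ : List β → R) (L : List α) :
    φ (blockOp σ κ Φ L) = blockOp σ (fun A => φ (κ A)) (fun M => φ (Φ M)) L := by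
  rw [blockOp, blockOp, splitSum_eq_sum_splittings, splitSum_eq_sum_splittings, map_list_sum,
    List.map_map]
  congr 2
  funext D
  simp [map_list_prod, List.map_map, Function.comp_def]

end CommRing
end Splittings

/-! ### The combinatorics of the coefficients -/

/-- The coefficients of `log (1 + x)`; the one of `x^0` is `0`, as `1 / 0 = 0`. -/
def logCoeff (l : ℕ) : ℚ := (-1) ^ (l - 1) / (l : ℚ)

/-- The coefficients of `1 - exp (-x)`, for `p ≥ 1`. -/
def expCoeff (p : ℕ) : ℚ := (-1) ^ (p - 1) / (p.factorial : ℚ)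

/-- The `q`-th power of a power series without constant term is a sum over the cuttings into `q`
blocks. -/
theorem splitSum_prod_logCoeff {α : Type*} (φ : ℕ → ℚ) (L : List α) :
    splitSum (fun D => (D.map fun A => logCoeff A.length).prod * φ D.length) L =
      ∑ q ∈ Finset.range (L.length + 1),
        φ q * PowerSeries.coeff L.length (PowerSeries.mk logCoeff ^ q) := by
  induction hn : L.length using Nat.strong_induction_on generalizing L φ with
  | _ n ih =>
    rcases eq_or_ne L [] with rfl | hL
    · subst hn
      simp [splitSum]
    have hX : (PowerSeries.X : PowerSeries ℚ) ∣ PowerSeries.mk logCoeff := by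
      rw [PowerSeries.X_dvd_iff]; simp [logCoeff]
    have hn0 : 0 < n := hn ▸ List.length_pos_iff.2 hL
    rw [splitSum_eq_prefixSum _ hL, prefixSum_eq_sum, hn]
    have h1 : ∀ k ∈ Finset.range n, splitSum (fun M =>
        ((L.take (k + 1) :: M).map fun A => logCoeff A.length).prod *
          φ (L.take (k + 1) :: M).length) (L.drop (k + 1)) =
        ∑ q ∈ Finset.range n, φ (q + 1) * (logCoeff (k + 1) *
          PowerSeries.coeff (n - (k + 1)) (PowerSeries.mk logCoeff ^ q)) := by
      intro k hk
      rw [Finset.mem_range] at hk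
      have h2 : splitSum (fun M =>
          ((L.take (k + 1) :: M).map fun A => logCoeff A.length).prod *
          φ (L.take (k + 1) :: M).length) (L.drop (k + 1)) =
          logCoeff (k + 1) * splitSum (fun M => (M.map fun A => logCoeff A.length).prod *
            φ (M.length + 1)) (L.drop (k + 1)) := by
        rw [← splitSum_mul_left]
        refine splitSum_congr fun M _ _ => ?_
        have : (L.take (k + 1)).length = k + 1 := by rw [List.length_take]; omega
        simp only [List.map_cons, List.prod_cons, this, List.length_cons, mul_assoc]
      have h3 : (L.drop (k + 1)).length = n - (k + 1) := by rw [List.length_drop, hn]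
      rw [h2, ih (n - (k + 1)) (by omega) (fun q => φ (q + 1)) (L.drop (k + 1)) h3, Finset.mul_sum]
      have hsub : Finset.range (n - (k + 1) + 1) ⊆ Finset.range n := by
        intro q; simp only [Finset.mem_range]; omega
      rw [← Finset.sum_subset hsub]
      · exact Finset.sum_congr rfl fun q _ => by ring
      · intro q _ hq
        rw [Finset.mem_range] at hq
        have h4 : PowerSeries.coeff (n - (k + 1)) (PowerSeries.mk logCoeff ^ q) = 0 :=
          PowerSeries.X_pow_dvd_iff.1 (pow_dvd_pow_of_dvd hX q) _ (by omega)
        rw [h4, mul_zero, mul_zero]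
    rw [Finset.sum_congr rfl h1, Finset.sum_comm, Finset.sum_range_succ']
    have h0 : PowerSeries.coeff n (PowerSeries.mk logCoeff ^ 0 : PowerSeries ℚ) = 0 := by
      rw [pow_zero, PowerSeries.coeff_one, if_neg hn0.ne']
    rw [h0, mul_zero, add_zero]
    refine Finset.sum_congr rfl fun q _ => ?_
    rw [← Finset.mul_sum, pow_succ', PowerSeries.coeff_mul,
      Finset.Nat.sum_antidiagonal_eq_sum_range_succ_mk, Finset.sum_range_succ']
    congr 1
    simp [logCoeff]

/-- The identity `exp (-log (1 + x)) = 1 / (1 + x)`. -/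
theorem sum_exp_neg_log (m N : ℕ) (h : m < N) :
    ∑ q ∈ Finset.range N, ((-1) ^ q / (q.factorial : ℚ)) *
      PowerSeries.coeff m (PowerSeries.mk logCoeff ^ q) = (-1) ^ m := by
  set P : PowerSeries ℚ := PowerSeries.mk logCoeff with hP
  set Y : ℕ → PowerSeries ℚ := fun N => ∑ q ∈ Finset.range N,
    PowerSeries.C ((-1) ^ q / (q.factorial : ℚ)) * P ^ q with hY
  have hcoeff : ∀ m N, PowerSeries.coeff m (Y N) = ∑ q ∈ Finset.range N,
      ((-1) ^ q / (q.factorial : ℚ)) * PowerSeries.coeff m (P ^ q) := by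
    intro m N
    simp only [hY, map_sum, PowerSeries.coeff_C_mul]
  rw [← hcoeff]
  have hd : (1 + PowerSeries.X) * PowerSeries.derivative ℚ P = 1 := by
    ext k
    rw [add_mul, one_mul, map_add, PowerSeries.coeff_derivative, PowerSeries.coeff_one]
    cases k with
    | zero => simp [hP, logCoeff]
    | succ k =>
      rw [PowerSeries.coeff_succ_X_mul, PowerSeries.coeff_derivative]
      simp only [hP, PowerSeries.coeff_mk, logCoeff]
      have h1 : ((k : ℚ) + 1 + 1) ≠ 0 := by positivity
      have h2 : ((k : ℚ) + 1) ≠ 0 := by positivity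
      push_cast
      rw [div_mul_cancel₀ _ h1, div_mul_cancel₀ _ h2]
      simp [pow_succ]
  -- The truncations `Y N` of `exp (-P)` with `P = log (1 + X)` satisfy the differential equation of
  -- `1 / (1 + X)` up to the shift of `N`.
  have hdY : ∀ N, (1 + PowerSeries.X) * PowerSeries.derivative ℚ (Y (N + 1)) = - Y N := by
    intro N
    simp only [hY, Finset.sum_range_succ', ← Finset.sum_neg_distrib]
    rw [map_add, map_sum, mul_add, Finset.mul_sum]
    have h0 : (1 + PowerSeries.X) * (PowerSeries.derivative ℚ)
        (PowerSeries.C ((-1) ^ 0 / ((Nat.factorial 0 : ℕ) : ℚ)) * P ^ 0) = 0 := by simp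
    rw [h0, add_zero]
    refine Finset.sum_congr rfl fun q _ => ?_
    rw [Derivation.leibniz, PowerSeries.derivative_C, smul_zero, add_zero, PowerSeries.derivative_pow,
      smul_eq_mul]
    have h3 : PowerSeries.C ((-1) ^ (q + 1) / ((q + 1).factorial : ℚ)) * ((q + 1 : ℕ) : PowerSeries ℚ)
        = - PowerSeries.C ((-1) ^ q / (q.factorial : ℚ)) := by
      rw [← map_natCast (PowerSeries.C (R := ℚ)), ← map_mul, ← map_neg]
      congr 1
      rw [Nat.factorial_succ]
      have h1 : ((q : ℚ) + 1) ≠ 0 := by positivity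
      have h2 : (q.factorial : ℚ) ≠ 0 := by positivity
      push_cast
      field_simp
      ring
    calc _ = (PowerSeries.C ((-1) ^ (q + 1) / ((q + 1).factorial : ℚ)) * ((q + 1 : ℕ) : PowerSeries ℚ))
          * P ^ q * ((1 + PowerSeries.X) * PowerSeries.derivative ℚ P) := by
            rw [Nat.add_sub_cancel]; ring
      _ = _ := by rw [h3, hd]; ring
  induction m generalizing N with
  | zero =>
    obtain ⟨N, rfl⟩ := Nat.exists_eq_succ_of_ne_zero h.ne'
    rw [hcoeff, Finset.sum_range_succ', Finset.sum_eq_zero]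
    · simp
    · intro q _
      have : PowerSeries.constantCoeff P = 0 := by simp [hP, logCoeff]
      simp [this]
  | succ m ih =>
    obtain ⟨N, rfl⟩ := Nat.exists_eq_succ_of_ne_zero (by omega : N ≠ 0)
    have h1 := congrArg (PowerSeries.coeff m) (hdY N)
    rw [map_neg, ih N (by omega), add_mul, one_mul, map_add, PowerSeries.coeff_derivative] at h1
    have h2 : PowerSeries.coeff m (PowerSeries.X * PowerSeries.derivative ℚ (Y (N + 1))) =
        (m : ℚ) * (-1) ^ m := by
      cases m with
      | zero => simp
      | succ k =>
        rw [PowerSeries.coeff_succ_X_mul, PowerSeries.coeff_derivative, ih (N + 1) (by omega)]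
        push_cast; ring
    rw [h2] at h1
    have h3 : ((m : ℚ) + 1) ≠ 0 := by positivity
    have : ((m : ℚ) + 1) * PowerSeries.coeff (m + 1) (Y (N + 1)) = ((m : ℚ) + 1) * (-1) ^ (m + 1) := by
      rw [pow_succ]; linarith
    exact mul_left_cancel₀ h3 this

theorem splitSum_logCoeff_exp {α : Type*} (L : List α) :
    splitSum (fun D => (D.map fun A => logCoeff A.length).prod *
      ((-1) ^ D.length / (D.length.factorial : ℚ))) L = (-1) ^ L.length := by
  rw [splitSum_prod_logCoeff (fun q => (-1) ^ q / (q.factorial : ℚ)),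
    sum_exp_neg_log _ _ (Nat.lt_succ_self _)]

theorem expCoeff_eq {p : ℕ} (hp : p ≠ 0) : expCoeff p = - ((-1) ^ p / (p.factorial : ℚ)) := by
  obtain ⟨p, rfl⟩ := Nat.exists_eq_succ_of_ne_zero hp
  simp [expCoeff, pow_succ, neg_div]

/-- The first entry of a list of reals (`0` if there is none). -/
def headVal (A : List ℝ) : ℝ := A.headD 0

open Classical in
/-- The weight `e (length)` on constant lists, zero on the others. -/
noncomputable def constWeight (e : ℕ → ℚ) (A : List ℝ) : ℚ := if ∀ x ∈ A, ∀ y ∈ A, x = y then e A.length else 0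

open Classical in
/-- The indicator function of the lists whose neighbouring entries are related by `r`. -/
noncomputable def chainWeight (r : ℝ → ℝ → Prop) (A : List ℝ) : ℚ := if A.IsChain r then 1 else 0

open Classical in
/-- `runWeight r e c x L` is the product of `e (length)` over the maximal constant runs of the
list `x, …, x, L` (with `c` entries `x`) if consecutive runs are related by `r`, and zero otherwise. -/
noncomputable def runWeight (r : ℝ → ℝ → Prop) (e : ℕ → ℚ) : ℕ → ℝ → List ℝ → ℚ
  | c, _, [] => e c
  | c, x, y :: L =>
    if y = x then runWeight r e (c + 1) x L else if r x y then e c * runWeight r e 1 y L else 0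

/-- The sum over all ways of cutting a list into constant blocks whose values form an `r`-chain. -/
noncomputable def blockWeight (r : ℝ → ℝ → Prop) (e : ℕ → ℚ) : List ℝ → ℚ :=
  blockOp headVal (constWeight e) (chainWeight r)

@[simp] theorem blockWeight_nil (r : ℝ → ℝ → Prop) (e : ℕ → ℚ) : blockWeight r e [] = 1 := by
  simp [blockWeight, chainWeight]

/-- Since `r` is irreflexive, only the cutting into maximal constant runs contributes. -/
theorem blockWeight_cons {r : ℝ → ℝ → Prop} (hr : ∀ x, ¬ r x x) (e : ℕ → ℚ) (x : ℝ) (L : List ℝ) :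
    blockWeight r e (x :: L) = runWeight r e 1 x L := by
  classical
  -- The contribution of the blocks after a first block with value `x`.
  set B : ℝ → List ℝ → ℚ := fun x D =>
    if ∀ y ∈ D.head?, r x y then blockWeight r e D else 0 with hB
  have h0 : ∀ x D, blockOp headVal (constWeight e) (fun M => chainWeight r (x :: M)) D = B x D := by
    intro x D
    cases D with
    | nil => simp [hB, chainWeight]
    | cons y D =>
      simp only [hB, List.head?_cons, Option.mem_some_iff, forall_eq']
      split_ifs with h
      · refine blockOp_congr fun E hE hn => ?_
        cases E with
        | nil => simp at hE
        | cons A E =>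
          cases A with
          | nil => simp at hn
          | cons a A =>
            simp only [List.flatten_cons, List.cons_append, List.cons.injEq] at hE
            simp [chainWeight, headVal, List.isChain_cons_cons, hE.1, h]
      · rw [blockOp, ← splitSum_zero (y :: D)]
        refine splitSum_congr fun E hE hn => ?_
        cases E with
        | nil => simp at hE
        | cons A E =>
          cases A with
          | nil => simp at hn
          | cons a A =>
            simp only [List.flatten_cons, List.cons_append, List.cons.injEq] at hE
            simp [chainWeight, headVal, List.isChain_cons_cons, hE.1, h]
  have hcons : ∀ x L, blockWeight r e (x :: L) = e 1 * B x L + prefixSum (fun A D =>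
      (if ∀ y ∈ A, y = x then e (1 + A.length) else 0) * B x D) L := by
    intro x L
    rw [blockWeight, blockOp_eq_prefixSum _ _ _ (by simp)]
    simp only [prefixSum, h0]
    congr 1
    · simp [constWeight, headVal]
    · refine prefixSum_congr fun A D _ _ => ?_
      have h1 : (∀ a ∈ x :: A, ∀ b ∈ x :: A, a = b) ↔ ∀ y ∈ A, y = x := by
        constructor
        · intro h y hy
          exact h y (by simp [hy]) x (by simp)
        · intro h a ha b hb
          have : ∀ a ∈ x :: A, a = x := by simpa using h
          rw [this a ha, this b hb]
      simp only [constWeight, h1, headVal, List.headD_cons, List.length_cons, add_comm 1]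
  have key : ∀ L : List ℝ, ∀ c x, e c * B x L + prefixSum (fun A D =>
      (if ∀ y ∈ A, y = x then e (c + A.length) else 0) * B x D) L = runWeight r e c x L := by
    intro L
    induction L with
    | nil => intro c x; simp [runWeight, prefixSum, hB]
    | cons y L ih =>
      intro c x
      simp only [prefixSum, runWeight]
      by_cases hyx : y = x
      · subst hyx
        rw [if_pos rfl, ← ih (c + 1) y]
        have : B y (y :: L) = 0 := by simp [hB, hr]
        rw [this, mul_zero, zero_add]
        congr 1
        · simp
        · refine prefixSum_congr fun A D _ _ => ?_
          simp [add_assoc, add_comm 1]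
      · rw [if_neg hyx]
        have : prefixSum (fun A D => (if ∀ z ∈ y :: A, z = x then e (c + (y :: A).length) else 0) *
            B x D) L = 0 := by
          refine Eq.trans (prefixSum_congr fun A D _ _ => ?_) (prefixSum_zero L)
          rw [if_neg, zero_mul]
          intro h
          exact hyx (h y (by simp))
        rw [this]
        have h2 : (if ∀ z ∈ [y], z = x then e (c + [y].length) else 0) * B x L = 0 := by
          rw [if_neg (by simpa using hyx), zero_mul]
        rw [h2, add_zero, add_zero, ← ih 1 y, ← hcons]
        simp only [hB, List.head?_cons, Option.mem_some_iff, forall_eq']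
        split_ifs <;> simp
  rw [hcons, key]

theorem sum_factorial_cancel {c : ℕ} (hc : 0 < c) :
    ∑ i ∈ Finset.range (c + 1), (1 / (i.factorial : ℚ)) *
      ((-1) ^ (c - i) / ((c - i).factorial : ℚ)) = 0 := by
  have h := add_pow (1 : ℚ) (-1) c
  rw [add_neg_cancel, zero_pow hc.ne'] at h
  have h2 : (c.factorial : ℚ) ≠ 0 := by positivity
  apply mul_left_cancel₀ h2
  rw [mul_zero, h, Finset.mul_sum]
  refine Finset.sum_congr rfl fun i hi => ?_
  rw [Nat.cast_choose ℚ (Nat.lt_succ_iff.1 (Finset.mem_range.1 hi))]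
  have h3 : (i.factorial : ℚ) ≠ 0 := by positivity
  have h4 : ((c - i).factorial : ℚ) ≠ 0 := by positivity
  field_simp
  simp

/-- The weights of decreasing runs (as for a product of exponentials) and of increasing runs (as for
its inverse) are convolution inverses of each other. -/
theorem prefixSum_blockWeight_mul (x : ℝ) (L : List ℝ) :
    prefixSum (fun A D => blockWeight (· > ·) (fun p => 1 / (p.factorial : ℚ)) A *
      blockWeight (· < ·) (fun p => (-1) ^ p / (p.factorial : ℚ)) D) (x :: L) =
      - blockWeight (· < ·) (fun p => (-1) ^ p / (p.factorial : ℚ)) (x :: L) := by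
  set d : ℕ → ℝ → List ℝ → ℚ := runWeight (· > ·) (fun p => 1 / (p.factorial : ℚ)) with hd
  set u : ℕ → ℝ → List ℝ → ℚ := runWeight (· < ·) (fun p => (-1) ^ p / (p.factorial : ℚ)) with hu
  set W : List ℝ → ℚ := blockWeight (· < ·) (fun p => (-1) ^ p / (p.factorial : ℚ)) with hW
  have hWc : ∀ x L, W (x :: L) = u 1 x L := fun x L => blockWeight_cons lt_irrefl _ _ _
  have hW0 : W [] = 1 := blockWeight_nil _ _
  -- For a list starting with `c` copies of `x`, followed by `L`: the first sum collects the prefixes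
  -- that contain `i < c` of the copies, the other terms those that contain all of them.
  have key : ∀ L : List ℝ, ∀ c x, 0 < c →
      ∑ i ∈ Finset.range c, (1 / (i.factorial : ℚ)) * u (c - i) x L +
        (1 / (c.factorial : ℚ) * W L + prefixSum (fun A D => d c x A * W D) L) = 0 := by
    intro L
    induction L with
    | nil =>
      intro c x hc
      rw [← sum_factorial_cancel hc, Finset.sum_range_succ, hW0]
      simp [hu, runWeight, prefixSum]
    | cons y L ih =>
      intro c x hc
      simp only [prefixSum]
      rcases lt_trichotomy y x with h | h | h
      -- A descent: no increasing chain continues from `x` to `y`, so all copies are in the prefix.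
      · have h1 : ∀ i, u (c - i) x (y :: L) = 0 := by
          intro i; simp [hu, runWeight, h.ne, h.not_gt]
        have h2 : ∀ A, d c x (y :: A) = 1 / (c.factorial : ℚ) * d 1 y A := by
          intro A; simp [hd, runWeight, h.ne, h]
        have h3 := ih 1 y one_pos
        have h4 : d 1 y [] = 1 := by simp [hd, runWeight]
        simp only [h1, h2, mul_zero, Finset.sum_const_zero, zero_add, hWc, h4, mul_one, mul_assoc,
          prefixSum_mul_left]
        simp at h3
        linear_combination (1 / (c.factorial : ℚ)) * h3
      · subst h
        -- One more copy of the same value.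
        have h1 : ∀ i ∈ Finset.range c, 1 / (i.factorial : ℚ) * u (c - i) y (y :: L) =
            1 / (i.factorial : ℚ) * u (c + 1 - i) y L := by
          intro i hi
          rw [Finset.mem_range] at hi
          have : c + 1 - i = c - i + 1 := by omega
          simp [hu, runWeight, this]
        have h2 : ∀ A, d c y (y :: A) = d (c + 1) y A := by intro A; simp [hd, runWeight]
        have h3 := ih (c + 1) y (by omega)
        rw [Finset.sum_range_succ, Nat.add_sub_cancel_left] at h3
        rw [Finset.sum_congr rfl h1, hWc]
        simp only [h2]
        have h4 : d (c + 1) y [] = 1 / ((c + 1).factorial : ℚ) := by simp [hd, runWeight]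
        rw [h4]
        linear_combination h3
      -- An ascent: the prefix ends among the copies of `x`, and the binomial sum vanishes.
      · have h1 : ∀ i ∈ Finset.range c, 1 / (i.factorial : ℚ) * u (c - i) x (y :: L) =
            u 1 y L * (1 / (i.factorial : ℚ) * ((-1) ^ (c - i) / ((c - i).factorial : ℚ))) := by
          intro i _
          simp only [hu, runWeight, h.ne', h, if_true, if_false]
          ring
        have h2 : ∀ A, d c x (y :: A) = 0 := by
          intro A; simp [hd, runWeight, h.ne', h.not_gt]
        have h3 := sum_factorial_cancel hc
        rw [Finset.sum_range_succ] at h3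
        rw [Finset.sum_congr rfl h1, hWc]
        simp only [h2, zero_mul, prefixSum_zero, ← Finset.mul_sum]
        simp at h3 ⊢
        linear_combination (u 1 y L) * h3
  have h := key L 1 x one_pos
  have hM : ∀ A, blockWeight (· > ·) (fun p => 1 / (p.factorial : ℚ)) (x :: A) = d 1 x A :=
    fun A => blockWeight_cons (r := (· > ·)) (fun x => lt_irrefl x) _ x A
  have h4 : d 1 x [] = 1 := by simp [hd, runWeight]
  simp only [prefixSum, hM, h4]
  rw [hWc]
  simp at h
  linear_combination h

/-- The sum over all cuttings of the weights of decreasing runs with alternating signs. -/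
theorem splitSum_blockWeight_neg_one (L : List ℝ) :
    splitSum (fun D => (D.map (blockWeight (· > ·) fun p => 1 / (p.factorial : ℚ))).prod *
      (-1) ^ D.length) L = blockWeight (· < ·) (fun p => (-1) ^ p / (p.factorial : ℚ)) L := by
  induction hn : L.length using Nat.strong_induction_on generalizing L with
  | _ n ih =>
    subst hn
    cases L with
    | nil => simp [splitSum]
    | cons x L =>
      rw [← neg_eq_iff_eq_neg.2 (prefixSum_blockWeight_mul x L), splitSum_eq_prefixSum _ (by simp),
        ← neg_one_mul (prefixSum _ _), ← prefixSum_mul_left]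
      refine prefixSum_congr fun A D hA hAD => ?_
      have hlen : D.length < (x :: L).length := by
        rw [← hAD, List.length_append]
        have := List.length_pos_iff.2 hA
        omega
      rw [← ih _ hlen D rfl, ← splitSum_mul_left, ← splitSum_mul_left]
      refine splitSum_congr fun M _ _ => ?_
      simp only [List.map_cons, List.prod_cons, List.length_cons]
      ring

/-- The coefficients of the transformation formula as a function of a list of arguments. -/
noncomputable def listCoeff : List ℝ → ℚ :=
  blockOp headVal (blockWeight (· > ·) fun p => 1 / (p.factorial : ℚ)) fun M => logCoeff M.length

theorem headVal_map_headVal {C : List (List ℝ)} (hC : C ≠ []) (hn : [] ∉ C) :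
    headVal (C.map headVal) = headVal C.flatten := by
  cases C with
  | nil => exact absurd rfl hC
  | cons A C =>
    cases A with
    | nil => simp at hn
    | cons a A => simp [headVal]

/-- The identity behind the transformation formula: both sides are the signed weights of
the increasing runs. -/
theorem blockOp_listCoeff {L : List ℝ} (hL : L ≠ []) :
    blockOp headVal (constWeight expCoeff) (fun M => (-1) ^ (M.length - 1) * chainWeight (· < ·) M) L =
      blockOp headVal listCoeff (fun M => expCoeff M.length) L := by
  have h1 : blockOp headVal (constWeight expCoeff)
      (fun M => (-1) ^ (M.length - 1) * chainWeight (· < ·) M) L =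
      - blockWeight (· < ·) (fun p => (-1) ^ p / (p.factorial : ℚ)) L := by
    rw [← neg_one_mul (blockWeight _ _ _), blockWeight, ← blockOp_mul_left]
    refine blockOp_congr fun D hD hn => ?_
    have hD0 : D.length ≠ 0 := by
      intro h
      rw [List.length_eq_zero_iff] at h
      subst h
      exact hL hD.symm
    have : ∀ D : List (List ℝ), [] ∉ D → (D.map (constWeight expCoeff)).prod = (-1) ^ D.length *
        (D.map (constWeight fun p => (-1) ^ p / (p.factorial : ℚ))).prod := by
      intro D hn
      induction D with
      | nil => simp
      | cons A D ih =>
        simp only [List.mem_cons, not_or] at hn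
        have hA : A.length ≠ 0 := fun h => hn.1 (List.length_eq_zero_iff.1 h).symm
        rw [List.map_cons, List.prod_cons, List.map_cons, List.prod_cons, ih hn.2, List.length_cons,
          constWeight, constWeight, expCoeff_eq hA]
        split_ifs <;> ring
    rw [this D hn, List.length_map]
    obtain ⟨m, hm⟩ := Nat.exists_eq_succ_of_ne_zero hD0
    rw [hm, Nat.succ_sub_one, Nat.succ_eq_add_one]
    have h2 : ((-1 : ℚ) ^ (m + 1)) * (-1) ^ m = -1 := by
      rw [← pow_add]; exact Odd.neg_one_pow ⟨m, by ring⟩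
    linear_combination ((D.map (constWeight fun p => (-1) ^ p / (p.factorial : ℚ))).prod *
      chainWeight (· < ·) (D.map headVal)) * h2
  rw [h1, ← splitSum_blockWeight_neg_one, listCoeff, ← blockOp_blockOp headVal _ headVal _ headVal _ L
    (fun C hC _ hn => headVal_map_headVal hC hn), ← neg_one_mul (splitSum _ _), ← splitSum_mul_left]
  refine splitSum_congr fun D hD _ => ?_
  have hD0 : D ≠ [] := by
    rintro rfl
    exact hL hD.symm
  have h3 : blockOp headVal (fun M : List ℝ => logCoeff M.length) (fun M => expCoeff M.length)
      (D.map headVal) = - (-1) ^ (D.map headVal).length := by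
    rw [← splitSum_logCoeff_exp (D.map headVal), ← neg_one_mul (splitSum _ _), blockOp, ← splitSum_mul_left]
    refine splitSum_congr fun E hE _ => ?_
    have hE0 : E.length ≠ 0 := by
      intro h
      rw [List.length_eq_zero_iff] at h
      subst h
      exact hD0 (List.map_eq_nil_iff.1 hE.symm)
    rw [List.length_map, expCoeff_eq hE0]
    ring
  rw [h3, List.length_map]
  ring

/-! ### Sums over compositions as sums over cuttings of lists -/

theorem splitWrtComposition_ofFn {α : Type*} {n : ℕ} (z : Fin n → α) (c : Composition n) :
    (List.ofFn z).splitWrtComposition c =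
      List.ofFn fun k => List.ofFn fun j => z (c.embedding k j) := by
  refine List.ext_getElem (by simp [List.length_splitWrtComposition]) fun i h1 h2 => ?_
  rw [List.length_ofFn] at h2
  rw [List.getElem_splitWrtComposition, List.getElem_ofFn]
  have h3 : c.sizeUpTo (i + 1) = c.sizeUpTo i + c.blocksFun ⟨i, h2⟩ := c.sizeUpTo_succ h2
  have h4 : c.sizeUpTo (i + 1) ≤ n := c.sizeUpTo_le _
  refine List.ext_getElem ?_ fun j h5 h6 => ?_
  · simp only [List.length_drop, List.length_take, List.length_ofFn]
    omega
  · simp only [List.getElem_drop, List.getElem_take, List.getElem_ofFn]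
    congr 1

theorem sum_composition_ofFn {α R : Type*} [AddCommMonoid R] (f : List (List α) → R) {n : ℕ}
    (z : Fin n → α) :
    ∑ c : Composition n, f (List.ofFn fun k => List.ofFn fun j => z (c.embedding k j)) =
      splitSum f (List.ofFn z) := by
  rw [← sum_composition_splitWrt f (List.ofFn z) (List.length_ofFn)]
  simp only [splitWrtComposition_ofFn]

theorem card_index_eq {n : ℕ} (c : Composition n) (i : Fin c.length) :
    (Finset.univ.filter fun a => c.index a = i).card = c.blocksFun i := by
  have : (Finset.univ.filter fun a => c.index a = i) =
      Finset.univ.map (c.embedding i).toEmbedding := by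
    ext a
    simp only [Finset.mem_filter, Finset.mem_univ, true_and, Finset.mem_map]
    rw [eq_comm, ← c.mem_range_embedding_iff']
    simp
  rw [this, Finset.card_map, Finset.card_univ, Fintype.card_fin]

theorem monotone_index {n : ℕ} (c : Composition n) : Monotone c.index := by
  intro a b hab
  by_contra h
  rw [not_le] at h
  have h1 := c.lt_sizeUpTo_index_succ b
  have h2 := c.sizeUpTo_index_le a
  have h3 : c.sizeUpTo (c.index b).succ ≤ c.sizeUpTo (c.index a) :=
    c.monotone_sizeUpTo (by simpa using h)
  have : (a : ℕ) ≤ b := hab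
  omega

theorem surjective_index {n : ℕ} (c : Composition n) : Function.Surjective c.index := fun i =>
  ⟨c.embedding i ⟨0, c.one_le_blocksFun i⟩, c.index_embedding _ _⟩

theorem composition_ext_index {n : ℕ} {c c' : Composition n}
    (h : ∀ a, (c.index a : ℕ) = c'.index a) : c = c' := by
  have hlen : ∀ c c' : Composition n, (∀ a, (c.index a : ℕ) = c'.index a) → c.length ≤ c'.length := by
    intro c c' h
    by_contra hlt
    rw [not_le] at hlt
    obtain ⟨a, ha⟩ := surjective_index c ⟨c'.length, hlt⟩
    have := h a
    rw [ha] at this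
    have h2 := (c'.index a).2
    simp at this
    omega
  have hl : c.length = c'.length := le_antisymm (hlen c c' h) (hlen c' c fun a => (h a).symm)
  refine Composition.ext (List.ext_getElem hl fun i h1 h2 => ?_)
  have e1 := card_index_eq c ⟨i, h1⟩
  have e2 := card_index_eq c' ⟨i, h2⟩
  change c.blocksFun ⟨i, h1⟩ = c'.blocksFun ⟨i, h2⟩
  rw [← e1, ← e2]
  congr 1
  ext a
  simp [Fin.ext_iff, h a]

/-- Monotone surjections between finite ordinals come from compositions. -/
theorem exists_composition_index {n m : ℕ} (ψ : Fin n → Fin m) (hs : Function.Surjective ψ)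
    (hm : Monotone ψ) : ∃ c : Composition n, c.length = m ∧ ∀ a, (c.index a : ℕ) = ψ a := by
  classical
  have hpos : ∀ i, 0 < (Finset.univ.filter fun a => ψ a = i).card := fun i => by
    obtain ⟨a, ha⟩ := hs i
    exact Finset.card_pos.2 ⟨a, by simp [ha]⟩
  let c : Composition n := ⟨List.ofFn fun i => (Finset.univ.filter fun a => ψ a = i).card, by
      intro i hi
      rw [List.mem_ofFn'] at hi
      obtain ⟨i, rfl⟩ := hi
      exact hpos i, by
      rw [List.sum_ofFn, ← Finset.card_eq_sum_card_fiberwise (fun a _ => Finset.mem_univ (ψ a)),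
        Finset.card_univ, Fintype.card_fin]⟩
  have hcl : c.length = m := by simp [c, Composition.length]
  have hsize : ∀ i ≤ m, c.sizeUpTo i = (Finset.univ.filter fun a => (ψ a : ℕ) < i).card := by
    intro i hi
    induction i with
    | zero => simp
    | succ i ih =>
      rw [c.sizeUpTo_succ (by omega), ih (by omega)]
      have h1 : c.blocks[i]'(by rw [Composition.blocks_length]; omega) =
          (Finset.univ.filter fun a => ψ a = ⟨i, by omega⟩).card := by
        simp [c]
      rw [h1, ← Finset.card_union_of_disjoint]
      · congr 1
        ext a
        simp [Fin.ext_iff]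
        omega
      · rw [Finset.disjoint_filter]
        rintro a _ h2 h3
        rw [h3] at h2
        simp at h2
  have hlow : ∀ a : Fin n, ∀ i ≤ m, (a : ℕ) < c.sizeUpTo i ↔ (ψ a : ℕ) < i := by
    intro a i hi
    rw [hsize i hi]
    constructor
    · intro h
      by_contra h2
      rw [not_lt] at h2
      have : (Finset.univ.filter fun b => (ψ b : ℕ) < i) ⊆ Finset.univ.filter fun b => b < a := by
        intro b
        simp only [Finset.mem_filter, Finset.mem_univ, true_and]
        intro hb
        by_contra h3
        have : (ψ a : ℕ) ≤ ψ b := hm (not_lt.1 h3)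
        omega
      have := Finset.card_le_card this
      rw [show (Finset.univ.filter fun b => b < a) = Finset.Iio a by ext; simp, Fin.card_Iio] at this
      omega
    · intro h
      have : (Finset.univ.filter fun b => b ≤ a) ⊆ Finset.univ.filter fun b => (ψ b : ℕ) < i := by
        intro b
        simp only [Finset.mem_filter, Finset.mem_univ, true_and]
        intro hb
        have : (ψ b : ℕ) ≤ ψ a := hm hb
        omega
      have := Finset.card_le_card this
      rw [show (Finset.univ.filter fun b => b ≤ a) = Finset.Iic a by ext; simp, Fin.card_Iic] at this
      omega
  refine ⟨c, hcl, fun a => ?_⟩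
  have h1 := c.lt_sizeUpTo_index_succ a
  have h2 := c.sizeUpTo_index_le a
  have h3 := (c.index a).2
  have h4 := (hlow a (c.index a).succ (by simp; omega)).1 h1
  have h5 := (hlow a (c.index a) (by omega)).not.1 (by omega)
  simp at h4
  omega

open Classical in
theorem sum_monotone_surjective {R : Type*} [AddCommMonoid R] {n : ℕ} (hn : 0 < n)
    (f : (m : ℕ) → (Fin n → Fin m) → R) :
    ∑ m ∈ Finset.Icc 1 n, ∑ ψ : Fin n → Fin m,
      (if Function.Surjective ψ ∧ Monotone ψ then f m ψ else 0) =
      ∑ c : Composition n, f c.length c.index := by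
  simp_rw [← Finset.sum_filter]
  rw [Finset.sum_sigma']
  symm
  refine Finset.sum_bij (fun c _ => ⟨c.length, c.index⟩) ?_ ?_ ?_ (fun _ _ => rfl)
  · intro c _
    simp only [Finset.mem_sigma, Finset.mem_Icc, Finset.mem_filter, Finset.mem_univ, true_and]
    exact ⟨⟨c.length_pos_of_pos hn, c.length_le⟩, surjective_index c, monotone_index c⟩
  · intro c _ c' _ h
    apply composition_ext_index
    intro a
    have h2 : ∀ s t : (Σ m : ℕ, Fin n → Fin m), s = t → (s.2 a : ℕ) = t.2 a := by
      rintro s t rfl; rfl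
    exact h2 _ _ h
  · rintro ⟨m, ψ⟩ h
    simp only [Finset.mem_sigma, Finset.mem_filter] at h
    obtain ⟨c, rfl, hc⟩ := exists_composition_index ψ h.2.2.1 h.2.2.2
    refine ⟨c, Finset.mem_univ _, ?_⟩
    congr 1
    funext a
    exact Fin.ext (hc a)

theorem index_eq_index_iff {n : ℕ} (c : Composition n) (P : Fin n → Fin n → Prop) :
    (∀ a b, c.index a = c.index b → P a b) ↔
      ∀ k, ∀ i j, P (c.embedding k i) (c.embedding k j) := by
  constructor
  · intro h k i j
    exact h _ _ (by rw [c.index_embedding, c.index_embedding])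
  · intro h a b hab
    obtain ⟨i, hi⟩ := c.mem_range_embedding a
    obtain ⟨j, hj⟩ : b ∈ Set.range (c.embedding (c.index a)) := by
      rw [hab]; exact c.mem_range_embedding b
    have := h (c.index a) i j
    rwa [hi, hj] at this

/-- Monotone surjections are compositions, so the sum over `ψ` and `ξ` is an iterated sum over
cuttings into blocks. -/
theorem coeff_eq_listCoeff {p : ℕ} (hp : 0 < p) (θ : Fin p → ℝ) :
    coeff θ = listCoeff (List.ofFn θ) := by
  classical
  set g : (m : ℕ) → (Fin p → Fin m) → (l : ℕ) → (Fin m → Fin l) → ℚ := fun m ψ l ξ =>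
    if (∀ a b, ψ a < ψ b → ξ (ψ a) = ξ (ψ b) → θ b < θ a) then logCoeff l else 0 with hg
  set w : (m : ℕ) → (Fin p → Fin m) → ℚ := fun m ψ =>
    if (∀ a b, ψ a = ψ b → θ a = θ b) then
      ∏ i : Fin m, (1 : ℚ) / ((Finset.univ.filter fun a => ψ a = i).card.factorial : ℚ) else 0 with hw
  have h1 : coeff θ = ∑ m ∈ Finset.Icc 1 p, ∑ ψ : Fin p → Fin m,
      if Function.Surjective ψ ∧ Monotone ψ then w m ψ * ∑ l ∈ Finset.Icc 1 m, ∑ ξ : Fin m → Fin l,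
        if Function.Surjective ξ ∧ Monotone ξ then g m ψ l ξ else 0 else 0 := by
    rw [coeff]
    refine Finset.sum_congr rfl fun m _ => ?_
    rw [Finset.sum_comm]
    refine Finset.sum_congr rfl fun ψ _ => ?_
    rw [Finset.mul_sum]
    simp_rw [Finset.mul_sum]
    split_ifs with h
    · refine Finset.sum_congr rfl fun l _ => Finset.sum_congr rfl fun ξ _ => ?_
      simp only [hg, hw, logCoeff]
      by_cases c1 : Function.Surjective ξ ∧ Monotone ξ <;>
      by_cases c2 : (∀ a b, ψ a = ψ b → θ a = θ b) <;>
      by_cases c3 : (∀ a b, ψ a < ψ b → ξ (ψ a) = ξ (ψ b) → θ b < θ a)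
      · rw [if_pos ⟨h.1, c1.1, h.2, c1.2, c2, c3⟩, if_pos c1, if_pos c2, if_pos c3, mul_comm]
      all_goals
        rw [if_neg (by tauto)]
        simp [c1, c2, c3]
    · refine Finset.sum_eq_zero fun l _ => Finset.sum_eq_zero fun ξ _ => ?_
      rw [if_neg (by tauto)]
  rw [h1, sum_monotone_surjective hp fun m ψ => w m ψ * ∑ l ∈ Finset.Icc 1 m, ∑ ξ : Fin m → Fin l,
        if Function.Surjective ξ ∧ Monotone ξ then g m ψ l ξ else 0, listCoeff,
    blockWeight, ← blockOp_blockOp headVal _ headVal _ headVal _ _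
      (fun C hC _ hn => headVal_map_headVal hC hn), blockOp, ← sum_composition_ofFn]
  refine Finset.sum_congr rfl fun c _ => ?_
  have hcw : ((List.ofFn fun k => List.ofFn fun j => θ (c.embedding k j)).map
      (constWeight fun p => 1 / (p.factorial : ℚ))).prod = w c.length c.index := by
    rw [List.map_ofFn, List.prod_ofFn]
    simp only [hw, Function.comp_apply, constWeight, List.length_ofFn, card_index_eq]
    simp only [index_eq_index_iff c fun a b => θ a = θ b]
    have hiff : ∀ k, (∀ x ∈ List.ofFn fun j => θ (c.embedding k j),
        ∀ y ∈ List.ofFn fun j => θ (c.embedding k j), x = y) ↔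
        ∀ i j, θ (c.embedding k i) = θ (c.embedding k j) := by
      intro k; simp [List.mem_ofFn']
    simp only [hiff]
    split_ifs with h
    · exact Finset.prod_congr rfl fun k _ => if_pos (h k)
    · push Not at h
      obtain ⟨k, hk⟩ := h
      refine Finset.prod_eq_zero (Finset.mem_univ k) (if_neg ?_)
      push Not
      exact hk
  rw [hcw]
  by_cases hc : ∀ a b, c.index a = c.index b → θ a = θ b
  swap
  · have : w c.length c.index = 0 := if_neg hc
    rw [this, zero_mul, zero_mul]
  congr 1
  set h : Fin c.length → ℝ := fun k => θ (c.embedding k ⟨0, c.one_le_blocksFun k⟩) with hh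
  have h2 : (headVal ∘ fun k => List.ofFn fun j => θ (c.embedding k j)) = h := by
    funext k
    have : ∀ (q : ℕ) (hq : 0 < q) (f : Fin q → ℝ), headVal (List.ofFn f) = f ⟨0, hq⟩ := by
      intro q hq f
      cases q with
      | zero => omega
      | succ q => simp [headVal, List.ofFn_succ]
    exact this _ _ _
  have hθ : ∀ a, θ a = h (c.index a) := fun a => hc _ _ (by rw [c.index_embedding])
  rw [List.map_ofFn, h2, sum_monotone_surjective (c.length_pos_of_pos hp), blockOp,
    ← sum_composition_ofFn]
  refine Finset.sum_congr rfl fun d _ => ?_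
  have h3 : (∀ a b, c.index a < c.index b → d.index (c.index a) = d.index (c.index b) → θ b < θ a) ↔
      ∀ k, (List.ofFn fun j => h (d.embedding k j)).IsChain (· > ·) := by
    have h4 : (∀ a b, c.index a < c.index b → d.index (c.index a) = d.index (c.index b) →
        θ b < θ a) ↔ ∀ i j, d.index i = d.index j → i < j → h j < h i := by
      simp only [hθ]
      constructor
      · intro H i j hij hlt
        obtain ⟨a, rfl⟩ := surjective_index c i
        obtain ⟨b, rfl⟩ := surjective_index c j
        exact H a b hlt hij
      · intro H a b hlt hij
        exact H _ _ hij hlt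
    rw [h4, index_eq_index_iff d fun i j => i < j → h j < h i]
    refine forall_congr' fun k => ?_
    rw [List.isChain_iff_pairwise, List.pairwise_ofFn]
    simp
  simp only [hg, h3]
  rw [List.map_ofFn, List.prod_ofFn, List.length_map, List.length_ofFn]
  simp only [Function.comp_apply, chainWeight]
  split_ifs with h5
  · rw [Finset.prod_eq_one fun k _ => if_pos (h5 k), one_mul]
  · push Not at h5
    obtain ⟨k, hk⟩ := h5
    rw [Finset.prod_eq_zero (Finset.mem_univ k) (if_neg hk), zero_mul]

/-! ### The transformation formula in terms of lists -/

/-- The sum of the base points and the sum of the variables in a block. -/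
def blockTotal (A : List (ℂ × ℂ)) : ℂ × ℂ := ((A.map Prod.fst).sum, (A.map Prod.snd).sum)

open Classical in
/-- The factor that a block of pairs (base point, variable) contributes to the transformation
formula. -/
noncomputable def blockCoeff (A : List (ℂ × ℂ)) : ℂ :=
  if ∀ x ∈ A, ∀ y ∈ A, y.1 / x.1 ∈ posRay then
    ((listCoeff (A.map fun q => Complex.arg (q.2 / q.1)) : ℚ) : ℂ) else 0

theorem transformSum_eq_blockOp (G : (m : ℕ) → (Fin m → ℂ) → (Fin m → ℂ) → ℂ)
    (Γ : List (ℂ × ℂ) → ℂ) (hG : ∀ m u x, G m u x = Γ (List.ofFn fun i => (u i, x i)))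
    (n : ℕ) (w z : Fin n → ℂ) :
    transformSum G n w z = blockOp blockTotal blockCoeff Γ (List.ofFn fun i => (w i, z i)) := by
  classical
  rw [transformSum, blockOp, ← sum_composition_ofFn]
  refine Finset.sum_congr rfl fun c _ => ?_
  rw [List.map_ofFn, List.map_ofFn, List.prod_ofFn]
  have h1 : G c.length (blockSum c w) (blockSum c z) = Γ (List.ofFn (blockTotal ∘ fun k =>
      List.ofFn fun j => (w (c.embedding k j), z (c.embedding k j)))) := by
    rw [hG]
    congr 2
    funext k
    simp [blockTotal, blockSum, List.map_ofFn, List.sum_ofFn, Function.comp_def]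
  rw [← h1]
  have h2 : ∀ k, blockCoeff (List.ofFn fun j => (w (c.embedding k j), z (c.embedding k j))) =
      if ∀ i j, w (c.embedding k j) / w (c.embedding k i) ∈ posRay then
        ((coeff (blockArg c w z k) : ℚ) : ℂ) else 0 := by
    intro k
    rw [blockCoeff, coeff_eq_listCoeff (c.one_le_blocksFun k), List.map_ofFn]
    refine if_congr ?_ rfl rfl
    simp [List.mem_ofFn']
  simp only [Function.comp_apply, h2]
  simp only [Aligned, index_eq_index_iff c fun a b => w b / w a ∈ posRay]
  split_ifs with h
  · rw [mul_comm]
    congr 1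
    exact Finset.prod_congr rfl fun k _ => (if_pos (h k)).symm
  · push Not at h
    obtain ⟨k, i, j, hk⟩ := h
    rw [Finset.prod_eq_zero (Finset.mem_univ k), zero_mul]
    exact if_neg fun h => hk (h i j)

/-! ### Dependence of the integrals on the directions -/

theorem admissibleList_iff {L : List (ℂ × ℂ)} : AdmissibleList L ↔
    (∀ x ∈ L, 0 < (x.2 * x.1).re) ∧ L.IsChain fun x y => OffRay x.1 y.1 := by
  have key : ∀ (L : List (ℂ × ℂ)) (x : ℂ × ℂ), Admissible x.1 L ↔
      (∀ y ∈ L, 0 < (y.2 * y.1).re) ∧ (x :: L).IsChain fun x y => OffRay x.1 y.1 := by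
    intro L
    induction L with
    | nil => intro x; simp [Admissible]
    | cons y L ih =>
      intro x
      rw [Admissible, ih y, List.isChain_cons_cons]
      simp only [List.mem_cons, forall_eq_or_imp]
      tauto
  cases L with
  | nil => simp [AdmissibleList]
  | cons x L =>
    rw [AdmissibleList, key L x]
    simp only [List.mem_cons, forall_eq_or_imp]
    tauto

/-- The open sector `|arg ζ| < π / 4`. -/
def Cone (ζ : ℂ) : Prop := |ζ.im| < ζ.re

theorem Cone.re_mul_dir_pos {ζ : ℂ} (h : Cone ζ) {α : ℝ} (hα : |α| ≤ Real.pi / 4) :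
    0 < (ζ * dir α).re := by
  rw [dir_eq]
  have hα' := abs_le.1 hα
  have hpi := Real.pi_pos
  have h1 : |Real.sin α| ≤ Real.cos α := by
    have h2 : |Real.sin α| = Real.sin |α| := by
      rcases abs_cases α with ⟨h, h'⟩ | ⟨h, h'⟩
      · rw [h, abs_of_nonneg (Real.sin_nonneg_of_nonneg_of_le_pi h' (by linarith))]
      · rw [h, Real.sin_neg, abs_of_nonpos (Real.sin_nonpos_of_nonpos_of_neg_pi_le h'.le (by linarith))]
    have h3 : Real.cos α = Real.cos |α| := (Real.cos_abs α).symm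
    rw [h2, h3]
    calc Real.sin |α| ≤ Real.sin (Real.pi / 4) :=
          Real.sin_le_sin_of_le_of_le_pi_div_two (by linarith [abs_nonneg α]) (by linarith) hα
      _ = Real.cos (Real.pi / 4) := by rw [Real.sin_pi_div_four, Real.cos_pi_div_four]
      _ ≤ Real.cos |α| := Real.cos_le_cos_of_nonneg_of_le_pi (abs_nonneg α) (by linarith) hα
  have h4 : 0 < Real.cos α := Real.cos_pos_of_mem_Ioo ⟨by linarith, by linarith⟩
  unfold Cone at h
  have h5 : ζ.im * Real.sin α ≤ |ζ.im| * Real.cos α :=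
    (le_abs_self _).trans (by rw [abs_mul]; gcongr)
  have h6 : (ζ * (Real.cos α + Real.sin α * Complex.I)).re =
      ζ.re * Real.cos α - ζ.im * Real.sin α := by
    simp [Complex.cos_ofReal_re, Complex.sin_ofReal_re, Complex.cos_ofReal_im, Complex.sin_ofReal_im]
  rw [h6]
  nlinarith

theorem Cone.ne_zero {ζ : ℂ} (h : Cone ζ) : ζ ≠ 0 := by
  rintro rfl; simp [Cone] at h

theorem Cone.add {ζ ξ : ℂ} (h : Cone ζ) (h' : Cone ξ) : Cone (ζ + ξ) := by
  simp only [Cone, Complex.add_re, Complex.add_im] at *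
  exact (abs_add_le _ _).trans_lt (add_lt_add h h')

theorem Cone.smul {ζ : ℂ} (h : Cone ζ) {r : ℝ} (hr : 0 < r) : Cone (r * ζ) := by
  simp only [Cone, Complex.re_ofReal_mul, Complex.im_ofReal_mul, abs_mul, abs_of_pos hr] at *
  gcongr

theorem dir_eq_pos_imp {x s : ℝ} (hs : 0 ≤ s) (h : dir x = s) : ∃ n : ℤ, x = n * (2 * Real.pi) := by
  have h1 : s = 1 := by
    have := congrArg norm h
    rw [norm_dir, Complex.norm_real, Real.norm_of_nonneg hs] at this
    exact this.symm
  rw [h1, Complex.ofReal_one, dir, Complex.exp_eq_one_iff] at h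
  obtain ⟨n, hn⟩ := h
  refine ⟨n, ?_⟩
  have h2 : (x : ℂ) = n * (2 * Real.pi) := by
    apply mul_left_cancel₀ Complex.I_ne_zero
    rw [hn]; ring
  exact_mod_cast h2

theorem eq_norm_mul_dir_arg (ζ : ℂ) : ζ = ‖ζ‖ * dir (Complex.arg ζ) := by
  rw [dir, mul_comm Complex.I, Complex.norm_mul_exp_arg_mul_I]

theorem offRay_inv_mul_dir {u v : ℂ} (hu : u ≠ 0) (hv : v ≠ 0) {α β : ℝ}
    (h0 : 0 < |Complex.arg (v / u) + (α - β)|) (h1 : |Complex.arg (v / u) + (α - β)| < 2 * Real.pi) :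
    OffRay (u⁻¹ * dir α) (v⁻¹ * dir β) := by
  intro r hr he
  set φ := Complex.arg (v / u) with hφ
  have h2 : v / u = ‖v / u‖ * dir φ := eq_norm_mul_dir_arg _
  have hpos : 0 < ‖v / u‖ := norm_pos_iff.2 (div_ne_zero hv hu)
  have h3 : (v / u) * dir (α - β) = r := by
    have h4 : dir α = dir (α - β) * dir β := by rw [← dir_add]; congr 1; ring
    rw [h4] at he
    have h5 := dir_ne_zero β
    have : u⁻¹ * dir (α - β) = r * v⁻¹ := mul_right_cancel₀ h5 (by linear_combination he)
    rw [div_eq_mul_inv, mul_assoc, this]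
    field_simp
  rw [h2, mul_assoc, ← dir_add] at h3
  have h4 : dir (φ + (α - β)) = ((r / ‖v / u‖ : ℝ) : ℂ) := by
    have : (‖v / u‖ : ℂ) ≠ 0 := by exact_mod_cast hpos.ne'
    rw [Complex.ofReal_div, eq_div_iff this, mul_comm]
    exact h3
  obtain ⟨n, hn⟩ := dir_eq_pos_imp (div_nonneg hr hpos.le) h4
  rw [hn] at h0 h1
  have hpi := Real.pi_pos
  rw [abs_mul, abs_of_pos (by linarith : (0 : ℝ) < 2 * Real.pi)] at h0 h1
  have h5 : |(n : ℝ)| < 1 := by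
    by_contra h
    rw [not_lt] at h
    nlinarith
  have h6 : n = 0 := by
    rw [← Int.abs_lt_one_iff]
    exact_mod_cast h5
  simp [h6] at h0

/-- The value at `z` of the function `F_n`, as an integral over the rays through the `d_i`, for a
list of pairs `(d_i, z_i)`. -/
noncomputable def rayValue (L : List (ℂ × ℂ)) : ℂ :=
  (L.map Prod.snd).sum * rayIter L / (2 * Real.pi * Complex.I) ^ L.length

/-- The ray through `e^{iα} / w`, for a triple `(w, z, α)`. -/
noncomputable def tiltPair (x : ℂ × ℂ × ℝ) : ℂ × ℂ := (x.1⁻¹ * dir x.2.2, x.2.1)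

/-- The triple `(w, z, α)` with `z / w` in the sector and a small tilt `α`. -/
def Good (ε : ℝ) (x : ℂ × ℂ × ℝ) : Prop := x.1 ≠ 0 ∧ Cone (x.2.1 / x.1) ∧ |x.2.2| < ε

/-- The rays of `w` and `w'` are equal or form an angle of at least `2 ε`. -/
def Apart (ε : ℝ) (w w' : ℂ) : Prop := Complex.arg (w' / w) = 0 ∨ 2 * ε ≤ |Complex.arg (w' / w)|

/-- `Apart`, with distinct tilts in the case of equal rays. -/
def Tilted (ε : ℝ) (x y : ℂ × ℂ × ℝ) : Prop :=
  (Complex.arg (y.1 / x.1) = 0 ∧ x.2.2 ≠ y.2.2) ∨ 2 * ε ≤ |Complex.arg (y.1 / x.1)|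

/-- `Apart`, with increasing tilts in the case of equal rays. -/
def TiltedUp (ε : ℝ) (x y : ℂ × ℂ × ℝ) : Prop :=
  (Complex.arg (y.1 / x.1) = 0 ∧ x.2.2 < y.2.2) ∨ 2 * ε ≤ |Complex.arg (y.1 / x.1)|

theorem TiltedUp.tilted {ε : ℝ} {x y : ℂ × ℂ × ℝ} (h : TiltedUp ε x y) : Tilted ε x y :=
  h.imp (fun h => ⟨h.1, h.2.ne⟩) id

theorem Good.mono {ε ε' : ℝ} (h : ε ≤ ε') {x : ℂ × ℂ × ℝ} (hx : Good ε x) : Good ε' x :=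
  ⟨hx.1, hx.2.1, hx.2.2.trans_le h⟩

theorem Good.re_pos {ε : ℝ} (hε : ε ≤ Real.pi / 8) {x : ℂ × ℂ × ℝ} (hx : Good ε x) :
    0 < ((tiltPair x).2 * (tiltPair x).1).re := by
  have h := hx.2.1.re_mul_dir_pos (α := x.2.2) (by linarith [hx.2.2, Real.pi_pos])
  have : (tiltPair x).2 * (tiltPair x).1 = x.2.1 / x.1 * dir x.2.2 := by
    simp only [tiltPair]; ring
  rwa [this]

theorem Tilted.offRay {ε : ℝ} (hε : ε ≤ Real.pi / 8) {x y : ℂ × ℂ × ℝ} (hx : Good ε x)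
    (hy : Good ε y) (h : Tilted ε x y) : OffRay (tiltPair x).1 (tiltPair y).1 := by
  have hx2 := abs_lt.1 hx.2.2
  have hy2 := abs_lt.1 hy.2.2
  have hpi := Real.pi_pos
  have harg := Complex.abs_arg_le_pi (y.1 / x.1)
  refine offRay_inv_mul_dir hx.1 hy.1 ?_ ?_
  · rw [abs_pos]
    intro h0
    rcases h with ⟨h1, h2⟩ | h1
    · apply h2; linarith
    · have : Complex.arg (y.1 / x.1) = y.2.2 - x.2.2 := by linarith
      rw [this] at h1
      have : |y.2.2 - x.2.2| < 2 * ε := abs_lt.2 ⟨by linarith, by linarith⟩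
      linarith
  · have h2 := abs_le.1 harg
    rw [abs_lt]
    constructor <;> linarith

theorem admissibleList_tilt {ε : ℝ} (hε : ε ≤ Real.pi / 8) {T : List (ℂ × ℂ × ℝ)}
    (hg : ∀ x ∈ T, Good ε x) (hc : T.IsChain (Tilted ε)) : AdmissibleList (T.map tiltPair) := by
  rw [admissibleList_iff]
  constructor
  · intro y hy
    obtain ⟨x, hx, rfl⟩ := List.mem_map.1 hy
    exact (hg x hx).re_pos hε
  · rw [List.isChain_map]
    exact List.IsChain.imp_of_mem_imp (fun x y hx hy h => h.offRay hε (hg x hx) (hg y hy)) hc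

theorem segment_lt_segment {a a' b b' τ : ℝ} (h : a < b) (h' : a' < b') (hτ : τ ∈ Icc (0 : ℝ) 1) :
    a + τ * (a' - a) < b + τ * (b' - b) := by
  rcases hτ.1.eq_or_lt with rfl | h0
  · linarith
  · have h1 : 0 < τ * (b' - a') := mul_pos h0 (by linarith)
    have h2 : 0 ≤ (1 - τ) * (b - a) := mul_nonneg (by linarith [hτ.2]) (by linarith)
    linarith

/-- The integral only depends on the order of the tilts of neighbouring aligned rays. -/
theorem rayValue_eq_of_order {ε : ℝ} (hε : ε ≤ Real.pi / 8) (M : List (ℂ × ℂ × ℝ × ℝ))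
    (hg : ∀ m ∈ M, Good ε (m.1, m.2.1, m.2.2.1) ∧ Good ε (m.1, m.2.1, m.2.2.2))
    (hc : M.IsChain fun x y => (Complex.arg (y.1 / x.1) = 0 ∧
      ((x.2.2.1 < y.2.2.1 ∧ x.2.2.2 < y.2.2.2) ∨ (y.2.2.1 < x.2.2.1 ∧ y.2.2.2 < x.2.2.2))) ∨
      2 * ε ≤ |Complex.arg (y.1 / x.1)|) :
    rayValue (M.map fun m => tiltPair (m.1, m.2.1, m.2.2.1)) =
      rayValue (M.map fun m => tiltPair (m.1, m.2.1, m.2.2.2)) := by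
  have h := rayIter_eq_of_segment (M.map fun m => (m.1⁻¹, m.2.1, m.2.2.1, m.2.2.2)) (by
    intro τ hτ
    rw [List.map_map]
    have h1 : (fun m : ℂ × ℂ × ℝ × ℝ => rotPair m.1 m.2.1 (m.2.2.1 + τ * (m.2.2.2 - m.2.2.1))) ∘
        (fun m => (m.1⁻¹, m.2.1, m.2.2.1, m.2.2.2)) =
        tiltPair ∘ fun m : ℂ × ℂ × ℝ × ℝ => (m.1, m.2.1, m.2.2.1 + τ * (m.2.2.2 - m.2.2.1)) := rfl
    rw [h1, ← List.map_map]
    refine admissibleList_tilt hε ?_ ?_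
    · intro x hx
      obtain ⟨m, hm, rfl⟩ := List.mem_map.1 hx
      obtain ⟨h2, h3⟩ := hg m hm
      refine ⟨h2.1, h2.2.1, ?_⟩
      have e1 := abs_lt.1 h2.2.2
      have e2 := abs_lt.1 h3.2.2
      simp only at e1 e2 ⊢
      rw [abs_lt]
      constructor
      · simpa using segment_lt_segment e1.1 e2.1 hτ
      · simpa using segment_lt_segment e1.2 e2.2 hτ
    · rw [List.isChain_map]
      refine hc.imp fun x y hxy => hxy.imp (fun h => ⟨h.1, ?_⟩) id
      simp only
      rcases h.2 with ⟨a, b⟩ | ⟨a, b⟩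
      · exact ne_of_lt (segment_lt_segment a b hτ)
      · exact ne_of_gt (segment_lt_segment a b hτ))
  simp only [List.map_map] at h
  have h2 : rayIter (M.map fun m => tiltPair (m.1, m.2.1, m.2.2.1)) =
      rayIter (M.map fun m => tiltPair (m.1, m.2.1, m.2.2.2)) := h
  simp only [rayValue, h2, List.map_map, List.length_map]
  rfl

theorem rayValue_sameRays {L L' : List (ℂ × ℂ)} (h : SameRays L L') : rayValue L' = rayValue L := by
  have h1 : L'.map Prod.snd = L.map Prod.snd := by
    induction h with
    | nil => rfl
    | cons h _ ih =>
      obtain ⟨r, _, rfl⟩ := h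
      simp [ih]
  rw [rayValue, rayValue, h.rayIter_eq, h1, h.length_eq]

/-- The base point and the variable of a triple. -/
def forgetTilt (x : ℂ × ℂ × ℝ) : ℂ × ℂ := (x.1, x.2.1)

/-- Increasing tilts in `[a, ε)` for a list of pairs. -/
noncomputable def spread (ε : ℝ) : ℝ → List (ℂ × ℂ) → List (ℂ × ℂ × ℝ)
  | _, [] => []
  | a, x :: L => (x.1, x.2, a) :: spread ε ((a + ε) / 2) L

theorem spread_spec {ε : ℝ} {R : ℂ × ℂ → ℂ × ℂ → Prop} : ∀ (a : ℝ) (L : List (ℂ × ℂ)), 0 ≤ a → a < ε →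
    L.IsChain R →
    (spread ε a L).map forgetTilt = L ∧ (∀ x ∈ spread ε a L, 0 ≤ x.2.2 ∧ x.2.2 < ε) ∧
      (spread ε a L).IsChain (fun x y => R (forgetTilt x) (forgetTilt y) ∧ x.2.2 < y.2.2)
  | a, [], _, _, _ => by simp [spread]
  | a, [x], h0, h, _ => by simp [spread, h0, h, forgetTilt]
  | a, x :: y :: L, h0, h, hc => by
    rw [List.isChain_cons_cons] at hc
    obtain ⟨h1, h2, h3⟩ :=
      spread_spec (ε := ε) ((a + ε) / 2) (y :: L) (by linarith) (by linarith) hc.2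
    refine ⟨?_, ?_, ?_⟩
    · rw [spread, List.map_cons, h1]; rfl
    · rw [spread]
      intro t ht
      rcases List.mem_cons.1 ht with rfl | ht
      · exact ⟨h0, h⟩
      · exact h2 t ht
    · rw [spread, spread, List.isChain_cons_cons]
      rw [spread] at h3
      exact ⟨⟨hc.1, by simp only; linarith⟩, h3⟩

/-- An angle `ε > 0` such that neighbouring rays of a list are equal or form an angle of at least
`2 ε`. -/
noncomputable def tolerance : List ℂ → ℝ
  | [] => Real.pi / 8
  | [_] => Real.pi / 8
  | x :: y :: L => min (tolerance (y :: L))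
      (if Complex.arg (y / x) = 0 then Real.pi / 8 else |Complex.arg (y / x)| / 2)

theorem tolerance_pos : ∀ L : List ℂ, 0 < tolerance L
  | [] => by rw [tolerance]; linarith [Real.pi_pos]
  | [_] => by rw [tolerance]; linarith [Real.pi_pos]
  | x :: y :: L => by
    rw [tolerance]
    refine lt_min (tolerance_pos _) ?_
    split_ifs with h
    · linarith [Real.pi_pos]
    · have := abs_pos.2 h
      linarith

theorem tolerance_le : ∀ L : List ℂ, tolerance L ≤ Real.pi / 8
  | [] => le_rfl
  | [_] => le_rfl
  | x :: y :: L => by rw [tolerance]; exact (min_le_left _ _).trans (tolerance_le _)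

theorem Apart.mono {ε ε' : ℝ} (h : ε' ≤ ε) {x y : ℂ} (hxy : Apart ε x y) : Apart ε' x y :=
  hxy.imp id fun h' => by linarith

theorem isChain_apart_tolerance : ∀ L : List ℂ, L.IsChain (Apart (tolerance L))
  | [] => List.isChain_nil
  | [_] => List.isChain_singleton _
  | x :: y :: L => by
    rw [List.isChain_cons_cons]
    constructor
    · by_cases h : Complex.arg (y / x) = 0
      · exact Or.inl h
      · right
        have := min_le_right (tolerance (y :: L))
          (if Complex.arg (y / x) = 0 then Real.pi / 8 else |Complex.arg (y / x)| / 2)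
        rw [if_neg h] at this
        rw [tolerance, if_neg h]
        linarith
    · exact (isChain_apart_tolerance (y :: L)).imp fun a b h => h.mono (by
        rw [tolerance]; exact min_le_left _ _)

/-- The value of the integral with slightly increasing tilts, for a list of pairs `(w_i, z_i)`. -/
noncomputable def upValue (L : List (ℂ × ℂ)) : ℂ :=
  rayValue ((spread (tolerance (L.map Prod.fst)) 0 L).map tiltPair)

/-- Increasing tilts within the runs of aligned rays determine the integral, whatever their size. -/
theorem rayValue_eq_upValue {ε : ℝ} (hε : ε ≤ Real.pi / 8) {T : List (ℂ × ℂ × ℝ)}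
    (hg : ∀ x ∈ T, Good ε x) (hc : T.IsChain (TiltedUp ε)) :
    rayValue (T.map tiltPair) = upValue (T.map forgetTilt) := by
  set δ := tolerance ((T.map forgetTilt).map Prod.fst) with hδ
  have hδ0 : 0 < δ := tolerance_pos _
  have hδ1 : T.IsChain fun x y => Apart δ x.1 y.1 := by
    have := isChain_apart_tolerance ((T.map forgetTilt).map Prod.fst)
    rw [List.map_map, List.isChain_map] at this
    rw [hδ, List.map_map]
    exact this
  -- `M` combines the tilts of `T` with those chosen by `spread`.
  have key : ∀ (T : List (ℂ × ℂ × ℝ)) (a : ℝ), 0 ≤ a → a < δ → (∀ x ∈ T, Good ε x) →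
      T.IsChain (TiltedUp ε) → (T.IsChain fun x y => Apart δ x.1 y.1) →
      ∃ M : List (ℂ × ℂ × ℝ × ℝ), M.map (fun m => (m.1, m.2.1, m.2.2.1)) = T ∧
        M.map (fun m => (m.1, m.2.1, m.2.2.2)) = spread δ a (T.map forgetTilt) ∧
        (∀ m ∈ M, Good (max ε δ) (m.1, m.2.1, m.2.2.1) ∧ Good (max ε δ) (m.1, m.2.1, m.2.2.2)) ∧
        (∀ m ∈ M.head?, m.2.2.2 = a) ∧
        M.IsChain fun x y => (Complex.arg (y.1 / x.1) = 0 ∧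
          ((x.2.2.1 < y.2.2.1 ∧ x.2.2.2 < y.2.2.2) ∨ (y.2.2.1 < x.2.2.1 ∧ y.2.2.2 < x.2.2.2))) ∨
          2 * max ε δ ≤ |Complex.arg (y.1 / x.1)| := by
    intro T
    induction T with
    | nil => intro a _ _ _ _ _; exact ⟨[], rfl, rfl, by simp, by simp, List.isChain_nil⟩
    | cons t T ih =>
      intro a ha0 ha hg hc hd
      obtain ⟨M, h1, h2, h3, h4, h5⟩ := ih ((a + δ) / 2) (by linarith) (by linarith)
        (fun x hx => hg x (by simp [hx])) hc.tail hd.tail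
      have ht := hg t (by simp)
      refine ⟨(t.1, t.2.1, t.2.2, a) :: M, by simp [h1], by simp [h2, spread, forgetTilt], ?_, by simp, ?_⟩
      · intro m hm
        rcases List.mem_cons.1 hm with rfl | hm
        · refine ⟨ht.mono (le_max_left _ _), ht.1, ht.2.1, ?_⟩
          simp only
          rw [abs_of_nonneg ha0]
          exact ha.trans_le (le_max_right _ _)
        · exact h3 m hm
      · refine h5.cons fun y hy => ?_
        have hy2 := h4 y hy
        cases M with
        | nil => simp at hy
        | cons m M =>
          simp only [List.head?_cons, Option.mem_some_iff] at hy
          subst hy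
          rw [← h1, List.map_cons, List.isChain_cons_cons] at hc hd
          have hup := hc.1
          have hap := hd.1
          simp only [TiltedUp, Apart] at hup hap
          simp only
          by_cases h0 : Complex.arg (m.1 / t.1) = 0
          · rcases hup with h | h
            · exact Or.inl ⟨h0, Or.inl ⟨h.2, by rw [hy2]; linarith⟩⟩
            · right
              rw [h0, abs_zero] at h ⊢
              have := (abs_nonneg _).trans_lt ht.2.2
              linarith
          · right
            have e1 := hup.resolve_left fun h => h0 h.1
            have e2 := hap.resolve_left h0
            rcases max_cases ε δ with ⟨h, _⟩ | ⟨h, _⟩ <;> rw [h] <;> assumption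
  obtain ⟨M, h1, h2, h3, _, h5⟩ := key T 0 le_rfl hδ0 hg hc hδ1
  have h6 := rayValue_eq_of_order (max_le hε (tolerance_le _)) M h3 h5
  have e1 : (M.map fun m => tiltPair (m.1, m.2.1, m.2.2.1)) = T.map tiltPair := by
    rw [← h1, List.map_map]; rfl
  have e2 : (M.map fun m => tiltPair (m.1, m.2.1, m.2.2.2)) =
      (spread δ 0 (T.map forgetTilt)).map tiltPair := by
    rw [← h2, List.map_map]; rfl
  rw [e1, e2] at h6
  rw [h6, upValue, hδ]

/-! ### Crossing walls -/

theorem arg_div_eq_zero_iff {u v : ℂ} (hu : u ≠ 0) (hv : v ≠ 0) :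
    Complex.arg (v / u) = 0 ↔ ∃ r : ℝ, 0 < r ∧ v = r * u := by
  constructor
  · intro h
    refine ⟨‖v / u‖, norm_pos_iff.2 (div_ne_zero hv hu), ?_⟩
    have := eq_norm_mul_dir_arg (v / u)
    rw [h, dir_zero, mul_one] at this
    rw [← this, div_mul_cancel₀ _ hu]
  · rintro ⟨r, hr, rfl⟩
    rw [mul_div_cancel_right₀ _ hu, Complex.arg_ofReal_of_nonneg hr.le]

theorem arg_mul_div_right {r : ℝ} (hr : 0 < r) (u v : ℂ) :
    Complex.arg (r * v / u) = Complex.arg (v / u) := by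
  rw [mul_div_assoc, Complex.arg_real_mul _ hr]

theorem arg_div_mul_right {r : ℝ} (hr : 0 < r) (u v : ℂ) :
    Complex.arg (v / (r * u)) = Complex.arg (v / u) := by
  have : v / (r * u) = ((r⁻¹ : ℝ) : ℂ) * (v / u) := by
    rw [Complex.ofReal_inv, mul_comm (r : ℂ) u, ← div_div]
    ring
  rw [this, Complex.arg_real_mul _ (inv_pos.2 hr)]

theorem rayValue_rescale (pre R : List (ℂ × ℂ × ℝ)) (x : ℂ × ℂ × ℝ) {r : ℝ} (hr : 0 < r) :
    rayValue ((pre ++ (r * x.1, x.2) :: R).map tiltPair) =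
      rayValue ((pre ++ x :: R).map tiltPair) := by
  refine rayValue_sameRays ?_
  have hrefl : ∀ p : ℂ × ℂ, ∃ s : ℝ, 0 < s ∧ p = (p.1 * s, p.2) := fun p => ⟨1, one_pos, by simp⟩
  rw [List.map_append, List.map_append]
  refine List.rel_append (List.forall₂_same.2 fun p _ => hrefl p) ?_
  rw [List.map_cons, List.map_cons]
  refine List.Forall₂.cons ⟨r⁻¹, inv_pos.2 hr, ?_⟩ (List.forall₂_same.2 fun p _ => hrefl p)
  simp only [tiltPair, Prod.mk.injEq, and_true]
  rw [mul_inv]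
  push_cast
  ring

/-- Crossing a single wall: moving the ray of `x` across the ray of `y`, parallel to it, changes the
integral by the one where the two variables are merged. -/
theorem rayValue_wall {ε : ℝ} (hε : ε ≤ Real.pi / 8) {pre B : List (ℂ × ℂ × ℝ)}
    {x y : ℂ × ℂ × ℝ} {a : ℝ} (hpre : ∀ p ∈ pre, Good ε p) (hx : Good ε x) (hy : Good ε y)
    (hB : ∀ b ∈ B, Good ε b) (hxy : Complex.arg (y.1 / x.1) = 0) (ha : a < y.2.2)
    (hyx : y.2.2 < x.2.2) (ha0 : -ε < a) (hpc : pre.IsChain (Tilted ε))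
    (hj : ∀ p ∈ pre.getLast?, (Complex.arg (x.1 / p.1) = 0 ∧ p.2.2 < a) ∨
      2 * ε ≤ |Complex.arg (x.1 / p.1)|) (hyB : (y :: B).IsChain (Tilted ε)) :
    rayValue ((pre ++ x :: y :: B).map tiltPair) =
      rayValue ((pre ++ (x.1, x.2.1, a) :: y :: B).map tiltPair) -
      rayValue ((pre ++ (x.1 + y.1, x.2.1 + y.2.1, y.2.2) :: B).map tiltPair) := by
  obtain ⟨r, hr, hyr⟩ := (arg_div_eq_zero_iff hx.1 hy.1).1 hxy
  have hpi := Real.pi_pos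
  have e1 := abs_lt.1 hx.2.2
  have e2 := abs_lt.1 hy.2.2
  -- Positive multiples of the directions do not matter, so the ray of `x` is written as that of `y`
  -- turned by an angle.
  set d : ℂ := y.1⁻¹ * dir y.2.2 with hd
  have hrot : ∀ τ, d * dir τ = y.1⁻¹ * dir (τ + y.2.2) := by
    intro τ
    rw [hd, add_comm τ, dir_add]; ring
  have hgood : ∀ τ ∈ Icc (a - y.2.2) (x.2.2 - y.2.2), Good ε (y.1, x.2.1, τ + y.2.2) := by
    intro τ hτ
    refine ⟨hy.1, ?_, ?_⟩
    · have : x.2.1 / y.1 = ((r⁻¹ : ℝ) : ℂ) * (x.2.1 / x.1) := by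
        rw [hyr]; push_cast; rw [mul_comm, ← div_div]; ring
      simp only [this]
      exact hx.2.1.smul (inv_pos.2 hr)
    · simp only
      rw [abs_lt]
      constructor <;> linarith [hτ.1, hτ.2]
  have hpair : ∀ τ, tiltPair (y.1, x.2.1, τ + y.2.2) = (d * dir τ, x.2.1) := by
    intro τ; rw [hrot]; rfl
  have hyadm : AdmissibleList ((y :: B).map tiltPair) := admissibleList_tilt hε (by
    intro b hb
    rcases List.mem_cons.1 hb with rfl | hb
    · exact hy
    · exact hB b hb) hyB
  have hw := rayIter_wall (d := d) (z := x.2.1) (z₂ := y.2.1) (L := B.map tiltPair)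
    (α := x.2.2 - y.2.2) (β := a - y.2.2) (by linarith) (by linarith) (by linarith) (by linarith)
    (by
      intro τ hτ
      have := (hgood τ hτ).re_pos hε
      rwa [hpair] at this) (hy.re_pos hε) hyadm.2 (pre.map tiltPair) (by
      intro τ hτ
      have h1 : pre.map tiltPair ++ [(d * dir τ, x.2.1)] =
          (pre ++ [(y.1, x.2.1, τ + y.2.2)]).map tiltPair := by
        rw [List.map_append, List.map_singleton, hpair]
      rw [h1]
      refine admissibleList_tilt hε ?_ ?_
      · intro p hp
        rcases List.mem_append.1 hp with hp | hp
        · exact hpre p hp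
        · rw [List.mem_singleton] at hp
          subst hp
          exact hgood τ hτ
      · refine hpc.append (List.isChain_singleton _) ?_
        intro p hp q hq
        simp only [List.head?_cons, Option.mem_some_iff] at hq
        subst hq
        have h2 := hj p hp
        simp only [Tilted]
        rw [hyr, arg_mul_div_right hr]
        exact h2.imp (fun h => ⟨h.1, by linarith [hτ.1, h.2]⟩) id)
  have hx1 : rayValue ((pre ++ x :: y :: B).map tiltPair) =
      rayValue (pre.map tiltPair ++ (d * dir (x.2.2 - y.2.2), x.2.1) :: (d, y.2.1) :: B.map tiltPair) := by
    rw [← rayValue_rescale pre (y :: B) x hr, ← hyr, ← hpair, sub_add_cancel, List.map_append,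
      List.map_cons, List.map_cons]
    rfl
  have hx2 : rayValue ((pre ++ (x.1, x.2.1, a) :: y :: B).map tiltPair) =
      rayValue (pre.map tiltPair ++ (d * dir (a - y.2.2), x.2.1) :: (d, y.2.1) :: B.map tiltPair) := by
    rw [← rayValue_rescale pre (y :: B) (x.1, x.2.1, a) hr]
    simp only
    rw [← hyr, ← hpair, sub_add_cancel, List.map_append, List.map_cons, List.map_cons]
    rfl
  have hx3 : rayValue ((pre ++ (x.1 + y.1, x.2.1 + y.2.1, y.2.2) :: B).map tiltPair) =
      rayValue (pre.map tiltPair ++ (d, x.2.1 + y.2.1) :: B.map tiltPair) := by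
    have hs : x.1 + y.1 = ((r⁻¹ + 1 : ℝ) : ℂ) * y.1 := by
      rw [hyr]
      have : (r : ℂ) ≠ 0 := by exact_mod_cast hr.ne'
      push_cast
      field_simp
    rw [hs, rayValue_rescale pre B (y.1, x.2.1 + y.2.1, y.2.2) (by positivity : 0 < r⁻¹ + 1),
      List.map_append, List.map_cons]
    rfl
  rw [hx1, hx2, hx3, rayValue, rayValue, rayValue]
  have hn : (2 * Real.pi * Complex.I : ℂ) ≠ 0 := Complex.two_pi_I_ne_zero
  simp only [List.map_append, List.map_cons, List.sum_append, List.sum_cons, List.length_append,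
    List.length_cons, List.length_map]
  rw [sub_eq_iff_eq_add.1 hw, ← add_assoc pre.length (B.length + 1) 1, pow_succ]
  have hn' := pow_ne_zero (pre.length + (B.length + 1)) hn
  rw [eq_sub_iff_add_eq, div_add_div _ _ (mul_ne_zero hn' hn) hn', div_eq_div_iff
    (mul_ne_zero (mul_ne_zero hn' hn) hn') (mul_ne_zero hn' hn)]
  ring

open Classical in
/-- The sign of a block of aligned base points with decreasing tilts. -/
noncomputable def downSign (C : List (ℂ × ℂ × ℝ)) : ℂ :=
  if C.IsChain fun x y => Complex.arg (y.1 / x.1) = 0 ∧ y.2.2 < x.2.2 then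
    (-1) ^ (C.length - 1) else 0

/-- The total base point and variable of a block of triples. -/
def tripleTotal (C : List (ℂ × ℂ × ℝ)) : ℂ × ℂ := blockTotal (C.map forgetTilt)

theorem tripleTotal_singleton (x : ℂ × ℂ × ℝ) : tripleTotal [x] = forgetTilt x := by
  simp [tripleTotal, blockTotal, forgetTilt]

theorem downSign_singleton (x : ℂ × ℂ × ℝ) : downSign [x] = 1 := by
  simp [downSign]

/-- Crossing all walls: the integral with arbitrary tilts in terms of integrals with increasing
tilts. -/
theorem rayValue_eq_blockOp {ε : ℝ} (hε0 : 0 < ε) (hε : ε ≤ Real.pi / 8) (n : ℕ) :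
    ∀ (pre : List (ℂ × ℂ × ℝ)) (x : ℂ × ℂ × ℝ) (l : List (ℂ × ℂ × ℝ)), l.length = n →
    (∀ p ∈ pre, Good ε p) → (∀ p ∈ x :: l, Good (ε / 2) p) →
    (pre ++ [x]).IsChain (TiltedUp ε) → (x :: l).IsChain (Tilted ε) →
    rayValue ((pre ++ x :: l).map tiltPair) =
      blockOp tripleTotal downSign (fun M => upValue (pre.map forgetTilt ++ M)) (x :: l) := by
  have hpi := Real.pi_pos
  induction n with
  | zero =>
    intro pre x l hl hpre hgl hup _
    rw [List.length_eq_zero_iff] at hl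
    subst hl
    rw [rayValue_eq_upValue hε _ hup, blockOp_eq_prefixSum _ _ _ (by simp)]
    · simp [prefixSum, downSign_singleton, tripleTotal_singleton]
    · intro p hp
      rcases List.mem_append.1 hp with hp | hp
      · exact hpre p hp
      · exact (hgl p hp).mono (by linarith)
  | succ n ih =>
    intro pre x l hl hpre hgl hup hti
    cases l with
    | nil => simp at hl
    | cons y B =>
    have hBn : B.length = n := by simpa using hl
    have hx := hgl x (by simp)
    have hy := hgl y (by simp)
    rw [List.isChain_cons_cons] at hti
    rw [blockOp_eq_prefixSum _ _ _ (by simp)]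
    simp only [prefixSum, downSign_singleton, one_mul, tripleTotal_singleton]
    by_cases hdown : Complex.arg (y.1 / x.1) = 0 ∧ y.2.2 < x.2.2
    -- If the tilts increase from `x` to `y`, or the rays are not aligned, then `x` joins the prefix.
    swap
    · have hxy : TiltedUp ε x y := by
        refine hti.1.imp (fun h => ⟨h.1, ?_⟩) id
        by_contra hlt
        exact hdown ⟨h.1, lt_of_le_of_ne (not_lt.1 hlt) (Ne.symm h.2)⟩
      have h0 : ∀ A, downSign (x :: y :: A) = 0 := by
        intro A
        rw [downSign, if_neg]
        rw [List.isChain_cons_cons]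
        exact fun h => hdown h.1
      have hih := ih (pre ++ [x]) y B hBn (by
          intro p hp
          rcases List.mem_append.1 hp with hp | hp
          · exact hpre p hp
          · rw [List.mem_singleton] at hp
            subst hp
            exact hx.mono (by linarith)) (fun p hp => hgl p (List.mem_cons_of_mem _ hp))
        (hup.append (List.isChain_singleton y) (by
          intro p hp q hq
          simp at hp hq
          subst hp; subst hq
          exact hxy)) hti.2
      have e1 : pre ++ x :: y :: B = pre ++ [x] ++ y :: B := by simp
      rw [e1, hih]
      simp only [h0, zero_mul, prefixSum_zero, add_zero]
      congr 1
      funext M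
      simp
    · -- The prefix is moved out of the way before the ray of `x` is moved across the one of `y`.
      -- The new tilts of the prefix lie below `-9ε/16`, those of the other rays above `-ε/2`.
      set f : ℂ × ℂ × ℝ → ℂ × ℂ × ℝ := fun p => (p.1, p.2.1, -(3 * ε / 4) + p.2.2 / 8) with hf
      set pre' := pre.map f with hpre'
      have hfb : ∀ p ∈ pre, -ε < (f p).2.2 ∧ (f p).2.2 < -(9 * ε / 16) := by
        intro p hp
        have := abs_lt.1 (hpre p hp).2.2
        simp only [hf]
        constructor <;> linarith
      have hgood' : ∀ p ∈ pre', Good ε p := by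
        intro p hp
        obtain ⟨q, hq, rfl⟩ := List.mem_map.1 hp
        refine ⟨(hpre q hq).1, (hpre q hq).2.1, abs_lt.2 ⟨(hfb q hq).1, ?_⟩⟩
        linarith [(hfb q hq).2]
      have hxa := abs_lt.1 hx.2.2
      have hya := abs_lt.1 hy.2.2
      rw [List.isChain_append] at hup
      obtain ⟨hup1, _, hup2⟩ := hup
      have hupf : pre'.IsChain (TiltedUp ε) := by
        rw [hpre', List.isChain_map]
        refine hup1.imp fun p q h => h.imp (fun h => ⟨h.1, ?_⟩) id
        simp only [hf]; linarith [h.2]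
      have hlast : ∀ p ∈ pre'.getLast?, (Complex.arg (x.1 / p.1) = 0 ∧ p.2.2 < -(9 * ε / 16)) ∨
          2 * ε ≤ |Complex.arg (x.1 / p.1)| := by
        intro p hp
        rw [hpre', List.getLast?_map] at hp
        obtain ⟨q, hq, rfl⟩ := Option.mem_map.1 hp
        have hq2 := hup2 q hq x (by simp)
        exact hq2.imp (fun h => ⟨h.1, (hfb q (List.mem_of_getLast? hq)).2⟩) id
      have hmove : rayValue ((pre ++ x :: y :: B).map tiltPair) =
          rayValue ((pre' ++ x :: y :: B).map tiltPair) := by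
        have h := rayValue_eq_of_order hε
          (pre.map (fun p => (p.1, p.2.1, p.2.2, (f p).2.2)) ++
            (x :: y :: B).map fun p => (p.1, p.2.1, p.2.2, p.2.2)) (by
            intro m hm
            rcases List.mem_append.1 hm with hm | hm
            · obtain ⟨q, hq, rfl⟩ := List.mem_map.1 hm
              exact ⟨hpre q hq, hgood' _ (List.mem_map_of_mem hq)⟩
            · obtain ⟨q, hq, rfl⟩ := List.mem_map.1 hm
              exact ⟨(hgl q hq).mono (by linarith), (hgl q hq).mono (by linarith)⟩) (by
            refine List.IsChain.append ?_ ?_ ?_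
            · rw [List.isChain_map]
              refine hup1.imp fun p q h => h.imp (fun h => ⟨h.1, Or.inl ⟨h.2, ?_⟩⟩) id
              simp only [hf]; linarith [h.2]
            · rw [List.isChain_map]
              have h1 : (x :: y :: B).IsChain (Tilted ε) := List.isChain_cons_cons.2 hti
              refine h1.imp fun p q h => h.imp (fun h => ⟨h.1, ?_⟩) id
              rcases lt_or_gt_of_ne h.2 with h' | h'
              · exact Or.inl ⟨h', h'⟩
              · exact Or.inr ⟨h', h'⟩
            · intro p hp q hq
              rw [List.getLast?_map] at hp
              obtain ⟨t, ht, rfl⟩ := Option.mem_map.1 hp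
              simp only [List.map_cons, List.head?_cons, Option.mem_some_iff] at hq
              subst hq
              have hq2 := hup2 t ht x (by simp)
              have := (hfb t (List.mem_of_getLast? ht)).2
              exact hq2.imp (fun h => ⟨h.1, Or.inl ⟨h.2, by simp only; linarith⟩⟩) id)
        have e1 : (pre.map (fun p => (p.1, p.2.1, p.2.2, (f p).2.2)) ++
            (x :: y :: B).map fun p => (p.1, p.2.1, p.2.2, p.2.2)).map
            (fun m : ℂ × ℂ × ℝ × ℝ => tiltPair (m.1, m.2.1, m.2.2.1)) =
            (pre ++ x :: y :: B).map tiltPair := by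
          simp only [List.map_append, List.map_map]; rfl
        have e2 : (pre.map (fun p => (p.1, p.2.1, p.2.2, (f p).2.2)) ++
            (x :: y :: B).map fun p => (p.1, p.2.1, p.2.2, p.2.2)).map
            (fun m : ℂ × ℂ × ℝ × ℝ => tiltPair (m.1, m.2.1, m.2.2.2)) =
            (pre' ++ x :: y :: B).map tiltPair := by
          simp only [hpre', List.map_append, List.map_map]; rfl
        rw [e1, e2] at h
        exact h
      obtain ⟨r, hr, hyr⟩ := (arg_div_eq_zero_iff hx.1 hy.1).1 hdown.1
      have hs : x.1 + y.1 = ((r⁻¹ + 1 : ℝ) : ℂ) * y.1 := by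
        rw [hyr]
        have : (r : ℂ) ≠ 0 := by exact_mod_cast hr.ne'
        push_cast
        field_simp
      have hs' : x.1 + y.1 = ((1 + r : ℝ) : ℂ) * x.1 := by
        rw [hyr]; push_cast; ring
      have hr1 : 0 < r⁻¹ + 1 := by positivity
      have hr2 : 0 < 1 + r := by positivity
      -- The merged pair, which takes the tilt of `y`.
      set m : ℂ × ℂ × ℝ := (x.1 + y.1, x.2.1 + y.2.1, y.2.2) with hm
      have harg : ∀ b : ℂ, Complex.arg (b / m.1) = Complex.arg (b / y.1) := by
        intro b
        simp only [hm]
        rw [hs, arg_div_mul_right hr1]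
      have hmgood : Good (ε / 2) m := by
        refine ⟨?_, ?_, hy.2.2⟩
        · simp only [hm]
          rw [hs]
          exact mul_ne_zero (by exact_mod_cast hr1.ne') hy.1
        · have : m.2.1 / m.1 = (((1 + r)⁻¹ : ℝ) : ℂ) * (x.2.1 / x.1) +
              (((r⁻¹ + 1)⁻¹ : ℝ) : ℂ) * (y.2.1 / y.1) := by
            have c1 : ((1 + r : ℝ) : ℂ) ≠ 0 := by exact_mod_cast hr2.ne'
            have c2 : ((r⁻¹ + 1 : ℝ) : ℂ) ≠ 0 := by exact_mod_cast hr1.ne'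
            have d1 : x.2.1 / (x.1 + y.1) = (((1 + r)⁻¹ : ℝ) : ℂ) * (x.2.1 / x.1) := by
              rw [hs', Complex.ofReal_inv, mul_comm _ x.1, ← div_div]; ring
            have d2 : y.2.1 / (x.1 + y.1) = (((r⁻¹ + 1)⁻¹ : ℝ) : ℂ) * (y.2.1 / y.1) := by
              rw [hs, Complex.ofReal_inv, mul_comm _ y.1, ← div_div]; ring
            rw [← d1, ← d2]
            simp only [hm]
            ring
          rw [this]
          exact (hx.2.1.smul (inv_pos.2 hr2)).add (hy.2.1.smul (inv_pos.2 hr1))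
      have hwall := rayValue_wall hε hgood' (hx.mono (by linarith)) (hy.mono (by linarith))
        (fun b hb => (hgl b (by simp [hb])).mono (by linarith)) hdown.1
        (a := -(9 * ε / 16)) (by linarith) hdown.2 (by linarith)
        (hupf.imp fun _ _ h => h.tilted) hlast hti.2
      have hforget : pre'.map forgetTilt = pre.map forgetTilt := by
        rw [hpre', List.map_map]; rfl
      set x₁ : ℂ × ℂ × ℝ := (x.1, x.2.1, -(9 * ε / 16)) with hx₁
      have hup₁ : (pre' ++ [x₁]).IsChain (TiltedUp ε) := by
        refine hupf.append (List.isChain_singleton _) ?_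
        intro p hp q hq
        simp only [List.head?_cons, Option.mem_some_iff] at hq
        subst hq
        exact hlast p hp
      have hih1 := ih (pre' ++ [x₁]) y B hBn (by
          intro p hp
          rcases List.mem_append.1 hp with hp | hp
          · exact hgood' p hp
          · rw [List.mem_singleton] at hp
            subst hp
            refine ⟨hx.1, hx.2.1, abs_lt.2 ⟨?_, ?_⟩⟩ <;> simp only [hx₁] <;> linarith)
        (fun p hp => hgl p (List.mem_cons_of_mem _ hp))
        (hup₁.append (List.isChain_singleton y) (by
          intro p hp q hq
          simp at hp hq
          subst hp; subst hq
          exact Or.inl ⟨hdown.1, by simp only [hx₁]; linarith⟩)) hti.2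
      have hmB : (m :: B).IsChain (Tilted ε) := by
        refine hti.2.imp_head ?_
        intro z h
        simp only [Tilted, harg] at h ⊢
        exact h
      have hih2 := ih pre' m B hBn hgood' (by
          intro p hp
          rcases List.mem_cons.1 hp with rfl | hp
          · exact hmgood
          · exact hgl p (by simp [hp]))
        (hupf.append (List.isChain_singleton _) (by
          intro p hp q hq
          simp only [List.head?_cons, Option.mem_some_iff] at hq
          subst hq
          have := hlast p hp
          simp only [TiltedUp, hm]
          rw [hs', arg_mul_div_right hr2]
          exact this.imp (fun h => ⟨h.1, by linarith [h.2]⟩) id)) hmB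
      have e1 : pre' ++ x₁ :: y :: B = pre' ++ [x₁] ++ y :: B := by simp
      rw [hmove, hwall, e1, hih1, hih2, sub_eq_add_neg]
      congr 1
      · congr 1
        funext M
        simp [hforget]
        rfl
      · have hsign : ∀ A, downSign (x :: y :: A) = - downSign (m :: A) := by
          intro A
          have hiff : (x :: y :: A).IsChain (fun x y => Complex.arg (y.1 / x.1) = 0 ∧ y.2.2 < x.2.2) ↔
              (m :: A).IsChain (fun x y => Complex.arg (y.1 / x.1) = 0 ∧ y.2.2 < x.2.2) := by
            rw [List.isChain_cons_cons]
            constructor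
            · rintro ⟨_, h⟩
              refine h.imp_head ?_
              intro z h
              rw [harg]; exact h
            · intro h
              refine ⟨hdown, h.imp_head ?_⟩
              intro z h
              rw [harg] at h; exact h
          simp only [downSign, hiff]
          split_ifs
          · simp [pow_succ]
          · simp
        have htot : ∀ A, tripleTotal (x :: y :: A) = tripleTotal (m :: A) := by
          intro A
          simp [tripleTotal, blockTotal, forgetTilt, hm, add_assoc]
        rw [blockOp_eq_prefixSum _ _ _ (by simp)]
        simp only [prefixSum, hsign, htot, hforget, neg_add]
        rw [← neg_one_mul (prefixSum _ _), ← prefixSum_mul_left]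
        simp

/-! ### The transformation formula -/

/-- `y` is on the open ray of `x`. -/
def OnRay (x y : ℂ) : Prop := ∃ r : ℝ, 0 < r ∧ y = r * x

theorem OnRay.refl (x : ℂ) : OnRay x x := ⟨1, one_pos, by simp⟩

theorem OnRay.symm {x y : ℂ} (h : OnRay x y) : OnRay y x := by
  obtain ⟨r, hr, rfl⟩ := h
  have : (r : ℂ) ≠ 0 := by exact_mod_cast hr.ne'
  exact ⟨r⁻¹, inv_pos.2 hr, by push_cast; field_simp⟩

theorem OnRay.trans {x y z : ℂ} (h : OnRay x y) (h' : OnRay y z) : OnRay x z := by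
  obtain ⟨r, hr, rfl⟩ := h
  obtain ⟨s, hs, rfl⟩ := h'
  exact ⟨s * r, mul_pos hs hr, by push_cast; ring⟩

theorem div_mem_posRay_iff {x y : ℂ} (hx : x ≠ 0) : y / x ∈ posRay ↔ OnRay x y := by
  simp only [posRay, Set.mem_ofPred_eq, OnRay, div_eq_iff hx]

theorem OnRay.arg_div {x y x' y' : ℂ} (hx : OnRay x x') (hy : OnRay y y') :
    Complex.arg (y' / x') = Complex.arg (y / x) := by
  obtain ⟨r, hr, rfl⟩ := hx
  obtain ⟨s, hs, rfl⟩ := hy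
  rw [arg_div_mul_right hr, arg_mul_div_right hs]

theorem OnRay.sum {x : ℂ} : ∀ {A : List ℂ}, A ≠ [] → (∀ y ∈ A, OnRay x y) → OnRay x A.sum
  | [], h, _ => absurd rfl h
  | [y], _, h => by simpa using h y (by simp)
  | y :: y' :: A, _, h => by
    obtain ⟨r, hr, h1⟩ := h y (by simp)
    obtain ⟨s, hs, h2⟩ := OnRay.sum (A := y' :: A) (by simp) fun z hz => h z (List.mem_cons_of_mem _ hz)
    exact ⟨r + s, add_pos hr hs, by rw [List.sum_cons, h1, h2]; push_cast; ring⟩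

theorem arg_pos_mul_dir {r φ : ℝ} (hr : 0 < r) (h : φ ∈ Ioc (-Real.pi) Real.pi) :
    Complex.arg (r * dir φ) = φ := by
  rw [dir_eq]
  have := Complex.arg_mul_cos_add_sin_mul_I hr h
  simpa using this

/-- The variable is in the sector around the base point and its relative argument is small. -/
def Near (δ : ℝ) (q : ℂ × ℂ) : Prop := q.1 ≠ 0 ∧ Cone (q.2 / q.1) ∧ |Complex.arg (q.2 / q.1)| < δ

/-- The argument of the variable relative to the base point. -/
noncomputable def relArg (q : ℂ × ℂ) : ℝ := Complex.arg (q.2 / q.1)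

theorem Near.snd_ne_zero {δ : ℝ} {q : ℂ × ℂ} (h : Near δ q) : q.2 ≠ 0 := by
  intro h0
  have := h.2.1.ne_zero
  simp [h0] at this

theorem Near.snd_eq {δ : ℝ} {q : ℂ × ℂ} (h : Near δ q) :
    ∃ r : ℝ, 0 < r ∧ q.2 = r * (q.1 * dir (relArg q)) := by
  refine ⟨‖q.2 / q.1‖, norm_pos_iff.2 h.2.1.ne_zero, ?_⟩
  have := eq_norm_mul_dir_arg (q.2 / q.1)
  rw [relArg]
  rw [div_eq_iff h.1] at this
  linear_combination this

theorem Near.div_eq {δ : ℝ} {p q : ℂ × ℂ} (hp : Near δ p) (hq : Near δ q) :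
    ∃ r : ℝ, 0 < r ∧ q.2 / p.2 = r * (dir (relArg q - relArg p) * (q.1 / p.1)) := by
  obtain ⟨r, hr, h1⟩ := hp.snd_eq
  obtain ⟨s, hs, h2⟩ := hq.snd_eq
  refine ⟨s / r, div_pos hs hr, ?_⟩
  have h3 : dir (relArg q) = dir (relArg q - relArg p) * dir (relArg p) := by
    rw [← dir_add]; congr 1; ring
  have h4 := dir_ne_zero (relArg p)
  have h5 : (r : ℂ) ≠ 0 := by exact_mod_cast hr.ne'
  have h6 := hp.1
  rw [h1, h2, h3]
  push_cast
  field_simp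

theorem Near.arg_div {δ : ℝ} (hδ : δ ≤ Real.pi / 2) {p q : ℂ × ℂ} (hp : Near δ p) (hq : Near δ q)
    (h : OnRay p.1 q.1) : Complex.arg (q.2 / p.2) = relArg q - relArg p := by
  obtain ⟨r, hr, h1⟩ := hp.div_eq hq
  obtain ⟨s, hs, h2⟩ := h
  rw [h1, h2, mul_div_cancel_right₀ _ hp.1]
  have : (r : ℂ) * (dir (relArg q - relArg p) * s) = ((r * s : ℝ) : ℂ) * dir (relArg q - relArg p) := by
    push_cast; ring
  rw [this]
  have e1 := abs_lt.1 hp.2.2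
  have e2 := abs_lt.1 hq.2.2
  exact arg_pos_mul_dir (mul_pos hr hs) ⟨by simp only [relArg]; linarith, by simp only [relArg]; linarith⟩

theorem Near.onRay_snd_iff {δ : ℝ} (hδ : δ ≤ Real.pi / 2) {p q : ℂ × ℂ} (hp : Near δ p)
    (hq : Near δ q) (h : OnRay p.1 q.1) : OnRay p.2 q.2 ↔ relArg p = relArg q := by
  rw [OnRay, ← arg_div_eq_zero_iff hp.snd_ne_zero hq.snd_ne_zero, hp.arg_div hδ hq h, sub_eq_zero,
    eq_comm]

/-- If the variables are on one ray, then so are the base points, if these form no small angle. -/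
theorem Near.onRay_fst {ε : ℝ} (hε0 : 0 < ε) (hε : ε ≤ Real.pi / 8) {p q : ℂ × ℂ}
    (hp : Near (ε / 4) p) (hq : Near (ε / 4) q) (h : OnRay p.2 q.2) (ha : Apart ε p.1 q.1) :
    OnRay p.1 q.1 := by
  rcases ha with ha | ha
  · exact (arg_div_eq_zero_iff hp.1 hq.1).1 ha
  exfalso
  obtain ⟨r, hr, h1⟩ := hp.div_eq hq
  obtain ⟨s, hs, h2⟩ := h
  rw [h2, mul_div_cancel_right₀ _ hp.snd_ne_zero] at h1
  have h3 : q.1 / p.1 = ((s / r : ℝ) : ℂ) * dir (relArg p - relArg q) := by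
    have h4 : dir (relArg p - relArg q) * dir (relArg q - relArg p) = 1 := by
      rw [← dir_add, sub_add_sub_cancel, sub_self, dir_zero]
    have h5 : (r : ℂ) ≠ 0 := by exact_mod_cast hr.ne'
    push_cast
    rw [h1]
    field_simp
    linear_combination (-(q.1 / p.1)) * h4
  have e1 := abs_lt.1 hp.2.2
  have e2 := abs_lt.1 hq.2.2
  have hpi := Real.pi_pos
  rw [h3, arg_pos_mul_dir (div_pos hs hr) ⟨by simp only [relArg]; linarith, by
    simp only [relArg]; linarith⟩] at ha
  have : |relArg p - relArg q| < 2 * ε := by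
    rw [abs_lt]
    constructor <;> simp only [relArg] <;> linarith
  linarith

theorem isChain_congr {α : Type*} {R S : α → α → Prop} {L : List α}
    (h : L.IsChain fun x y => (R x y ↔ S x y)) : L.IsChain R ↔ L.IsChain S := by
  induction L with
  | nil => simp
  | cons x L ih =>
    cases L with
    | nil => simp
    | cons y L =>
      rw [List.isChain_cons_cons] at h
      rw [List.isChain_cons_cons, List.isChain_cons_cons, h.1, ih h.2]

theorem isChain_map_of_flatten {α β : Type*} {R : α → α → Prop} {S : β → β → Prop} (σ : List α → β)
    {D : List (List α)} (hn : [] ∉ D)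
    (h : ∀ A ∈ D, ∀ B ∈ D, ∀ a ∈ A, ∀ b ∈ B, R a b → S (σ A) (σ B)) (hc : D.flatten.IsChain R) :
    (D.map σ).IsChain S := by
  induction D with
  | nil => simp
  | cons A D ih =>
    have hA : A ≠ [] := fun h => hn (by simp [h])
    rw [List.flatten_cons, List.isChain_append] at hc
    refine (ih (fun h => hn (by simp [h])) (fun B hB C hC => h B (by simp [hB]) C (by simp [hC]))
      hc.2.1).cons ?_
    intro y hy
    cases D with
    | nil => simp at hy
    | cons B D =>
      simp only [List.map_cons, List.head?_cons, Option.mem_some_iff] at hy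
      subst hy
      have hB : B ≠ [] := fun h => hn (by simp [h])
      refine h A (by simp) B (by simp) (A.getLast hA) (List.getLast_mem hA) (B.head hB)
        (List.head_mem hB) (hc.2.2 _ (List.getLast?_eq_getLast_of_ne_nil hA) _ ?_)
      rw [List.flatten_cons, List.head?_append_of_ne_nil _ hB]
      exact List.head?_eq_some_head hB

theorem isChain_flatten_of_map {α β : Type*} {R : α → α → Prop} {S : β → β → Prop} (σ : List α → β)
    {D : List (List α)} (hn : [] ∉ D) (hb : ∀ A ∈ D, A.IsChain R)
    (h : ∀ A ∈ D, ∀ B ∈ D, ∀ a ∈ A, ∀ b ∈ B, S (σ A) (σ B) → R a b) (hc : (D.map σ).IsChain S) :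
    D.flatten.IsChain R := by
  induction D with
  | nil => simp
  | cons A D ih =>
    have hA : A ≠ [] := fun h => hn (by simp [h])
    rw [List.map_cons] at hc
    rw [List.flatten_cons]
    refine (hb A (by simp)).append (ih (fun h => hn (by simp [h])) (fun B hB => hb B (by simp [hB]))
      (fun B hB C hC => h B (by simp [hB]) C (by simp [hC])) hc.tail) ?_
    intro x hx y hy
    cases D with
    | nil => simp at hy
    | cons B D =>
      have hB : B ≠ [] := fun h => hn (by simp [h])
      rw [List.flatten_cons, List.head?_append_of_ne_nil _ hB] at hy
      rw [List.map_cons, List.isChain_cons_cons] at hc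
      exact h A (by simp) B (by simp) x (List.mem_of_getLast? hx) y (List.mem_of_head? hy) hc.1

theorem forall_mem_of_isChain {α : Type*} {R : α → α → Prop} (hr : ∀ x, R x x)
    (hs : ∀ x y, R x y → R y x) (ht : ∀ x y z, R x y → R y z → R x z) {L : List α}
    (h : L.IsChain R) : ∀ x ∈ L, ∀ y ∈ L, R x y := by
  induction L with
  | nil => simp
  | cons a L ih =>
    have key : ∀ y ∈ a :: L, R a y := by
      cases L with
      | nil => simp [hr]
      | cons b L =>
        rw [List.isChain_cons_cons] at h
        intro y hy
        rcases List.mem_cons.1 hy with rfl | hy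
        · exact hr _
        · exact ht _ _ _ h.1 (ih h.2 b (by simp) y hy)
    intro x hx y hy
    exact ht _ _ _ (hs _ _ (key x hx)) (key y hy)

theorem blockTotal_map_blockTotal (C : List (List (ℂ × ℂ))) :
    blockTotal (C.map blockTotal) = blockTotal C.flatten := by
  simp [blockTotal, List.map_flatten, List.sum_flatten, Function.comp_def]

/-- Both entries of `p` are on the rays of the entries of `q`. -/
def OnRays (q p : ℂ × ℂ) : Prop := OnRay q.1 p.1 ∧ OnRay q.2 p.2

theorem onRays_blockTotal {A : List (ℂ × ℂ)} (h : ∀ x ∈ A, ∀ y ∈ A, OnRays x y) :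
    ∀ x ∈ A, OnRays x (blockTotal A) := by
  intro x hx
  have hA : A ≠ [] := List.ne_nil_of_mem hx
  constructor
  · refine OnRay.sum (by simpa using hA) fun y hy => ?_
    obtain ⟨q, hq, rfl⟩ := List.mem_map.1 hy
    exact (h x hx q hq).1
  · refine OnRay.sum (by simpa using hA) fun y hy => ?_
    obtain ⟨q, hq, rfl⟩ := List.mem_map.1 hy
    exact (h x hx q hq).2

theorem onRay_blockTotal_fst {A : List (ℂ × ℂ)} (h : ∀ x ∈ A, ∀ y ∈ A, OnRay x.1 y.1) :
    ∀ x ∈ A, OnRay x.1 (blockTotal A).1 := by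
  intro x hx
  have hA : A ≠ [] := List.ne_nil_of_mem hx
  refine OnRay.sum (by simpa using hA) fun y hy => ?_
  obtain ⟨q, hq, rfl⟩ := List.mem_map.1 hy
  exact h x hx q hq

theorem OnRay.ne_zero {x y : ℂ} (h : OnRay x y) (hx : x ≠ 0) : y ≠ 0 := by
  obtain ⟨r, hr, rfl⟩ := h
  exact mul_ne_zero (by exact_mod_cast hr.ne') hx

theorem OnRays.relArg_eq {p q : ℂ × ℂ} (h : OnRays q p) : relArg p = relArg q :=
  OnRay.arg_div h.1 h.2

theorem OnRays.near {δ : ℝ} {p q : ℂ × ℂ} (h : OnRays q p) (hq : Near δ q) : Near δ p := by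
  refine ⟨h.1.ne_zero hq.1, ?_, ?_⟩
  · obtain ⟨⟨r, hr, h1⟩, s, hs, h2⟩ := h
    have : p.2 / p.1 = ((s / r : ℝ) : ℂ) * (q.2 / q.1) := by
      rw [h1, h2]; push_cast; rw [mul_div_mul_comm]
    rw [this]
    exact hq.2.1.smul (div_pos hs hr)
  · have := h.relArg_eq
    rw [relArg, relArg] at this
    rw [this]; exact hq.2.2

open Classical in
/-- The weight of a block with aligned base points in the definition of the local functions. -/
noncomputable def alignWeight (A : List (ℂ × ℂ)) : ℂ :=
  if ∀ x ∈ A, ∀ y ∈ A, y.1 / x.1 ∈ posRay then ((expCoeff A.length : ℚ) : ℂ) else 0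

/-- The local function `G(z; w)`, for a list of pairs `(w_i, z_i)`. -/
noncomputable def localFun : List (ℂ × ℂ) → ℂ := blockOp blockTotal alignWeight upValue

open Classical in
/-- The sign of a block with aligned base points and increasing relative arguments. -/
noncomputable def upSign (C : List (ℂ × ℂ)) : ℂ :=
  if C.IsChain fun x y => Complex.arg (y.1 / x.1) = 0 ∧ relArg x < relArg y then
    (-1) ^ (C.length - 1) else 0

/-- A change of the base points: moving the rays of the `z_i` to those of the `w_i`. -/
theorem upValue_diag {ε : ℝ} (hε0 : 0 < ε) (hε : ε ≤ Real.pi / 8) {P : List (ℂ × ℂ)} (hP : P ≠ [])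
    (hnear : ∀ p ∈ P, Near (ε / 4) p) (hc : P.IsChain fun p q => Apart ε p.1 q.1) :
    upValue (P.map fun p => (p.2, p.2)) = blockOp blockTotal upSign upValue P := by
  have hpi := Real.pi_pos
  set δ := tolerance (P.map Prod.snd) with hδ
  have hδ0 : 0 < δ := tolerance_pos _
  set ε' := min (ε / 4) δ with hε'
  have hε'0 : 0 < ε' := lt_min (by linarith) hδ0
  have hε'1 : ε' ≤ ε / 4 := min_le_left _ _
  have hc2 : P.IsChain fun p q => (Apart ε p.1 q.1 ∧ Apart ε' p.2 q.2) := by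
    have h1 := isChain_apart_tolerance (P.map Prod.snd)
    rw [List.isChain_map] at h1
    have h2 : P.IsChain fun p q => Apart ε' p.2 q.2 :=
      h1.imp fun p q h => h.mono (min_le_right _ _)
    exact List.isChain_iff_getElem.2 fun i hi =>
      ⟨List.isChain_iff_getElem.1 hc i hi, List.isChain_iff_getElem.1 h2 i hi⟩
  -- `T` carries increasing tilts, small enough for both the `w_i` and the `z_i`.
  obtain ⟨hT1, hT2, hT3⟩ := spread_spec (ε := ε') 0 P le_rfl hε'0 hc2
  set T := spread ε' 0 P with hT
  have hTnear : ∀ t ∈ T, Near (ε / 4) (forgetTilt t) := by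
    intro t ht
    refine hnear _ ?_
    rw [← hT1]; exact List.mem_map_of_mem ht
  have hz : upValue (P.map fun p => (p.2, p.2)) =
      rayValue ((T.map fun t => (t.2.1, t.2.1, t.2.2)).map tiltPair) := by
    rw [rayValue_eq_upValue (ε := ε') (by linarith)]
    · congr 1
      rw [← hT1, List.map_map, List.map_map]
      rfl
    · intro x hx
      obtain ⟨t, ht, rfl⟩ := List.mem_map.1 hx
      have hne : t.2.1 ≠ 0 := (hTnear t ht).snd_ne_zero
      refine ⟨hne, ?_, ?_⟩
      · simp only [div_self hne]
        simp [Cone]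
      · simp only
        rw [abs_of_nonneg (hT2 t ht).1]
        exact (hT2 t ht).2
    · rw [List.isChain_map]
      exact hT3.imp fun x y h => h.1.2.imp (fun h' => ⟨h', h.2⟩) id
  -- The same rays, with the directions measured from the base points `w_i`.
  set Tw := T.map fun t => (t.1, t.2.1, t.2.2 - relArg (forgetTilt t)) with hTw
  have hw : rayValue ((T.map fun t => (t.2.1, t.2.1, t.2.2)).map tiltPair) =
      rayValue (Tw.map tiltPair) := by
    refine rayValue_sameRays ?_
    rw [hTw, List.map_map, List.map_map, SameRays, List.forall₂_map_left_iff,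
      List.forall₂_map_right_iff, List.forall₂_same]
    intro t ht
    obtain ⟨r, hr, h1⟩ := (hTnear t ht).snd_eq
    refine ⟨r⁻¹, inv_pos.2 hr, ?_⟩
    simp only [Function.comp_apply, tiltPair, Prod.mk.injEq, and_true]
    have h2 : dir t.2.2 = dir (t.2.2 - relArg (forgetTilt t)) * dir (relArg (forgetTilt t)) := by
      rw [← dir_add]; congr 1; ring
    have h3 := dir_ne_zero (relArg (forgetTilt t))
    have h4 : (r : ℂ) ≠ 0 := by exact_mod_cast hr.ne'
    have h5 : t.1 ≠ 0 := (hTnear t ht).1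
    have h6 : t.2.1 = r * (t.1 * dir (relArg (forgetTilt t))) := h1
    rw [h6, h2]
    push_cast
    field_simp
  -- For aligned base points, the tilts decrease exactly where the relative arguments increase; equal
  -- relative arguments leave the increasing tilts of `T`.
  have hord : T.IsChain fun x y => Complex.arg (y.1 / x.1) = 0 →
      (x.2.2 - relArg (forgetTilt x) ≠ y.2.2 - relArg (forgetTilt y)) ∧
      (y.2.2 - relArg (forgetTilt y) < x.2.2 - relArg (forgetTilt x) ↔
        relArg (forgetTilt x) < relArg (forgetTilt y)) := by
    refine List.IsChain.imp_of_mem_imp ?_ hT3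
    intro x y hx hy h h0
    have hnx := hTnear x hx
    have hny := hTnear y hy
    have h1 : Complex.arg (y.2.1 / x.2.1) = relArg (forgetTilt y) - relArg (forgetTilt x) :=
      hnx.arg_div (by linarith) hny ((arg_div_eq_zero_iff hnx.1 hny.1).1 h0)
    have h2 := hT2 x hx
    have h3 := hT2 y hy
    have h4 : Apart ε' x.2.1 y.2.1 := h.1.2
    rw [Apart, h1] at h4
    rcases h4 with h4 | h4
    · have h5 : relArg (forgetTilt y) = relArg (forgetTilt x) := by linarith
      rw [h5]
      exact ⟨by intro he; linarith [h.2], ⟨fun h => by linarith [h], fun h => absurd h (lt_irrefl _)⟩⟩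
    · rcases le_abs.1 h4 with h4 | h4
      · exact ⟨by intro he; linarith, ⟨fun _ => by linarith, fun _ => by linarith⟩⟩
      · exact ⟨by intro he; linarith, ⟨fun _ => by linarith, fun _ => by linarith⟩⟩
  have hforget : Tw.map forgetTilt = P := by
    rw [← hT1, hTw, List.map_map]; rfl
  have hcross : rayValue (Tw.map tiltPair) = blockOp tripleTotal downSign upValue Tw := by
    have hgood : ∀ p ∈ Tw, Good (ε / 2) p := by
      intro p hp
      obtain ⟨t, ht, rfl⟩ := List.mem_map.1 hp
      have hn := hTnear t ht
      refine ⟨hn.1, hn.2.1, ?_⟩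
      have e1 : |relArg (forgetTilt t)| < ε / 4 := hn.2.2
      have e2 := abs_lt.1 e1
      have e3 := hT2 t ht
      simp only
      rw [abs_lt]
      constructor <;> linarith
    have htil : Tw.IsChain (Tilted ε) := by
      rw [hTw, List.isChain_map]
      refine List.isChain_iff_getElem.2 fun i hi => ?_
      have h1 := List.isChain_iff_getElem.1 hord i hi
      have h2 := (List.isChain_iff_getElem.1 hT3 i hi).1.1
      rcases h2 with h2 | h2
      · exact Or.inl ⟨h2, (h1 h2).1⟩
      · exact Or.inr h2
    cases hTw' : Tw with
    | nil =>
      exfalso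
      rw [hTw'] at hforget
      exact hP hforget.symm
    | cons x l =>
      rw [hTw'] at hgood htil
      have := rayValue_eq_blockOp hε0 hε l.length [] x l rfl (by simp) hgood
        (List.isChain_singleton x) htil
      simpa using this
  rw [hz, hw, hcross, ← hforget, blockOp_map forgetTilt blockTotal upSign upValue Tw]
  refine blockOp_congr (R := ℂ) fun D hD _ => ?_
  congr 2
  refine List.map_congr_left fun C hC => ?_
  have hCT : C <:+: Tw := hD ▸ List.infix_of_mem_flatten hC
  rw [downSign, upSign, List.length_map]
  have : Tw.IsChain fun x y => (Complex.arg (y.1 / x.1) = 0 ∧ y.2.2 < x.2.2 ↔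
      Complex.arg ((forgetTilt y).1 / (forgetTilt x).1) = 0 ∧
        relArg (forgetTilt x) < relArg (forgetTilt y)) := by
    rw [hTw, List.isChain_map]
    refine hord.imp fun x y h => ?_
    simp only [forgetTilt] at h ⊢
    exact and_congr_right fun h0 => (h h0).2
  have h2 : C.IsChain (fun x y => Complex.arg (y.1 / x.1) = 0 ∧ y.2.2 < x.2.2) ↔
      (C.map forgetTilt).IsChain fun x y => Complex.arg (y.1 / x.1) = 0 ∧ relArg x < relArg y := by
    rw [List.isChain_map]
    exact isChain_congr (this.infix hCT)
  split_ifs with c1 c2 c2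
  · rfl
  · exact absurd (h2.1 c1) c2
  · exact absurd (h2.2 c2) c1
  · rfl

/-- A block whose variables are aligned has aligned base points. -/
theorem onRays_of_onRay_snd {ε : ℝ} (hε0 : 0 < ε) (hε : ε ≤ Real.pi / 8) {A : List (ℂ × ℂ)}
    (hnear : ∀ p ∈ A, Near (ε / 4) p) (hc : A.IsChain fun p q => Apart ε p.1 q.1)
    (h : ∀ x ∈ A, ∀ y ∈ A, OnRay x.2 y.2) : ∀ x ∈ A, ∀ y ∈ A, OnRays x y := by
  have h1 : A.IsChain fun p q => OnRay p.1 q.1 :=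
    List.IsChain.imp_of_mem_imp (fun p q hp hq hpq =>
      (hnear p hp).onRay_fst hε0 hε (hnear q hq) (h p hp q hq) hpq) hc
  have h2 := forall_mem_of_isChain (R := fun p q : ℂ × ℂ => OnRay p.1 q.1) (fun x => OnRay.refl _)
    (fun _ _ h => h.symm) (fun _ _ _ h h' => h.trans h') h1
  exact fun x hx y hy => ⟨h2 x hx y hy, h x hx y hy⟩

theorem prod_eq_zero_of_mem {α : Type*} {κ : α → ℂ} {D : List α} {A : α} (hA : A ∈ D)
    (h : κ A = 0) : (D.map κ).prod = 0 :=
  List.prod_eq_zero (List.mem_map.2 ⟨A, hA, h⟩)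

theorem alignWeight_of_onRay {A : List (ℂ × ℂ)} (hne : ∀ x ∈ A, x.1 ≠ 0)
    (h : ∀ x ∈ A, ∀ y ∈ A, OnRay x.1 y.1) : alignWeight A = (expCoeff A.length : ℚ) :=
  if_pos fun x hx y hy => (div_mem_posRay_iff (hne x hx)).2 (h x hx y hy)

theorem alignWeight_of_not {A : List (ℂ × ℂ)} (hne : ∀ x ∈ A, x.1 ≠ 0)
    (h : ¬ ∀ x ∈ A, ∀ y ∈ A, OnRay x.1 y.1) : alignWeight A = 0 :=
  if_neg fun h' => h fun x hx y hy => (div_mem_posRay_iff (hne x hx)).1 (h' x hx y hy)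

/-- The weights of a block of aligned base points on both sides of the transformation formula. -/
theorem blockOp_alignWeight_upSign {ε : ℝ} (hε0 : 0 < ε) (hε : ε ≤ Real.pi / 8) {A : List (ℂ × ℂ)}
    (hA : A ≠ []) (hnear : ∀ p ∈ A, Near (ε / 4) p)
    (hc : A.IsChain fun p q => Apart ε p.1 q.1) :
    blockOp blockTotal (fun B => alignWeight (B.map fun p => (p.2, p.2))) upSign A =
      blockOp blockTotal blockCoeff alignWeight A := by
  have hpi := Real.pi_pos
  have hne1 : ∀ p ∈ A, p.1 ≠ 0 := fun p hp => (hnear p hp).1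
  have hne2 : ∀ p ∈ A, p.2 ≠ 0 := fun p hp => (hnear p hp).snd_ne_zero
  have hsub : ∀ {D : List (List (ℂ × ℂ))}, D.flatten = A → ∀ B ∈ D, ∀ x ∈ B, x ∈ A := by
    intro D hD B hB x hx
    rw [← hD]; exact List.mem_flatten.2 ⟨B, hB, hx⟩
  have hkz : ∀ B : List (ℂ × ℂ), (∀ x ∈ B, x ∈ A) → (∀ x ∈ B, ∀ y ∈ B, OnRay x.2 y.2) →
      alignWeight (B.map fun p => (p.2, p.2)) = (expCoeff B.length : ℚ) := by
    intro B hB h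
    rw [alignWeight_of_onRay, List.length_map]
    · intro x hx
      obtain ⟨q, hq, rfl⟩ := List.mem_map.1 hx
      exact hne2 _ (hB _ hq)
    · intro x hx y hy
      obtain ⟨q, hq, rfl⟩ := List.mem_map.1 hx
      obtain ⟨r, hr, rfl⟩ := List.mem_map.1 hy
      exact h _ hq _ hr
  have hkz' : ∀ B : List (ℂ × ℂ), (∀ x ∈ B, x ∈ A) → ¬ (∀ x ∈ B, ∀ y ∈ B, OnRay x.2 y.2) →
      alignWeight (B.map fun p => (p.2, p.2)) = 0 := by
    intro B hB h
    apply alignWeight_of_not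
    · intro x hx
      obtain ⟨q, hq, rfl⟩ := List.mem_map.1 hx
      exact hne2 _ (hB _ hq)
    · intro h'
      apply h
      intro x hx y hy
      exact h' _ (List.mem_map_of_mem hx) _ (List.mem_map_of_mem hy)
  by_cases hal : ∀ x ∈ A, ∀ y ∈ A, OnRay x.1 y.1
  · -- All base points are aligned: both sides only depend on the relative arguments.
    have hθ : A.map relArg ≠ [] := by simpa using hA
    have key := congrArg (fun q : ℚ => (q : ℂ)) (blockOp_listCoeff hθ)
    have e1 := map_blockOp (Rat.castHom ℂ) headVal (constWeight expCoeff)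
      (fun M => (-1) ^ (M.length - 1) * chainWeight (· < ·) M) (A.map relArg)
    have e2 := map_blockOp (Rat.castHom ℂ) headVal listCoeff
      (fun M => expCoeff M.length) (A.map relArg)
    simp only [Rat.coe_castHom] at e1 e2
    rw [e1, e2, blockOp_map, blockOp_map] at key
    have hconst : ∀ B : List (ℂ × ℂ), (∀ x ∈ B, x ∈ A) → ((∀ x ∈ B, ∀ y ∈ B, OnRay x.2 y.2) ↔
        ∀ x ∈ B.map relArg, ∀ y ∈ B.map relArg, x = y) := by
      intro B hB
      have : ∀ x ∈ B, ∀ y ∈ B, (OnRay x.2 y.2 ↔ relArg x = relArg y) := fun x hx y hy =>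
        (hnear x (hB x hx)).onRay_snd_iff (by linarith) (hnear y (hB y hy)) (hal x (hB x hx) y (hB y hy))
      simp only [List.mem_map, forall_exists_index, and_imp, forall_apply_eq_imp_iff₂]
      exact forall₂_congr fun x hx => forall₂_congr fun y hy => this x hx y hy
    have htot : ∀ {D : List (List (ℂ × ℂ))}, D.flatten = A → [] ∉ D →
        ∀ B ∈ D, ∀ x ∈ B, OnRay x.1 (blockTotal B).1 := by
      intro D hD _ B hB
      exact onRay_blockTotal_fst fun x hx y hy => hal x (hsub hD B hB x hx) y (hsub hD B hB y hy)
    have htot2 : ∀ {D : List (List (ℂ × ℂ))}, D.flatten = A → [] ∉ D → ∀ B ∈ D, ∀ C ∈ D,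
        OnRay (blockTotal B).1 (blockTotal C).1 ∧ (blockTotal B).1 ≠ 0 := by
      intro D hD hn B hB C hC
      obtain ⟨b, hb⟩ := List.exists_mem_of_ne_nil B fun h => hn (h ▸ hB)
      obtain ⟨c, hc⟩ := List.exists_mem_of_ne_nil C fun h => hn (h ▸ hC)
      have h1 := htot hD hn B hB b hb
      have h2 := htot hD hn C hC c hc
      exact ⟨h1.symm.trans ((hal b (hsub hD B hB b hb) c (hsub hD C hC c hc)).trans h2),
        h1.ne_zero (hne1 b (hsub hD B hB b hb))⟩
    have hL : blockOp blockTotal (fun B => alignWeight (B.map fun p => (p.2, p.2))) upSign A =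
        blockOp (fun B => headVal (B.map relArg))
          (fun B => ((constWeight expCoeff (B.map relArg) : ℚ) : ℂ))
          (fun M => (((-1) ^ (M.length - 1) * chainWeight (· < ·) M : ℚ) : ℂ)) A := by
      refine blockOp_congr fun D hD hn => ?_
      by_cases hD2 : ∀ B ∈ D, ∀ x ∈ B, ∀ y ∈ B, OnRay x.2 y.2
      · congr 1
        · congr 1
          refine List.map_congr_left fun B hB => ?_
          rw [hkz B (hsub hD B hB) (hD2 B hB), constWeight,
            if_pos ((hconst B (hsub hD B hB)).1 (hD2 B hB)), List.length_map]
        · have hrel : ∀ B ∈ D, relArg (blockTotal B) = headVal (B.map relArg) := by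
            intro B hB
            obtain ⟨b, B', rfl⟩ := List.exists_cons_of_ne_nil (l := B) fun h => hn (h ▸ hB)
            have h1 := onRays_blockTotal (A := b :: B') (fun x hx y hy =>
              ⟨hal x (hsub hD _ hB x hx) y (hsub hD _ hB y hy), hD2 _ hB x hx y hy⟩) b (by simp)
            rw [h1.relArg_eq]
            simp [headVal]
          have hiff : (D.map blockTotal).IsChain
              (fun x y => Complex.arg (y.1 / x.1) = 0 ∧ relArg x < relArg y) ↔
              (D.map fun B => headVal (B.map relArg)).IsChain (· < ·) := by
            rw [List.isChain_map, List.isChain_map]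
            refine List.IsChain.iff_of_mem_imp fun B C hB hC => ?_
            have h1 := htot2 hD hn B hB C hC
            rw [hrel B hB, hrel C hC, and_iff_right]
            exact (arg_div_eq_zero_iff h1.2 (h1.1.ne_zero h1.2)).2 h1.1
          rw [upSign, chainWeight, List.length_map, List.length_map]
          split_ifs with c1 c2 c2
          · simp
          · exact absurd (hiff.1 c1) c2
          · exact absurd (hiff.2 c2) c1
          · simp
      · push Not at hD2
        obtain ⟨B, hB, hx⟩ := hD2
        have hnot : ¬ ∀ x ∈ B, ∀ y ∈ B, OnRay x.2 y.2 := by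
          push Not; exact hx
        rw [prod_eq_zero_of_mem hB (hkz' B (hsub hD B hB) hnot), zero_mul,
          prod_eq_zero_of_mem hB, zero_mul]
        rw [constWeight, if_neg fun h => hnot ((hconst B (hsub hD B hB)).2 h), Rat.cast_zero]
    have hR : blockOp blockTotal blockCoeff alignWeight A =
        blockOp (fun B => headVal (B.map relArg)) (fun B => ((listCoeff (B.map relArg) : ℚ) : ℂ))
          (fun M => ((expCoeff M.length : ℚ) : ℂ)) A := by
      refine blockOp_congr fun D hD hn => ?_
      congr 1
      · congr 1
        refine List.map_congr_left fun B hB => ?_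
        rw [blockCoeff, if_pos]
        · rfl
        · exact fun x hx y hy => (div_mem_posRay_iff (hne1 x (hsub hD B hB x hx))).2
            (hal x (hsub hD B hB x hx) y (hsub hD B hB y hy))
      · rw [alignWeight_of_onRay, List.length_map, List.length_map]
        · intro x hx
          obtain ⟨B, hB, rfl⟩ := List.mem_map.1 hx
          exact (htot2 hD hn B hB B hB).2
        · intro x hx y hy
          obtain ⟨B, hB, rfl⟩ := List.mem_map.1 hx
          obtain ⟨C, hC, rfl⟩ := List.mem_map.1 hy
          exact (htot2 hD hn B hB C hC).1
    rw [hL, hR]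
    exact key
  · -- Otherwise every term of both sides vanishes.
    have hchain : ∀ {D : List (List (ℂ × ℂ))}, D.flatten = A → [] ∉ D →
        (∀ B ∈ D, ∀ x ∈ B, ∀ y ∈ B, OnRay x.1 y.1) →
        ¬ (D.map blockTotal).IsChain fun x y => OnRay x.1 y.1 := by
      intro D hD hn hB h
      apply hal
      have h1 := isChain_flatten_of_map (R := fun x y : ℂ × ℂ => OnRay x.1 y.1) blockTotal hn
        (fun B hB' => List.isChain_iff_getElem.2 fun i hi =>
          hB B hB' _ (List.getElem_mem _) _ (List.getElem_mem _))
        (fun B hB' C hC b hb c hc h => (onRay_blockTotal_fst (hB B hB') b hb).trans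
          (h.trans (onRay_blockTotal_fst (hB C hC) c hc).symm)) h
      rw [hD] at h1
      exact forall_mem_of_isChain (R := fun p q : ℂ × ℂ => OnRay p.1 q.1) (fun x => OnRay.refl _)
        (fun _ _ h => h.symm) (fun _ _ _ h h' => h.trans h') h1
    have hzero : ∀ (σ : List (ℂ × ℂ) → ℂ × ℂ) (κ : List (ℂ × ℂ) → ℂ) (Φ : List (ℂ × ℂ) → ℂ),
        (∀ D : List (List (ℂ × ℂ)), D.flatten = A → [] ∉ D → (D.map κ).prod * Φ (D.map σ) = 0) →
        blockOp σ κ Φ A = 0 := by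
      intro σ κ Φ h
      rw [blockOp, ← splitSum_zero A]
      exact splitSum_congr h
    have hne3 : ∀ {D : List (List (ℂ × ℂ))}, D.flatten = A → [] ∉ D →
        (∀ B ∈ D, ∀ x ∈ B, ∀ y ∈ B, OnRay x.1 y.1) → ∀ B ∈ D, (blockTotal B).1 ≠ 0 := by
      intro D hD hn h B hB
      obtain ⟨b, hb⟩ := List.exists_mem_of_ne_nil B fun h => hn (h ▸ hB)
      exact (onRay_blockTotal_fst (h B hB) b hb).ne_zero (hne1 b (hsub hD B hB b hb))
    rw [hzero, hzero]
    · intro D hD hn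
      by_cases hB : ∀ B ∈ D, ∀ x ∈ B, ∀ y ∈ B, OnRay x.1 y.1
      · rw [alignWeight_of_not, mul_zero]
        · intro x hx
          obtain ⟨B, hB', rfl⟩ := List.mem_map.1 hx
          exact hne3 hD hn hB B hB'
        · intro h
          exact hchain hD hn hB (List.isChain_iff_getElem.2 fun i hi =>
            h _ (List.getElem_mem _) _ (List.getElem_mem _))
      · push Not at hB
        obtain ⟨B, hB, x, hx, y, hy, hxy⟩ := hB
        rw [prod_eq_zero_of_mem hB, zero_mul]
        rw [blockCoeff, if_neg]
        exact fun h => hxy ((div_mem_posRay_iff (hne1 x (hsub hD B hB x hx))).1 (h x hx y hy))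
    · intro D hD hn
      by_cases hB : ∀ B ∈ D, ∀ x ∈ B, ∀ y ∈ B, OnRay x.2 y.2
      · have hB1 : ∀ B ∈ D, ∀ x ∈ B, ∀ y ∈ B, OnRay x.1 y.1 := by
          intro B hB' x hx y hy
          exact (onRays_of_onRay_snd hε0 hε (fun p hp => hnear p (hsub hD B hB' p hp))
            (hc.infix (hD ▸ List.infix_of_mem_flatten hB')) (hB B hB') x hx y hy).1
        rw [upSign, if_neg, mul_zero]
        intro h
        refine hchain hD hn hB1 ?_
        refine List.IsChain.imp_of_mem_imp ?_ h
        intro x y hx hy hxy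
        obtain ⟨B, hB', rfl⟩ := List.mem_map.1 hx
        obtain ⟨C, hC', rfl⟩ := List.mem_map.1 hy
        exact (arg_div_eq_zero_iff (hne3 hD hn hB1 B hB') (hne3 hD hn hB1 C hC')).1 hxy.1
      · push Not at hB
        obtain ⟨B, hB, x, hx, y, hy, hxy⟩ := hB
        rw [prod_eq_zero_of_mem hB (hkz' B (hsub hD B hB) fun h => hxy (h x hx y hy)), zero_mul]

/-- The transformation formula for lists. -/
theorem localFun_diag {ε : ℝ} (hε0 : 0 < ε) (hε : ε ≤ Real.pi / 8) {L : List (ℂ × ℂ)}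
    (hL : L ≠ []) (hnear : ∀ p ∈ L, Near (ε / 4) p) (hc : L.IsChain fun p q => Apart ε p.1 q.1) :
    localFun (L.map fun p => (p.2, p.2)) = blockOp blockTotal blockCoeff localFun L := by
  have hsub : ∀ {D : List (List (ℂ × ℂ))}, D.flatten = L → ∀ B ∈ D, ∀ x ∈ B, x ∈ L := by
    intro D hD B hB x hx
    rw [← hD]; exact List.mem_flatten.2 ⟨B, hB, hx⟩
  have h1 : localFun (L.map fun p => (p.2, p.2)) =
      blockOp blockTotal (fun B => alignWeight (B.map fun p => (p.2, p.2)))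
        (blockOp blockTotal upSign upValue) L := by
    rw [localFun, blockOp_map]
    refine blockOp_congr (R := ℂ) fun D hD hn => ?_
    -- Only blocks with aligned variables contribute; their base points are then aligned as well.
    by_cases hB : ∀ B ∈ D, ∀ x ∈ B, ∀ y ∈ B, OnRay x.2 y.2
    · congr 1
      have hrays : ∀ B ∈ D, ∀ x ∈ B, OnRays x (blockTotal B) := fun B hB' =>
        onRays_blockTotal (onRays_of_onRay_snd hε0 hε (fun p hp => hnear p (hsub hD B hB' p hp))
          (hc.infix (hD ▸ List.infix_of_mem_flatten hB')) (hB B hB'))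
      rw [← upValue_diag hε0 hε]
      · congr 1
        rw [List.map_map]
        refine List.map_congr_left fun B _ => ?_
        simp [blockTotal, Function.comp_def]
      · rintro h
        rw [List.map_eq_nil_iff] at h
        subst h
        exact hL hD.symm
      · intro p hp
        obtain ⟨B, hB', rfl⟩ := List.mem_map.1 hp
        obtain ⟨b, hb⟩ := List.exists_mem_of_ne_nil B fun h => hn (h ▸ hB')
        exact (hrays B hB' b hb).near (hnear b (hsub hD B hB' b hb))
      · refine isChain_map_of_flatten (R := fun p q : ℂ × ℂ => Apart ε p.1 q.1) blockTotal hn ?_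
          (hD ▸ hc)
        intro B hB' C hC b hb c hc h
        simp only [Apart] at h ⊢
        rwa [(hrays B hB' b hb).1.arg_div (hrays C hC c hc).1]
    · push Not at hB
      obtain ⟨B, hB, x, hx, y, hy, hxy⟩ := hB
      have h0 : alignWeight (B.map fun p => (p.2, p.2)) = 0 := by
        apply alignWeight_of_not
        · intro x hx
          obtain ⟨q, hq, rfl⟩ := List.mem_map.1 hx
          exact (hnear _ (hsub hD B hB _ hq)).snd_ne_zero
        · exact fun h' => hxy (h' _ (List.mem_map_of_mem hx) _ (List.mem_map_of_mem hy))
      rw [prod_eq_zero_of_mem hB h0, zero_mul, zero_mul]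
  have hassoc : ∀ C : List (List (ℂ × ℂ)), C ≠ [] → C.flatten <:+: L → [] ∉ C →
      blockTotal (C.map blockTotal) = blockTotal C.flatten := fun C _ _ _ =>
    blockTotal_map_blockTotal C
  rw [h1, blockOp_blockOp _ _ _ _ _ _ _ hassoc]
  have h2 : blockOp blockTotal blockCoeff localFun L =
      blockOp blockTotal (blockOp blockTotal blockCoeff alignWeight) upValue L :=
    blockOp_blockOp _ _ _ _ _ _ _ hassoc
  rw [h2]
  refine blockOp_congr (R := ℂ) fun D hD hn => ?_
  congr 2
  refine List.map_congr_left fun B hB => ?_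
  exact blockOp_alignWeight_upSign hε0 hε (fun h => hn (h ▸ hB))
    (fun p hp => hnear p (hsub hD B hB p hp)) (hc.infix (hD ▸ List.infix_of_mem_flatten hB))

/-! ### The extended functions and the local functions -/

theorem onRay_blockSum {n : ℕ} {w : Fin n → ℂ} (hw : w ∈ puncturedSpace n) {c : Composition n}
    (hc : Aligned c w) (k : Fin c.length) (j : Fin (c.blocksFun k)) :
    OnRay (w (c.embedding k j)) (blockSum c w k) := by
  have h := (index_eq_index_iff c fun a b => w b / w a ∈ posRay).1 hc k j
  rw [blockSum, ← List.sum_ofFn]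
  refine OnRay.sum ?_ fun y hy => ?_
  · have := c.one_le_blocksFun k
    intro h0
    have h1 := congrArg List.length h0
    simp at h1
    omega
  · obtain ⟨i, rfl⟩ := (List.mem_ofFn' _ _).1 hy
    exact (div_mem_posRay_iff (hw _)).1 (h i)

theorem blockSum_mem_puncturedSpace {n : ℕ} {w : Fin n → ℂ} (hw : w ∈ puncturedSpace n)
    {c : Composition n} (hc : Aligned c w) : blockSum c w ∈ puncturedSpace c.length := fun k =>
  (onRay_blockSum hw hc k ⟨0, c.one_le_blocksFun k⟩).ne_zero (hw _)

theorem continuous_blockSum {n : ℕ} (c : Composition n) : Continuous (blockSum c) := by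
  unfold blockSum
  fun_prop

/-- Sums over an aligned block stay in the sector. -/
theorem cone_blockSum {n : ℕ} {w z : Fin n → ℂ} (hw : w ∈ puncturedSpace n)
    (hz : ∀ i, Cone (z i / w i)) {c : Composition n} (hc : Aligned c w) (k : Fin c.length) :
    Cone (blockSum c z k / blockSum c w k) := by
  have h1 : blockSum c z k / blockSum c w k =
      (List.ofFn fun j => z (c.embedding k j) / blockSum c w k).sum := by
    rw [List.sum_ofFn, blockSum, Finset.sum_div]
  rw [h1]
  have h2 : ∀ ζ ∈ List.ofFn fun j => z (c.embedding k j) / blockSum c w k, Cone ζ := by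
    intro ζ hζ
    obtain ⟨j, rfl⟩ := (List.mem_ofFn' _ _).1 hζ
    obtain ⟨r, hr, h⟩ := onRay_blockSum hw hc k j
    have : z (c.embedding k j) / blockSum c w k =
        ((r⁻¹ : ℝ) : ℂ) * (z (c.embedding k j) / w (c.embedding k j)) := by
      rw [h, Complex.ofReal_inv, mul_comm (r : ℂ), ← div_div]; ring
    simp only [this]
    exact (hz _).smul (inv_pos.2 hr)
  have h3 : (List.ofFn fun j => z (c.embedding k j) / blockSum c w k) ≠ [] := by
    have := c.one_le_blocksFun k
    intro h0
    have h1 := congrArg List.length h0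
    simp at h1
    omega
  generalize (List.ofFn fun j => z (c.embedding k j) / blockSum c w k) = A at h2 h3
  induction A with
  | nil => exact absurd rfl h3
  | cons a A ih =>
    rcases eq_or_ne A [] with rfl | hA
    · simpa using h2 a (by simp)
    · rw [List.sum_cons]
      exact (h2 a (by simp)).add (ih (fun ζ hζ => h2 ζ (by simp [hζ])) hA)

/-- The extensions of the functions `F_n` to all of `(ℂ^×)^n`: the values `G_n(z; z)`. -/
noncomputable def extFamily : Family := fun _ z => localFun (List.ofFn fun i => (z i, z i))

/-- The local functions `G_m(x; u)`. -/
noncomputable def localFamily (m : ℕ) (u x : Fin m → ℂ) : ℂ :=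
  localFun (List.ofFn fun i => (u i, x i))

/-- The neighbourhood of `w` on which the transformation formula holds: the angles between `z_i` and
`w_i` are small compared to those between neighbouring rays of `w`. -/
def sector (n : ℕ) (w : Fin n → ℂ) : Set (Fin n → ℂ) :=
  {z | ∀ i, Near (tolerance (List.ofFn w) / 4) (w i, z i)}

theorem isOpen_cone : IsOpen {ζ : ℂ | Cone ζ} :=
  isOpen_lt (Complex.continuous_im.abs) Complex.continuous_re

theorem Cone.re_pos {ζ : ℂ} (h : Cone ζ) : 0 < ζ.re := (abs_nonneg _).trans_lt h

theorem isOpen_sector {n : ℕ} {w : Fin n → ℂ} (hw : w ∈ puncturedSpace n) :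
    IsOpen (sector n w) := by
  have h1 : sector n w = ⋂ i, (fun z : Fin n → ℂ => z i / w i) ⁻¹'
      ({ζ | Cone ζ} ∩ (fun ζ => |Complex.arg ζ|) ⁻¹' Iio (tolerance (List.ofFn w) / 4)) := by
    ext z
    simp only [sector, Near, mem_iInter]
    exact forall_congr' fun i => and_iff_right (hw i)
  rw [h1]
  refine isOpen_iInter_of_finite fun i => ?_
  refine IsOpen.preimage (by fun_prop) ?_
  refine ContinuousOn.isOpen_inter_preimage ?_ isOpen_cone isOpen_Iio
  intro ζ hζ
  exact ((Complex.continuousAt_arg (Or.inl (Cone.re_pos hζ))).abs).continuousWithinAt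

theorem mem_sector_self {n : ℕ} {w : Fin n → ℂ} (hw : w ∈ puncturedSpace n) : w ∈ sector n w := by
  intro i
  have h := tolerance_pos (List.ofFn w)
  refine ⟨hw i, ?_, ?_⟩
  · simp only [div_self (hw i)]
    simp [Cone]
  · simp only [div_self (hw i)]
    simp
    exact h

theorem extFamily_eq_transformSum {n : ℕ} (hn : 1 ≤ n) {w z : Fin n → ℂ} (hz : z ∈ sector n w) :
    extFamily n z = transformSum localFamily n w z := by
  rw [transformSum_eq_blockOp localFamily localFun (fun _ _ _ => rfl), extFamily,
    ← localFun_diag (ε := tolerance (List.ofFn w)) (tolerance_pos _) (tolerance_le _)]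
  · simp [List.map_ofFn, Function.comp_def]
  · intro h
    have := congrArg List.length h
    simp at this
    omega
  · intro p hp
    obtain ⟨i, rfl⟩ := (List.mem_ofFn' _ _).1 hp
    exact hz i
  · have := isChain_apart_tolerance (List.ofFn w)
    have h2 : List.ofFn w = (List.ofFn fun i => (w i, z i)).map Prod.fst := by
      simp [List.map_ofFn, Function.comp_def]
    rw [h2, List.isChain_map, ← h2] at this
    exact this

theorem differentiableAt_rayValue {Y : Type} [NormedAddCommGroup Y] [NormedSpace ℂ Y]
    [FiniteDimensional ℂ Y] {L : List (ℂ × (Y → ℂ))} {y : Y} (hL : ∀ q ∈ L, Differentiable ℂ q.2)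
    (h : AdmissibleList (L.map fun q => (q.1, q.2 y))) :
    DifferentiableAt ℂ (fun y => rayValue (L.map fun q => (q.1, q.2 y))) y := by
  have h1 : ∀ y, (L.map fun q => (q.1, q.2 y)) =
      evalList (L.map fun q => ((fun _ => q.1 : Y → ℂ), q.2)) y := by
    intro y
    simp [evalList, Function.comp_def]
  have h2 : DifferentiableAt ℂ (fun y => rayIter (L.map fun q => (q.1, q.2 y))) y := by
    simp only [h1]
    refine differentiableAt_rayIter ?_ (by rw [← h1]; exact h)
    intro q hq
    obtain ⟨p, hp, rfl⟩ := List.mem_map.1 hq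
    exact ⟨differentiable_const _, hL p hp⟩
  have h3 : DifferentiableAt ℂ (fun y => ((L.map fun q => (q.1, q.2 y)).map Prod.snd).sum) y := by
    clear h h1 h2
    induction L with
    | nil => simp
    | cons q L ih =>
      simp only [List.map_cons, List.sum_cons]
      exact (hL q (by simp) y).add (ih fun p hp => hL p (by simp [hp]))
  simp only [rayValue, List.length_map, div_eq_mul_inv]
  exact (h3.fun_mul h2).mul_const _

theorem spread_map {ι : Type*} (ε a : ℝ) (L : List ι) (u : ι → ℂ) :
    ∃ S : List (ι × ℝ), S.map Prod.fst = L ∧ ∀ x : ι → ℂ,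
      spread ε a (L.map fun i => (u i, x i)) = S.map fun s => (u s.1, x s.1, s.2) := by
  induction L generalizing a with
  | nil => exact ⟨[], rfl, fun _ => rfl⟩
  | cons i L ih =>
    obtain ⟨S, h1, h2⟩ := ih ((a + ε) / 2)
    exact ⟨(i, a) :: S, by simp [h1], fun x => by simp [spread, h2]⟩

theorem spread_good {L : List (ℂ × ℂ)} (hL : ∀ q ∈ L, q.1 ≠ 0 ∧ Cone (q.2 / q.1)) :
    AdmissibleList ((spread (tolerance (L.map Prod.fst)) 0 L).map tiltPair) := by
  have hc := isChain_apart_tolerance (L.map Prod.fst)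
  rw [List.isChain_map] at hc
  obtain ⟨h1, h2, h3⟩ := spread_spec (ε := tolerance (L.map Prod.fst)) 0 L le_rfl (tolerance_pos _) hc
  refine admissibleList_tilt (tolerance_le (L.map Prod.fst)) ?_ ?_
  · intro x hx
    have hxL : forgetTilt x ∈ L := by
      rw [← h1]; exact List.mem_map_of_mem hx
    refine ⟨(hL _ hxL).1, (hL _ hxL).2, ?_⟩
    rw [abs_of_nonneg (h2 x hx).1]
    exact (h2 x hx).2
  · exact h3.imp fun x y h => h.1.imp (fun h' => ⟨h', h.2.ne⟩) id

/-- `upValue` is holomorphic in the variables. -/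
theorem differentiableAt_upValue {n m : ℕ} (u : Fin m → ℂ) (x : (Fin n → ℂ) → Fin m → ℂ)
    (hx : Differentiable ℂ x) {z : Fin n → ℂ} (h : ∀ k, u k ≠ 0 ∧ Cone (x z k / u k)) :
    DifferentiableAt ℂ (fun z => upValue (List.ofFn fun k => (u k, x z k))) z := by
  obtain ⟨S, hS1, hS2⟩ := spread_map (tolerance (List.ofFn u)) 0 (List.finRange m) u
  have h1 : ∀ z, upValue (List.ofFn fun k => (u k, x z k)) =
      rayValue ((S.map fun s => ((u s.1)⁻¹ * dir s.2, fun z => x z s.1)).map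
        fun q => (q.1, q.2 z)) := by
    intro z
    have h2 : (List.ofFn fun k => (u k, x z k)) = (List.finRange m).map fun k => (u k, x z k) :=
      List.ofFn_eq_map
    have h3 : (List.ofFn fun k => (u k, x z k)).map Prod.fst = List.ofFn u := by
      simp [List.map_ofFn, Function.comp_def]
    rw [upValue, h3, h2, hS2, List.map_map, List.map_map]
    rfl
  simp only [h1]
  refine differentiableAt_rayValue ?_ ?_
  · intro q hq
    obtain ⟨s, _, rfl⟩ := List.mem_map.1 hq
    exact (differentiable_pi.1 hx) s.1
  · have h4 := spread_good (L := List.ofFn fun k => (u k, x z k)) (by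
      intro q hq
      obtain ⟨k, rfl⟩ := (List.mem_ofFn' _ _).1 hq
      exact h k)
    have h2 : (List.ofFn fun k => (u k, x z k)) = (List.finRange m).map fun k => (u k, x z k) :=
      List.ofFn_eq_map
    have h3 : (List.ofFn fun k => (u k, x z k)).map Prod.fst = List.ofFn u := by
      simp [List.map_ofFn, Function.comp_def]
    rw [h3, h2, hS2, List.map_map] at h4
    rw [List.map_map]
    exact h4

theorem differentiableAt_localFamily {m : ℕ} {u x : Fin m → ℂ} (hu : u ∈ puncturedSpace m)
    (hx : ∀ i, Cone (x i / u i)) : DifferentiableAt ℂ (localFamily m u) x := by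
  have h1 : localFamily m u = fun x => ∑ c : Composition m,
      ((List.ofFn fun k => List.ofFn fun j => (u (c.embedding k j), x (c.embedding k j))).map
        alignWeight).prod *
      upValue (List.ofFn fun k => (blockSum c u k, blockSum c x k)) := by
    funext x
    rw [localFamily, localFun, blockOp, ← sum_composition_ofFn]
    refine Finset.sum_congr rfl fun c _ => ?_
    congr 2
    rw [List.map_ofFn]
    congr 1
    funext k
    simp [blockTotal, blockSum, List.map_ofFn, List.sum_ofFn, Function.comp_def]
  rw [h1]
  refine DifferentiableAt.fun_sum fun c _ => ?_
  by_cases hc : Aligned c u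
  · have h2 : ∀ x : Fin m → ℂ, ((List.ofFn fun k => List.ofFn fun j =>
        (u (c.embedding k j), x (c.embedding k j))).map alignWeight).prod =
        ∏ k : Fin c.length, ((expCoeff (c.blocksFun k) : ℚ) : ℂ) := by
      intro x
      rw [List.map_ofFn, List.prod_ofFn]
      refine Finset.prod_congr rfl fun k _ => ?_
      simp only [Function.comp_apply]
      rw [alignWeight, if_pos, List.length_ofFn]
      intro p hp q hq
      obtain ⟨i, rfl⟩ := (List.mem_ofFn' _ _).1 hp
      obtain ⟨j, rfl⟩ := (List.mem_ofFn' _ _).1 hq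
      exact (index_eq_index_iff c fun a b => u b / u a ∈ posRay).1 hc k i j
    simp only [h2]
    refine (differentiableAt_upValue (blockSum c u) (fun x => blockSum c x) ?_ fun k =>
      ⟨blockSum_mem_puncturedSpace hu hc k, cone_blockSum hu hx hc k⟩).const_mul _
    unfold blockSum
    fun_prop
  · have h2 : ∀ x : Fin m → ℂ, ((List.ofFn fun k => List.ofFn fun j =>
        (u (c.embedding k j), x (c.embedding k j))).map alignWeight).prod = 0 := by
      intro x
      have := (index_eq_index_iff c fun a b => u b / u a ∈ posRay).not.1 hc
      push Not at this
      obtain ⟨k, i, j, hk⟩ := this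
      rw [List.map_ofFn, List.prod_ofFn]
      refine Finset.prod_eq_zero (Finset.mem_univ k) (if_neg fun h => hk ?_)
      exact h _ ((List.mem_ofFn' _ _).2 ⟨i, rfl⟩) _ ((List.mem_ofFn' _ _).2 ⟨j, rfl⟩)
    simp only [h2, zero_mul]
    exact differentiableAt_const _

theorem transformCondition_extFamily : TransformCondition extFamily := by
  refine ⟨sector, localFamily, ?_, ?_⟩
  · intro n hn w hw
    refine ⟨isOpen_sector hw, mem_sector_self hw, ?_, ?_, ?_⟩
    · exact fun z hz k => (hz k).snd_ne_zero
    · intro z hz k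
      rw [← div_eq_mul_inv]
      exact (hz k).2.1.re_pos
    · exact fun z hz => extFamily_eq_transformSum hn hz
  · intro m hm u hu
    have h : ∀ x ∈ {x | Required sector m u x}, DifferentiableAt ℂ (localFamily m u) x := by
      intro x hx
      obtain ⟨n, hn, w, hw, z, hz, c, hc⟩ := hx
      exact differentiableAt_localFamily (blockSum_mem_puncturedSpace hw hc)
        (cone_blockSum hw (fun i => (hz i).2.1) hc)
    exact ⟨fun x hx => (h x hx).continuousAt.continuousWithinAt,
      fun x hx => (h x hx).differentiableWithinAt⟩

/-! ### The differential equation -/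

theorem splitSum_eq_single {α R : Type*} [AddCommMonoid R] {f : List (List α) → R} {L : List α}
    (h : ∀ D : List (List α), D.flatten = L → [] ∉ D → D.length < L.length → f D = 0) :
    splitSum f L = f (L.map fun x => [x]) := by
  induction L generalizing f with
  | nil => rfl
  | cons x L ih =>
    rw [splitSum, ih, List.map_cons]
    · have : splitSum (consHead x f) L = 0 := by
        refine Eq.trans (splitSum_congr fun D hD hn => ?_) (splitSum_zero L)
        cases D with
        | nil => rfl
        | cons A D =>
          simp only [consHead]
          refine h _ (by simpa using hD) ?_ ?_
          · simp only [List.mem_cons, not_or] at hn ⊢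
            exact ⟨by simp, hn.2⟩
          · have hlen : ∀ D : List (List α), [] ∉ D → D.length ≤ D.flatten.length := by
              intro D
              induction D with
              | nil => simp
              | cons B D ih =>
                intro hn
                simp only [List.mem_cons, not_or] at hn
                have := ih hn.2
                have h2 : 0 < B.length := List.length_pos_iff.2 (Ne.symm hn.1)
                simp only [List.flatten_cons, List.length_append, List.length_cons]
                omega
            have := hlen _ hn
            rw [hD] at this
            simpa using Nat.lt_succ_of_le this
      rw [this, add_zero]
    · intro D hD hn hl
      exact h _ (by simp [hD]) (by simp [hn]) (by simpa using hl)

theorem exists_two_le_length {α : Type*} {D : List (List α)}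
    (h : D.length < D.flatten.length) : ∃ A ∈ D, 2 ≤ A.length := by
  by_contra h1
  push Not at h1
  have : ∀ D : List (List α), (∀ A ∈ D, A.length < 2) → D.flatten.length ≤ D.length := by
    intro D
    induction D with
    | nil => simp
    | cons B D ih =>
      intro h
      have h2 := h B (by simp)
      have := ih fun A hA => h A (by simp [hA])
      simp only [List.flatten_cons, List.length_append, List.length_cons]
      omega
  have := this D h1
  omega

theorem blockOp_eq_of_single {α β : Type*} {σ : List α → β} {κ : List α → ℂ} {Φ : List β → ℂ}
    {L : List α} (h : ∀ A : List α, A <:+: L → 2 ≤ A.length → κ A = 0) (h1 : ∀ x ∈ L, κ [x] = 1) :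
    blockOp σ κ Φ L = Φ (L.map fun x => σ [x]) := by
  rw [blockOp, splitSum_eq_single]
  · rw [List.map_map, List.map_map]
    have : (L.map (κ ∘ fun x => [x])).prod = 1 :=
      List.prod_eq_one fun y hy => by
        obtain ⟨x, hx, rfl⟩ := List.mem_map.1 hy
        exact h1 x hx
    rw [this, one_mul]
    rfl
  · intro D hD hn hl
    obtain ⟨A, hA, h2⟩ := exists_two_le_length (hD ▸ hl)
    rw [prod_eq_zero_of_mem hA (h A (hD ▸ List.infix_of_mem_flatten hA) h2), zero_mul]

theorem blockTotal_singleton (x : ℂ × ℂ) : blockTotal [x] = x := by simp [blockTotal]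

theorem listCoeff_singleton (x : ℝ) : listCoeff [x] = 1 := by
  rw [listCoeff, blockOp_eq_prefixSum _ _ _ (by simp)]
  simp only [prefixSum, blockOp_nil, add_zero]
  rw [blockWeight_cons (r := (· > ·)) (fun x => lt_irrefl x)]
  simp [runWeight, logCoeff]

theorem blockCoeff_singleton {x : ℂ × ℂ} (hx : x.1 ≠ 0) : blockCoeff [x] = 1 := by
  rw [blockCoeff, if_pos]
  · simp [listCoeff_singleton]
  · simp only [List.mem_singleton, forall_eq]
    exact (div_mem_posRay_iff hx).2 (OnRay.refl _)

theorem alignWeight_singleton {x : ℂ × ℂ} (hx : x.1 ≠ 0) : alignWeight [x] = 1 := by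
  rw [alignWeight_of_onRay]
  · simp [expCoeff]
  · simpa using hx
  · simpa using OnRay.refl _

theorem isChain_ofFn_of_slit {n : ℕ} {w : Fin n → ℂ} (hw : w ∈ slitDomain n) (z : Fin n → ℂ) :
    (List.ofFn fun i => (w i, z i)).IsChain fun x y => y.1 / x.1 ∉ posRay := by
  refine List.isChain_iff_getElem.2 fun i hi => ?_
  rw [List.getElem_ofFn, List.getElem_ofFn]
  exact hw.2 _ _ rfl

theorem admissible_of_slit {n : ℕ} {w z : Fin n → ℂ} (hw : w ∈ slitDomain n) (hz : z ∈ sector n w) :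
    AdmissibleList (List.ofFn fun i => ((w i)⁻¹, z i)) ∧
      upValue (List.ofFn fun i => (w i, z i)) = rayValue (List.ofFn fun i => ((w i)⁻¹, z i)) := by
  set ε := tolerance (List.ofFn w) with hε
  have hε0 : 0 < ε := tolerance_pos _
  set T : List (ℂ × ℂ × ℝ) := List.ofFn fun i => (w i, z i, 0) with hT
  have hg : ∀ x ∈ T, Good ε x := by
    intro x hx
    obtain ⟨i, rfl⟩ := (List.mem_ofFn' _ _).1 hx
    exact ⟨hw.1 i, (hz i).2.1, by simpa using hε0⟩
  have hc : T.IsChain (TiltedUp ε) := by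
    have h1 := isChain_apart_tolerance (List.ofFn w)
    refine List.isChain_iff_getElem.2 fun i hi => ?_
    rw [List.length_ofFn] at hi
    have h2 := List.isChain_iff_getElem.1 h1 i (by simpa using hi)
    rw [List.getElem_ofFn, List.getElem_ofFn] at h2 ⊢
    refine Or.inr (h2.resolve_left fun h0 => ?_)
    exact hw.2 _ _ rfl ((div_mem_posRay_iff (hw.1 _)).2
      ((arg_div_eq_zero_iff (hw.1 _) (hw.1 _)).1 h0))
  have h1 : T.map tiltPair = List.ofFn fun i => ((w i)⁻¹, z i) := by
    rw [hT, List.map_ofFn]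
    simp [tiltPair, Function.comp_def]
  have h2 : T.map forgetTilt = List.ofFn fun i => (w i, z i) := by
    rw [hT, List.map_ofFn]
    rfl
  have h3 := admissibleList_tilt (tolerance_le _) hg (hc.imp fun _ _ h => h.tilted)
  have h4 := rayValue_eq_upValue (tolerance_le _) hg hc
  rw [h1] at h3 h4
  rw [h2] at h4
  exact ⟨h3, h4.symm⟩

/-- Away from the aligned configurations the extended functions are given by a single integral. -/
theorem extFamily_eq_rayValue {n : ℕ} (hn : 1 ≤ n) {w z : Fin n → ℂ} (hw : w ∈ slitDomain n)
    (hz : z ∈ sector n w) : extFamily n z = rayValue (List.ofFn fun i => ((w i)⁻¹, z i)) := by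
  have hchain := isChain_ofFn_of_slit hw z
  have hne : ∀ x ∈ List.ofFn fun i => (w i, z i), x.1 ≠ 0 := by
    intro x hx
    obtain ⟨i, rfl⟩ := (List.mem_ofFn' _ _).1 hx
    exact hw.1 i
  have hzero : ∀ A : List (ℂ × ℂ), A <:+: (List.ofFn fun i => (w i, z i)) → 2 ≤ A.length →
      ¬ ∀ x ∈ A, ∀ y ∈ A, y.1 / x.1 ∈ posRay := by
    intro A hA h2 h
    have h3 := List.isChain_iff_getElem.1 (hchain.infix hA) 0 (by omega)
    exact h3 (h _ (List.getElem_mem _) _ (List.getElem_mem _))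
  have h1 : ∀ A : List (ℂ × ℂ), A <:+: (List.ofFn fun i => (w i, z i)) → 2 ≤ A.length →
      blockCoeff A = 0 := fun A hA h2 => if_neg (hzero A hA h2)
  have h2 : ∀ A : List (ℂ × ℂ), A <:+: (List.ofFn fun i => (w i, z i)) → 2 ≤ A.length →
      alignWeight A = 0 := fun A hA h2 => if_neg (hzero A hA h2)
  rw [extFamily_eq_transformSum hn hz,
    transformSum_eq_blockOp localFamily localFun (fun _ _ _ => rfl),
    blockOp_eq_of_single h1 (fun x hx => blockCoeff_singleton (hne x hx))]
  simp only [blockTotal_singleton, List.map_id']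
  rw [localFun, blockOp_eq_of_single h2 (fun x hx => alignWeight_singleton (hne x hx))]
  simp only [blockTotal_singleton, List.map_id']
  exact (admissible_of_slit hw hz).2

theorem ofFn_slice {n : ℕ} (z : Fin n → ℂ) {s p : ℕ} (h : s + p ≤ n) :
    List.ofFn (slice z s p) = ((List.ofFn z).drop s).take p := by
  refine List.ext_getElem (by simp; omega) fun i h1 h2 => ?_
  rw [List.length_ofFn] at h1
  rw [List.getElem_ofFn, List.getElem_take, List.getElem_drop, List.getElem_ofFn]
  exact dif_pos (by simp; omega)

theorem ofFn_slice_zero {n : ℕ} (z : Fin n → ℂ) {k : ℕ} (h : k ≤ n) :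
    List.ofFn (slice z 0 k) = (List.ofFn z).take k := by
  rw [ofFn_slice z (by omega), List.drop_zero]

theorem ofFn_slice_tail {n : ℕ} (z : Fin n → ℂ) {k : ℕ} (h : k ≤ n) :
    List.ofFn (slice z k (n - k)) = (List.ofFn z).drop k := by
  rw [ofFn_slice z (by omega), List.take_of_length_le]
  simp

theorem headSum_eq {n : ℕ} (z : Fin n → ℂ) {k : ℕ} (h : k ≤ n) :
    headSum z k = ((List.ofFn z).take k).sum := by
  rw [headSum, ← List.sum_ofFn, ofFn_slice_zero z h]

theorem tailSum_eq {n : ℕ} (z : Fin n → ℂ) {k : ℕ} (h : k ≤ n) :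
    tailSum z k = ((List.ofFn z).drop k).sum := by
  rw [tailSum, ← List.sum_ofFn, ofFn_slice_tail z h]

theorem headSum_add_tailSum {n : ℕ} (z : Fin n → ℂ) {k : ℕ} (h : k ≤ n) :
    headSum z k + tailSum z k = ∑ i, z i := by
  rw [headSum_eq z h, tailSum_eq z h, List.sum_take_add_sum_drop, List.sum_ofFn]

theorem slice_mem_slitDomain {n : ℕ} {z : Fin n → ℂ} (hz : z ∈ slitDomain n) {s p : ℕ}
    (h : s + p ≤ n) : slice z s p ∈ slitDomain p := by
  constructor
  · intro k
    rw [slice, dif_pos (by omega)]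
    exact hz.1 _
  · intro i j hij
    rw [slice, slice, dif_pos (by omega), dif_pos (by omega)]
    exact hz.2 _ _ (by simp; omega)

/-- The value at the centre of a sector, in terms of lists. -/
theorem extFamily_eq_rayValue_map {n : ℕ} (hn : 1 ≤ n) {z : Fin n → ℂ} (hz : z ∈ slitDomain n) :
    extFamily n z = rayValue ((List.ofFn z).map fun ζ => (ζ⁻¹, ζ)) := by
  rw [extFamily_eq_rayValue hn hz (mem_sector_self hz.1), List.map_ofFn]
  rfl

theorem rayIter_singleton_inv {ζ : ℂ} (hζ : ζ ≠ 0) : rayIter [(ζ⁻¹, ζ)] = ζ⁻¹ := by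
  have h1 : ∀ v : ℝ, ζ⁻¹ * Complex.exp (-(ζ * (ζ⁻¹ * v))) * 1 =
      ζ⁻¹ * ((Real.exp (-v) : ℝ) : ℂ) := by
    intro v
    rw [mul_inv_cancel_left₀ hζ, mul_one]
    push_cast
    rfl
  simp only [rayIter, rayInt, rayKernel, h1]
  rw [integral_const_mul, integral_complex_ofReal, integral_exp_neg_Ioi_zero]
  simp

theorem hasDerivAt_line {n : ℕ} {f : (Fin n → ℂ) → ℂ} {z : Fin n → ℂ} (hf : DifferentiableAt ℂ f z)
    (v : Fin n → ℂ) : HasDerivAt (fun s : ℂ => f (z + s • v)) (fderiv ℂ f z v) 0 := by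
  have h1 : HasDerivAt (fun s : ℂ => z + s • v) v 0 := by
    simpa using ((hasDerivAt_id (0 : ℂ)).smul_const v).const_add z
  have h2 : HasFDerivAt f (fderiv ℂ f z) (z + (0 : ℂ) • v) := by
    simpa using hf.hasFDerivAt
  exact h2.comp_hasDerivAt (0 : ℂ) h1

/-- The integral is homogeneous of degree `-1` (Euler's relation). -/
theorem fderiv_rayIter_self {n : ℕ} {d z : Fin n → ℂ}
    (hf : DifferentiableAt ℂ (fun z : Fin n → ℂ => rayIter (List.ofFn fun i => (d i, z i))) z) :
    fderiv ℂ (fun z : Fin n → ℂ => rayIter (List.ofFn fun i => (d i, z i))) z z =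
      - rayIter (List.ofFn fun i => (d i, z i)) := by
  have h1 := (hasDerivAt_line hf z)
  have h2 : HasDerivAt (fun s : ℝ => rayIter (List.ofFn fun i => (d i, (z + (s : ℂ) • z) i)))
      (fderiv ℂ (fun z : Fin n → ℂ => rayIter (List.ofFn fun i => (d i, z i))) z z) 0 :=
    HasDerivAt.comp_ofReal (z := (0 : ℝ)) (by simpa using h1)
  have h3 : (fun s : ℝ => rayIter (List.ofFn fun i => (d i, (z + (s : ℂ) • z) i))) =ᶠ[𝓝 0]
      fun s : ℝ => (((1 + s : ℝ) : ℂ))⁻¹ * rayIter (List.ofFn fun i => (d i, z i)) := by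
    filter_upwards [lt_mem_nhds (show (-1 : ℝ) < 0 by norm_num)] with s hs
    have hs' : 0 < 1 + s := by linarith
    rw [← rayIter_smul hs', List.map_ofFn]
    congr 2
    funext i
    simp only [Function.comp_apply, Pi.add_apply, Pi.smul_apply, smul_eq_mul, Prod.mk.injEq, true_and]
    push_cast
    ring
  have h4 : HasDerivAt (fun s : ℝ => (((1 + s : ℝ) : ℂ))⁻¹ * rayIter (List.ofFn fun i => (d i, z i)))
      (- rayIter (List.ofFn fun i => (d i, z i))) 0 := by
    have h5 : HasDerivAt (fun s : ℝ => ((1 + s : ℝ) : ℂ)) 1 0 := by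
      have := ((hasDerivAt_id (0 : ℝ)).const_add 1).ofReal_comp
      simpa using this
    have h6 := (h5.inv (by simp)).mul_const (rayIter (List.ofFn fun i => (d i, z i)))
    simpa using h6
  exact h2.unique (h4.congr_of_eventuallyEq h3)

theorem isPdeFamily_extFamily : IsPdeFamily extFamily := by
  have hloc : ∀ n, 1 ≤ n → ∀ z ∈ slitDomain n, extFamily n =ᶠ[𝓝 z]
      fun z' => (∑ i, z' i) * rayIter (List.ofFn fun i => ((z i)⁻¹, z' i)) *
        ((2 * Real.pi * Complex.I) ^ n)⁻¹ := by
    intro n hn z hz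
    filter_upwards [(isOpen_sector hz.1).mem_nhds (mem_sector_self hz.1)] with z' hz'
    rw [extFamily_eq_rayValue hn hz hz', rayValue, List.map_ofFn, List.length_ofFn, div_eq_mul_inv]
    congr 2
    exact List.sum_ofFn
  have hdiff : ∀ n, ∀ z ∈ slitDomain n, DifferentiableAt ℂ
      (fun z' : Fin n → ℂ => rayIter (List.ofFn fun i => ((z i)⁻¹, z' i))) z := by
    intro n z hz
    have h1 : ∀ z' : Fin n → ℂ, (List.ofFn fun i => ((z i)⁻¹, z' i)) =
        evalList (List.ofFn fun i : Fin n => ((fun _ => (z i)⁻¹ : (Fin n → ℂ) → ℂ),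
          fun z' : Fin n → ℂ => z' i)) z' := by
      intro z'
      rw [evalList, List.map_ofFn]
      rfl
    simp only [h1]
    refine differentiableAt_rayIter ?_ ?_
    · intro q hq
      obtain ⟨i, rfl⟩ := (List.mem_ofFn' _ _).1 hq
      exact ⟨differentiable_const _, by fun_prop⟩
    · rw [← h1]
      exact (admissible_of_slit hz (mem_sector_self hz.1)).1
  have hS : ∀ n (z : Fin n → ℂ), HasFDerivAt (fun z' : Fin n → ℂ => ∑ i, z' i)
      (∑ i, ContinuousLinearMap.proj (R := ℂ) (φ := fun _ : Fin n => ℂ) i) z := fun n z =>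
    HasFDerivAt.fun_sum fun i _ => (ContinuousLinearMap.proj (R := ℂ) (φ := fun _ : Fin n => ℂ) i).hasFDerivAt
  have hE : ∀ n, 1 ≤ n → ∀ z ∈ slitDomain n, HasFDerivAt (extFamily n)
      (((2 * Real.pi * Complex.I : ℂ) ^ n)⁻¹ • ((∑ i, z i) •
        fderiv ℂ (fun z' : Fin n → ℂ => rayIter (List.ofFn fun i => ((z i)⁻¹, z' i))) z +
        rayIter (List.ofFn fun i => ((z i)⁻¹, z i)) •
          ∑ i, ContinuousLinearMap.proj (R := ℂ) (φ := fun _ : Fin n => ℂ) i)) z := by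
    intro n hn z hz
    exact (((hS n z).fun_mul (hdiff n z hz).hasFDerivAt).mul_const _).congr_of_eventuallyEq
      (hloc n hn z hz)
  refine ⟨?_, ?_, ?_, ?_⟩
  · exact fun n hn z hz => (hE n hn z hz).differentiableAt.differentiableWithinAt
  · intro z hz
    rw [extFamily_eq_rayValue_map le_rfl hz, rayValue]
    have h0 : z 0 ≠ 0 := hz.1 0
    simp [List.ofFn_succ, rayIter_singleton_inv h0, h0]
  · intro n hn z hz h0
    rw [(hloc n hn z hz).self_of_nhds]
    simp only [h0, zero_mul]
  · intro n hn z hz hne v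
    set f : (Fin n → ℂ) → ℂ := fun z' => rayIter (List.ofFn fun i => ((z i)⁻¹, z' i)) with hf
    -- By homogeneity, the derivative in direction `v` is a multiple of the derivative of the integral
    -- in the direction `u`, whose components add up to zero.
    set u : Fin n → ℂ := (∑ i, z i) • v - (∑ i, v i) • z with hu
    have hDf : fderiv ℂ f z z = - f z := fderiv_rayIter_self (hdiff n z hz)
    have h1 : fderiv ℂ (extFamily n) z v = ((2 * Real.pi * Complex.I : ℂ) ^ n)⁻¹ * fderiv ℂ f z u := by
      rw [(hE n hn z hz).fderiv, hu, map_sub, map_smul, map_smul, hDf]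
      simp [f]
      ring
    set M : List (ℂ × ℂ × ℂ) := List.ofFn fun i => ((z i)⁻¹, z i, u i) with hM
    have hline : ∀ s, lineList M s = List.ofFn fun i => ((z i)⁻¹, (z + s • u) i) := by
      intro s
      rw [lineList, hM, List.map_ofFn]
      rfl
    have hline0 : lineList M 0 = (List.ofFn z).map fun ζ => (ζ⁻¹, ζ) := by
      rw [hline, List.map_ofFn]
      simp [Function.comp_def]
    have hvel : M.map (fun m => m.2.2) = List.ofFn u := by
      rw [hM, List.map_ofFn]; rfl
    have hadm : AdmissibleList (lineList M 0) := by
      have := (admissible_of_slit hz (mem_sector_self hz.1)).1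
      rw [hline]
      simpa using this
    have hvel0 : velSum M = 0 := by
      rw [velSum, hvel, List.sum_ofFn, hu]
      simp only [Pi.sub_apply, Pi.smul_apply, smul_eq_mul, Finset.sum_sub_distrib, ← Finset.mul_sum]
      ring
    have h2 := hasDerivAt_rayIter M 0 hadm hvel0
    simp only [hline] at h2
    have h3 := (hasDerivAt_line (hdiff n z hz) u).unique h2
    have hMn : M.length = n := by rw [hM, List.length_ofFn]
    rw [h1, h3, hMn, Finset.mul_sum]
    refine Finset.sum_congr rfl fun k hk => ?_
    obtain ⟨hk1, hkn⟩ := Finset.mem_Ico.1 hk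
    obtain ⟨hh, ht⟩ := hne k hk
    have e1 : lineList (M.take k) 0 = ((List.ofFn z).take k).map fun ζ => (ζ⁻¹, ζ) := by
      rw [List.map_take, ← hline0, lineList, lineList, List.map_take]
    have e2 : lineList (M.drop k) 0 = ((List.ofFn z).drop k).map fun ζ => (ζ⁻¹, ζ) := by
      rw [List.map_drop, ← hline0, lineList, lineList, List.map_drop]
    have e3 : velSum (M.drop k) = headSum z k * tailSum v k - headSum v k * tailSum z k := by
      rw [velSum, List.map_drop, hvel, ← tailSum_eq u hkn.le]
      have h5 : tailSum u k = (∑ i, z i) * tailSum v k - (∑ i, v i) * tailSum z k := by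
        have h6 : ∀ i, slice u k (n - k) i = (∑ i, z i) * slice v k (n - k) i -
            (∑ i, v i) * slice z k (n - k) i := by
          intro i
          simp only [slice]
          split_ifs
          · simp [hu]
          · simp
        simp only [tailSum, h6, Finset.sum_sub_distrib, ← Finset.mul_sum]
      rw [h5, ← headSum_add_tailSum z hkn.le, ← headSum_add_tailSum v hkn.le]
      ring
    have hs1 : slice z 0 k ∈ slitDomain k := slice_mem_slitDomain hz (by omega)
    have hs2 : slice z k (n - k) ∈ slitDomain (n - k) := slice_mem_slitDomain hz (by omega)
    rw [extFamily_eq_rayValue_map hk1 hs1, extFamily_eq_rayValue_map (by omega) hs2,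
      ofFn_slice_zero z hkn.le, ofFn_slice_tail z hkn.le, rayValue, rayValue, e1, e2, e3]
    have hid : ∀ L : List ℂ, ((L.map fun ζ => (ζ⁻¹, ζ)).map Prod.snd).sum = L.sum := by
      intro L
      rw [List.map_map]
      simp [Function.comp_def]
    rw [hid, hid, ← headSum_eq z hkn.le, ← tailSum_eq z hkn.le]
    simp only [List.length_map, List.length_take, List.length_drop, List.length_ofFn,
      min_eq_left hkn.le]
    have hpi : (2 * Real.pi * Complex.I : ℂ) ≠ 0 := Complex.two_pi_I_ne_zero
    have hpow : (2 * Real.pi * Complex.I : ℂ) ^ n =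
        (2 * Real.pi * Complex.I) ^ k * (2 * Real.pi * Complex.I) ^ (n - k) := by
      rw [← pow_add]; congr 1; omega
    rw [hpow]
    have hp1 := pow_ne_zero k hpi
    have hp2 := pow_ne_zero (n - k) hpi
    field_simp

/-! ### The slit domain is open and connected -/

theorem notMem_posRay_iff {w : ℂ} (hw : w ≠ 0) : w ∉ posRay ↔ -w ∈ Complex.slitPlane := by
  rw [Complex.mem_slitPlane_iff, Complex.neg_re, Complex.neg_im]
  constructor
  · intro h
    by_contra! h1
    have him : w.im = 0 := by linarith [h1.2]
    refine h ⟨w.re, lt_of_le_of_ne (by linarith [h1.1]) fun h0 => hw ?_, ?_⟩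
    · exact Complex.ext h0.symm him
    · exact Complex.ext rfl (by simpa using him)
  · rintro h ⟨r, hr, rfl⟩
    simp at h
    linarith

theorem isOpen_slitDomain (n : ℕ) : IsOpen (slitDomain n) := by
  rw [isOpen_iff_mem_nhds]
  intro z hz
  have h1 : ∀ᶠ z' in 𝓝 z, ∀ k, z' k ≠ 0 := eventually_all.2 fun k =>
    (continuous_apply k).continuousAt.eventually_ne (hz.1 k)
  have h2 : ∀ᶠ z' in 𝓝 z, ∀ i j : Fin n, (j : ℕ) = i + 1 → -(z' j / z' i) ∈ Complex.slitPlane := by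
    refine eventually_all.2 fun i => eventually_all.2 fun j => ?_
    by_cases hij : (j : ℕ) = i + 1
    · have hc : ContinuousAt (fun z' : Fin n → ℂ => -(z' j / z' i)) z :=
        ((continuous_apply j).continuousAt.div (continuous_apply i).continuousAt (hz.1 i)).neg
      have := hc.eventually (Complex.isOpen_slitPlane.mem_nhds
        ((notMem_posRay_iff (div_ne_zero (hz.1 j) (hz.1 i))).1 (hz.2 i j hij)))
      filter_upwards [this] with z' h _ using h
    · exact Eventually.of_forall fun _ h => absurd h hij
  filter_upwards [h1, h2] with z' h1 h2
  exact ⟨h1, fun i j hij => (notMem_posRay_iff (div_ne_zero (h1 j) (h1 i))).2 (h2 i j hij)⟩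

theorem exp_notMem_posRay {ζ : ℂ} (h0 : 0 < ζ.im) (h1 : ζ.im < 2 * Real.pi) :
    Complex.exp ζ ∉ posRay := by
  rintro ⟨r, hr, h⟩
  have h2 : Complex.exp ζ = Complex.exp (Real.log r) := by
    rw [h, ← Complex.ofReal_exp, Real.exp_log hr]
  obtain ⟨n, hn⟩ := Complex.exp_eq_exp_iff_exists_int.1 h2
  have h3 : ζ.im = n * (2 * Real.pi) := by
    rw [hn]; simp
  have hpi := Real.pi_pos
  have h4 : (0 : ℝ) < n := by
    by_contra! h
    have : (n : ℝ) * (2 * Real.pi) ≤ 0 := mul_nonpos_of_nonpos_of_nonneg h (by positivity)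
    linarith
  have h5 : (n : ℝ) < 1 := by
    by_contra! h
    have : 1 * (2 * Real.pi) ≤ (n : ℝ) * (2 * Real.pi) := by gcongr
    linarith
  have h6 : 0 < n := by exact_mod_cast h4
  have h7 : n < 1 := by exact_mod_cast h5
  omega

/-- Logarithms of `z_1` and of the quotients `z_{k+1} / z_k` parametrize `slitDomain n` by a convex
set. -/
theorem isPreconnected_slitDomain (n : ℕ) : IsPreconnected (slitDomain n) := by
  set C : Set (ℕ → ℂ) := {ζ | ∀ i, ζ (i + 1) ∈ Complex.im ⁻¹' Ioo 0 (2 * Real.pi)} with hC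
  set P : (ℕ → ℂ) → Fin n → ℂ := fun ζ k => Complex.exp (∑ i ∈ Finset.range (k + 1), ζ i) with hP
  have hconv : Convex ℝ C := by
    intro x hx y hy a b ha hb hab i
    exact ((convex_Ioo (0 : ℝ) (2 * Real.pi)).is_linear_preimage Complex.imLm.isLinear)
      (hx i) (hy i) ha hb hab
  have hcont : Continuous P := by
    rw [hP]; fun_prop
  have himage : P '' C = slitDomain n := by
    ext z
    constructor
    · rintro ⟨ζ, hζ, rfl⟩
      refine ⟨fun k => Complex.exp_ne_zero _, fun i j hij => ?_⟩
      simp only [hP]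
      rw [← Complex.exp_sub, hij, Finset.sum_range_succ _ ((i : ℕ) + 1), add_sub_cancel_left]
      exact exp_notMem_posRay (hζ i).1 (hζ i).2
    · intro hz
      set Z : ℕ → ℂ := fun k => if h : k < n then z ⟨k, h⟩ else 1 with hZ
      have hZ0 : ∀ k, Z k ≠ 0 := by
        intro k
        simp only [hZ]
        split_ifs with h
        · exact hz.1 _
        · exact one_ne_zero
      set ζ : ℕ → ℂ := fun k => Nat.casesOn k (Complex.log (Z 0)) fun k =>
        if k + 1 < n then Complex.log (-(Z (k + 1) / Z k)) + Real.pi * Complex.I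
        else Real.pi * Complex.I with hζ
      have hpi := Real.pi_pos
      refine ⟨ζ, fun k => ?_, ?_⟩
      · simp only [hζ]
        split_ifs with h
        · have h1 : -(Z (k + 1) / Z k) ∈ Complex.slitPlane := by
            rw [← notMem_posRay_iff (div_ne_zero (hZ0 _) (hZ0 _))]
            simp only [hZ, dif_pos h, dif_pos (show k < n by omega)]
            exact hz.2 _ _ rfl
          have h2 := Complex.mem_slitPlane_iff_arg.1 h1
          have h3 := Complex.neg_pi_lt_arg (-(Z (k + 1) / Z k))
          have h4 := lt_of_le_of_ne (Complex.arg_le_pi (-(Z (k + 1) / Z k))) h2.1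
          simp only [mem_preimage, Complex.add_im, Complex.log_im, Complex.mul_im,
            Complex.ofReal_re, Complex.I_im, Complex.ofReal_im, Complex.I_re, mul_one, mul_zero,
            add_zero, mem_Ioo]
          constructor <;> linarith
        · simp only [mem_preimage, Complex.mul_im,
            Complex.ofReal_re, Complex.I_im, Complex.ofReal_im, Complex.I_re, mul_one, mul_zero,
            add_zero, mem_Ioo]
          constructor <;> linarith
      · have key : ∀ k, k < n → Complex.exp (∑ i ∈ Finset.range (k + 1), ζ i) = Z k := by
          intro k
          induction k with
          | zero =>
            intro _
            simp only [zero_add, Finset.sum_range_one, hζ]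
            exact Complex.exp_log (hZ0 0)
          | succ k ih =>
            intro hk
            rw [Finset.sum_range_succ, Complex.exp_add, ih (by omega)]
            simp only [hζ, if_pos hk]
            rw [Complex.exp_add, Complex.exp_pi_mul_I,
              Complex.exp_log (neg_ne_zero.2 (div_ne_zero (hZ0 _) (hZ0 _)))]
            have := hZ0 k
            field_simp
        funext k
        exact (key k k.2).trans (by simp [hZ])
  rw [← himage]
  exact hconv.isPreconnected.image P hcont.continuousOn

/-! ### Uniqueness of the solution of the differential equation -/

/-- A function whose derivative vanishes off finitely many linear hyperplanes has vanishing
derivative everywhere: nearby points are joined to a point off the hyperplanes by segments that meet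
each hyperplane at most once. -/
theorem fderiv_eq_zero_of_off_hyperplanes {V ι : Type*} [NormedAddCommGroup V] [NormedSpace ℂ V]
    [Finite ι] {U : Set V} (hU : IsOpen U) {g : V → ℂ} (hg : DifferentiableOn ℂ g U)
    (l : ι → V →ₗ[ℂ] ℂ) {e : V} (he : ∀ j, l j e ≠ 0)
    (h : ∀ z ∈ U, (∀ j, l j z ≠ 0) → fderiv ℂ g z = 0) {z : V} (hz : z ∈ U) :
    fderiv ℂ g z = 0 := by
  obtain ⟨r, hr, hball⟩ := Metric.isOpen_iff.1 hU z hz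
  have hc1 : ∀ᶠ s : ℝ in 𝓝[≠] 0, z + (s : ℂ) • e ∈ Metric.ball z r := by
    have hc : Continuous fun s : ℝ => z + (s : ℂ) • e := by fun_prop
    refine (hc.continuousAt.eventually (Metric.isOpen_ball.mem_nhds ?_)).filter_mono
      nhdsWithin_le_nhds
    simpa using hr
  have hc2 : ∀ᶠ s : ℝ in 𝓝[≠] 0, ∀ j, l j (z + (s : ℂ) • e) ≠ 0 := by
    refine eventually_all.2 fun j => ?_
    simp only [map_add, map_smul, smul_eq_mul]
    rcases eq_or_ne (l j z) 0 with h0 | h0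
    · filter_upwards [self_mem_nhdsWithin] with s hs
      rw [h0, zero_add]
      exact mul_ne_zero (by exact_mod_cast hs) (he j)
    · have hc : Continuous fun s : ℝ => l j z + (s : ℂ) * l j e := by fun_prop
      refine (hc.continuousAt.eventually_ne ?_).filter_mono nhdsWithin_le_nhds
      simpa using h0
  obtain ⟨s, hs1, hs2⟩ := (hc1.and hc2).exists
  set c := z + (s : ℂ) • e with hc
  have hconst : ∀ y ∈ Metric.ball z r, g y = g c := by
    intro y hy
    have hmem : ∀ t : ℝ, t ∈ Icc (0 : ℝ) 1 → c + (t : ℂ) • (y - c) ∈ Metric.ball z r := by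
      intro t ht
      let : NormedSpace ℝ V := NormedSpace.restrictScalars ℝ ℂ V
      have h2 := (convex_ball z r).add_smul_sub_mem hs1 hy ht
      exact h2
    set B : Set ℝ := {t | ∃ j, l j (c + (t : ℂ) • (y - c)) = 0} with hB
    have hBc : B.Countable := by
      have : B = ⋃ j, {t : ℝ | l j (c + (t : ℂ) • (y - c)) = 0} := by
        ext t; simp [hB]
      rw [this]
      have : Countable ι := Finite.to_countable
      refine countable_iUnion fun j => Set.Subsingleton.countable ?_
      intro t ht t' ht'
      simp only [mem_ofPred_eq, map_add, map_smul, smul_eq_mul] at ht ht'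
      have h2 : ((t : ℂ) - t') * l j (y - c) = 0 := by linear_combination ht - ht'
      rcases mul_eq_zero.1 h2 with h3 | h3
      · exact_mod_cast sub_eq_zero.1 h3
      · rw [h3, mul_zero, add_zero] at ht
        exact absurd ht (hs2 j)
    have hder : ∀ t ∈ Icc (0 : ℝ) 1, HasDerivAt (fun t : ℝ => g (c + (t : ℂ) • (y - c)))
        (fderiv ℂ g (c + (t : ℂ) • (y - c)) (y - c)) t := by
      intro t ht
      have h1 : HasDerivAt (fun s : ℂ => c + s • (y - c)) (y - c) (t : ℂ) := by
        simpa using ((hasDerivAt_id (t : ℂ)).smul_const (y - c)).const_add c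
      have h2 := ((hg _ (hball (hmem t ht))).differentiableAt
        (hU.mem_nhds (hball (hmem t ht)))).hasFDerivAt
      exact HasDerivAt.comp_ofReal (h2.comp_hasDerivAt (t : ℂ) h1)
    have := integral_eq_of_hasDerivAt_off_countable_of_le
      (fun t : ℝ => g (c + (t : ℂ) • (y - c))) (fun _ => 0) zero_le_one hBc
      (fun t ht => (hder t ht).continuousAt.continuousWithinAt) ?_ (by simp)
    · simp at this
      exact (sub_eq_zero.1 this.symm)
    · intro t ht
      have h1 := hder t (Ioo_subset_Icc_self ht.1)
      have h2 : ∀ j, l j (c + (t : ℂ) • (y - c)) ≠ 0 := fun j h0 => ht.2 ⟨j, h0⟩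
      rw [h _ (hball (hmem t (Ioo_subset_Icc_self ht.1))) h2] at h1
      exact h1
  have : g =ᶠ[𝓝 z] fun _ => g c := by
    filter_upwards [Metric.isOpen_ball.mem_nhds (Metric.mem_ball_self hr)] with y hy using hconst y hy
  rw [this.fderiv_eq]
  simp

theorem isLinearMap_slice {n : ℕ} (s p : ℕ) :
    IsLinearMap ℂ fun z : Fin n → ℂ => ∑ i, slice z s p i := by
  constructor
  · intro x y
    rw [← Finset.sum_add_distrib]
    refine Finset.sum_congr rfl fun i _ => ?_
    simp only [slice]
    split_ifs <;> simp
  · intro a x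
    rw [Finset.smul_sum]
    refine Finset.sum_congr rfl fun i _ => ?_
    simp only [slice]
    split_ifs <;> simp

theorem sum_slice_one {n s p : ℕ} (h : s + p ≤ n) :
    ∑ i, slice (fun _ : Fin n => (1 : ℂ)) s p i = p := by
  have : ∀ i, slice (fun _ : Fin n => (1 : ℂ)) s p i = 1 := fun i => dif_pos (by omega)
  simp [this]

/-- The points `1, ω, …, ω^(n-1)` for a primitive `n`-th root of unity `ω` lie in `slitDomain n`
and add up to zero. -/
theorem exists_mem_slitDomain_sum_eq_zero {n : ℕ} (hn : 2 ≤ n) :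
    ∃ z ∈ slitDomain n, ∑ i, z i = 0 := by
  set ω := Complex.exp (2 * Real.pi * Complex.I / n) with hω
  have hprim : IsPrimitiveRoot ω n := Complex.isPrimitiveRoot_exp n (by omega)
  have hω0 : ω ≠ 0 := Complex.exp_ne_zero _
  refine ⟨fun k => ω ^ (k : ℕ), ⟨fun k => pow_ne_zero _ hω0, fun i j hij => ?_⟩, ?_⟩
  · simp only [hij, pow_succ]
    rw [mul_div_cancel_left₀ _ (pow_ne_zero _ hω0)]
    have him : (2 * Real.pi * Complex.I / n : ℂ).im = 2 * Real.pi / n := by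
      rw [show (2 * Real.pi * Complex.I / n : ℂ) = ((2 * Real.pi / n : ℝ) : ℂ) * Complex.I by
        push_cast; ring]
      simp
    have hn' : (2 : ℝ) ≤ n := by exact_mod_cast hn
    have hpi := Real.pi_pos
    refine exp_notMem_posRay ?_ ?_
    · rw [him]; positivity
    · rw [him]
      exact div_lt_self (by positivity) (by linarith)
  · rw [Fin.sum_univ_eq_sum_range fun k => ω ^ k]
    exact hprim.geom_sum_eq_zero (by omega)

theorem eqOn_of_isPdeFamily {F F' : Family} (hF : IsPdeFamily F) (hF' : IsPdeFamily F') {n : ℕ}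
    (hn : 1 ≤ n) : EqOn (F n) (F' n) (slitDomain n) := by
  induction n using Nat.strong_induction_on with
  | _ n ih =>
    rcases hn.eq_or_lt with rfl | hn2
    · exact fun z hz => (hF.first z hz).trans (hF'.first z hz).symm
    have hopen := isOpen_slitDomain n
    have hd := hF.holomorphic n hn
    have hd' := hF'.holomorphic n hn
    obtain ⟨z₀, hz₀, hsum⟩ := exists_mem_slitDomain_sum_eq_zero hn2
    refine hopen.eqOn_of_fderiv_eq (isPreconnected_slitDomain n) hd hd' (fun z hz => ?_) hz₀
      ((hF.vanish n hn z₀ hz₀ hsum).trans (hF'.vanish n hn z₀ hz₀ hsum).symm)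
    have hat : ∀ z ∈ slitDomain n, DifferentiableAt ℂ (F n) z := fun z hz =>
      (hd z hz).differentiableAt (hopen.mem_nhds hz)
    have hat' : ∀ z ∈ slitDomain n, DifferentiableAt ℂ (F' n) z := fun z hz =>
      (hd' z hz).differentiableAt (hopen.mem_nhds hz)
    rw [← sub_eq_zero, ← fderiv_sub (hat z hz) (hat' z hz)]
    refine fderiv_eq_zero_of_off_hyperplanes hopen (hd.sub hd')
      (ι := Finset.Ico 1 n × Bool) (fun j => if j.2 then (isLinearMap_slice 0 j.1).mk' _ else
        (isLinearMap_slice j.1 (n - j.1)).mk' _) (e := fun _ => 1) ?_ ?_ hz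
    · rintro ⟨⟨k, hk⟩, b⟩
      obtain ⟨h1, h2⟩ := Finset.mem_Ico.1 hk
      cases b
      · simp only [Bool.false_eq_true, if_false, IsLinearMap.mk'_apply]
        rw [sum_slice_one (by omega)]
        exact_mod_cast (by omega : n - k ≠ 0)
      · simp only [if_true, IsLinearMap.mk'_apply]
        rw [sum_slice_one (by omega)]
        exact_mod_cast (by omega : k ≠ 0)
    · intro y hy hne
      have hgood : ∀ k ∈ Finset.Ico 1 n, headSum y k ≠ 0 ∧ tailSum y k ≠ 0 := fun k hk =>
        ⟨hne (⟨k, hk⟩, true), hne (⟨k, hk⟩, false)⟩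
      rw [fderiv_sub (hat y hy) (hat' y hy), sub_eq_zero]
      ext1 v
      rw [hF.pde n hn y hy hgood v, hF'.pde n hn y hy hgood v]
      refine Finset.sum_congr rfl fun k hk => ?_
      obtain ⟨h1, h2⟩ := Finset.mem_Ico.1 hk
      rw [ih k h2 h1 (slice_mem_slitDomain hy (by omega)),
        ih (n - k) (by omega) (by omega) (slice_mem_slitDomain hy (by omega))]

/-! ### Uniqueness of the extension -/

/-- Tuples of pairs with the same entries have the same length and the same components. -/
theorem eq_of_ofFn_eq {α : Sort*} (P : (m : ℕ) → (Fin m → ℂ) → (Fin m → ℂ) → α) {m m' : ℕ}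
    {u x : Fin m → ℂ} {u' x' : Fin m' → ℂ}
    (h : (List.ofFn fun i => (u i, x i)) = List.ofFn fun i => (u' i, x' i)) :
    P m u x = P m' u' x' := by
  have h1 : ∀ s t : (Σ m : ℕ, Fin m → ℂ × ℂ), s = t →
      P s.1 (fun i => (s.2 i).1) (fun i => (s.2 i).2) =
        P t.1 (fun i => (t.2 i).1) (fun i => (t.2 i).2) := by
    rintro s t rfl; rfl
  exact h1 ⟨m, fun i => (u i, x i)⟩ ⟨m', fun i => (u' i, x' i)⟩
    (List.equivSigmaTuple.symm.injective h)

theorem blockSum_ones {n : ℕ} (w : Fin n → ℂ) (k : Fin (Composition.ones n).length) :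
    blockSum (Composition.ones n) w k = w ⟨k, by simpa using k.2⟩ := by
  have h1 : (Composition.ones n).blocksFun k = 1 := Composition.ones_blocksFun n k
  rw [blockSum, Fintype.sum_eq_single ⟨0, by omega⟩]
  · rw [Composition.ones_embedding]
  · intro j hj
    exact absurd (Fin.ext (by have := j.2; simp; omega)) hj

theorem ofFn_blockSum_ones {n : ℕ} (w z : Fin n → ℂ) :
    (List.ofFn fun k => (blockSum (Composition.ones n) w k, blockSum (Composition.ones n) z k)) =
      List.ofFn fun k => (w k, z k) := by
  refine List.ext_getElem (by simp) fun i h1 h2 => ?_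
  rw [List.getElem_ofFn, List.getElem_ofFn, blockSum_ones, blockSum_ones]

theorem aligned_ones {n : ℕ} {w : Fin n → ℂ} (hw : w ∈ puncturedSpace n) :
    Aligned (Composition.ones n) w := by
  refine (index_eq_index_iff _ fun a b => w b / w a ∈ posRay).2 fun k i j => ?_
  have h1 : (Composition.ones n).blocksFun k = 1 := Composition.ones_blocksFun n k
  have hij : i = j := Fin.ext (by omega)
  rw [hij]
  exact (div_mem_posRay_iff (hw _)).2 (OnRay.refl _)

theorem coeff_eq_one {p : ℕ} (hp : p = 1) (θ : Fin p → ℝ) : coeff θ = 1 := by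
  subst hp
  rw [coeff_eq_listCoeff one_pos]
  simp [listCoeff_singleton]

/-- In the transformation formula `G_n` occurs with coefficient one, in the term of the composition
into blocks of length one; the other terms involve fewer variables. -/
theorem transformSum_sub {G G' : (m : ℕ) → (Fin m → ℂ) → (Fin m → ℂ) → ℂ} {n : ℕ}
    {w z : Fin n → ℂ} (hw : w ∈ puncturedSpace n)
    (h : ∀ c : Composition n, c ≠ Composition.ones n → Aligned c w →
      G c.length (blockSum c w) (blockSum c z) = G' c.length (blockSum c w) (blockSum c z)) :
    transformSum G n w z - transformSum G' n w z = G n w z - G' n w z := by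
  classical
  rw [transformSum, transformSum, ← Finset.sum_sub_distrib,
    Fintype.sum_eq_single (Composition.ones n)]
  · rw [if_pos (aligned_ones hw), if_pos (aligned_ones hw), Finset.prod_eq_one, mul_one, mul_one,
      eq_of_ofFn_eq G (ofFn_blockSum_ones w z), eq_of_ofFn_eq G' (ofFn_blockSum_ones w z)]
    intro k _
    rw [coeff_eq_one (Composition.ones_blocksFun n k), Rat.cast_one]
  · intro c hc
    split_ifs with hal
    · rw [h c hc hal, sub_self]
    · rw [sub_self]

theorem required_of_mem {N : (n : ℕ) → (Fin n → ℂ) → Set (Fin n → ℂ)} {n : ℕ} (hn : 1 ≤ n)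
    {w z : Fin n → ℂ} (hw : w ∈ puncturedSpace n) (hz : z ∈ N n w) : Required N n w z := by
  rw [← eq_of_ofFn_eq (Required N) (ofFn_blockSum_ones w z)]
  exact Required.mk n hn w hw z hz _ (aligned_ones hw)

theorem eventually_mul_exp_notMem_posRay {w : ℂ} (hw : w ≠ 0) :
    ∀ᶠ η : ℝ in 𝓝[>] 0, w * Complex.exp (η * Complex.I) ∉ posRay := by
  by_cases h : w ∈ posRay
  · obtain ⟨r, hr, rfl⟩ := h
    filter_upwards [Ioo_mem_nhdsGT (show (0 : ℝ) < 2 * Real.pi by positivity)] with η hη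
    rw [← Real.exp_log hr, Complex.ofReal_exp, ← Complex.exp_add]
    refine exp_notMem_posRay ?_ ?_
    · simpa using hη.1
    · simpa using hη.2
  · have hc : Continuous fun η : ℝ => -(w * Complex.exp (η * Complex.I)) := by fun_prop
    have h0 : -(w * Complex.exp ((0 : ℝ) * Complex.I)) ∈ Complex.slitPlane := by
      simpa using (notMem_posRay_iff hw).1 h
    have h1 := (hc.tendsto 0).eventually (Complex.isOpen_slitPlane.mem_nhds h0)
    filter_upwards [h1.filter_mono nhdsWithin_le_nhds] with η hη
    exact (notMem_posRay_iff (mul_ne_zero hw (Complex.exp_ne_zero _))).2 hη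

/-- `slitDomain n` is dense in `(ℂ^×)^n`: rotate the `k`-th variable by the angle `k η`. -/
theorem frequently_mem_slitDomain {n : ℕ} {x : Fin n → ℂ} (hx : x ∈ puncturedSpace n) :
    ∃ᶠ z in 𝓝 x, z ∈ slitDomain n := by
  set c : ℝ → Fin n → ℂ := fun η k => x k * Complex.exp ((k : ℕ) * (η * Complex.I)) with hc
  have hcont : Continuous c := by rw [hc]; fun_prop
  have h0 : c 0 = x := by simp [hc]
  have h1 : Tendsto c (𝓝[>] 0) (𝓝 x) := by
    rw [← h0]
    exact hcont.continuousAt.mono_left nhdsWithin_le_nhds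
  have h2 : ∀ᶠ η in 𝓝[>] (0 : ℝ), c η ∈ slitDomain n := by
    have h3 : ∀ᶠ η : ℝ in 𝓝[>] 0, ∀ i j : Fin n,
        x j / x i * Complex.exp (η * Complex.I) ∉ posRay :=
      eventually_all.2 fun i => eventually_all.2 fun j =>
        eventually_mul_exp_notMem_posRay (div_ne_zero (hx j) (hx i))
    filter_upwards [h3] with η hη
    refine ⟨fun k => mul_ne_zero (hx k) (Complex.exp_ne_zero _), fun i j hij => ?_⟩
    have h4 : c η j / c η i = x j / x i * Complex.exp (η * Complex.I) := by
      simp only [hc, hij]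
      push_cast
      rw [add_mul, one_mul, Complex.exp_add]
      have := hx i
      have := Complex.exp_ne_zero ((i : ℕ) * (η * Complex.I))
      field_simp
    rw [h4]
    exact hη i j
  exact h1.frequently h2.frequently

/-- An extension satisfying the transformation formula is determined by its values on the slit
domains: by induction on `m`, they determine the germ of `G_m(⬝; u)` at `u`. -/
theorem eqOn_of_transformCondition {E E' : Family} (hEE : ∀ n, 1 ≤ n →
    EqOn (E n) (E' n) (slitDomain n)) (hE : TransformCondition E) (hE' : TransformCondition E')
    {n : ℕ} (hn : 1 ≤ n) : EqOn (E n) (E' n) (puncturedSpace n) := by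
  obtain ⟨N, G, hN, hG⟩ := hE
  obtain ⟨N', G', hN', hG'⟩ := hE'
  have key : ∀ m, 1 ≤ m → ∀ u ∈ puncturedSpace m,
      ∀ᶠ x in 𝓝 u, x ∈ N m u ∧ x ∈ N' m u ∧ G m u x = G' m u x ∧
        transformSum G m u x = transformSum G' m u x := by
    intro m
    induction m using Nat.strong_induction_on with
    | _ m ih =>
      intro hm u hu
      obtain ⟨hNo, hNu, hNp, -, hNt⟩ := hN m hm u hu
      obtain ⟨hNo', hNu', -, -, hNt'⟩ := hN' m hm u hu
      -- The terms with fewer variables agree near `u` by the induction hypothesis.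
      have hlower : ∀ᶠ x in 𝓝 u, ∀ c : Composition m, c ≠ Composition.ones m → Aligned c u →
          G c.length (blockSum c u) (blockSum c x) =
            G' c.length (blockSum c u) (blockSum c x) := by
        refine eventually_all.2 fun c => ?_
        by_cases hc : c ≠ Composition.ones m ∧ Aligned c u
        · have hlt : c.length < m :=
            lt_of_le_of_ne c.length_le fun h => hc.1 (Composition.eq_ones_iff_length.2 h)
          have := (continuous_blockSum c).continuousAt.eventually
            (ih _ hlt (c.length_pos_of_pos hm) _ (blockSum_mem_puncturedSpace hu hc.2))
          filter_upwards [this] with x hx _ _ using hx.2.2.1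
        · exact Eventually.of_forall fun x h1 h2 => absurd ⟨h1, h2⟩ hc
      have hall : ∀ᶠ x in 𝓝 u, x ∈ N m u ∧ x ∈ N' m u ∧ transformSum G m u x -
          transformSum G' m u x = G m u x - G' m u x := by
        filter_upwards [hlower, hNo.mem_nhds hNu, hNo'.mem_nhds hNu'] with x h1 h2 h3
        exact ⟨h2, h3, transformSum_sub hu h1⟩
      filter_upwards [eventually_eventually_nhds.2 hall] with x hx
      obtain ⟨hxN, hxN', hxs⟩ := hx.self_of_nhds
      have hcont : ContinuousAt (G m u) x :=
        ((hG m hm u hu).1.mono fun y hy => required_of_mem hm hu hy).continuousAt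
          (hNo.mem_nhds hxN)
      have hcont' : ContinuousAt (G' m u) x :=
        ((hG' m hm u hu).1.mono fun y hy => required_of_mem hm hu hy).continuousAt
          (hNo'.mem_nhds hxN')
      have hGG : G m u x = G' m u x := by
        -- On the dense slit domain the two transformation formulas have the same left hand side.
        by_contra hne
        have h1 : ∀ᶠ y in 𝓝 x, G m u y - G' m u y ≠ 0 :=
          (hcont.sub hcont').eventually_ne (sub_ne_zero.2 hne)
        obtain ⟨y, hy, hy1, hyN, hyN', hys⟩ :=
          ((frequently_mem_slitDomain (hNp hxN)).and_eventually (h1.and hx)).exists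
        refine hy1 ?_
        rw [← hys, ← hNt y hyN, ← hNt' y hyN', hEE m hm hy, sub_self]
      refine ⟨hxN, hxN', hGG, ?_⟩
      rwa [hGG, sub_self, sub_eq_zero] at hxs
  intro z hz
  obtain ⟨h1, h2, -, h3⟩ := (key n hn z hz).self_of_nhds
  rw [(hN n hn z hz).2.2.2.2 z h1, (hN' n hn z hz).2.2.2.2 z h2, h3]

end HolGen

theorem theorem3p12 :
    -- existence and uniqueness of the functions `F_n` on the open dense domain
    (∃ F : HolGen.Family, HolGen.IsPdeFamily F ∧
      ∀ F' : HolGen.Family, HolGen.IsPdeFamily F' →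
        ∀ n, 1 ≤ n → Set.EqOn (F' n) (F n) (HolGen.slitDomain n)) ∧
    -- their unique extension to all of `(ℂ^×)^n`
    (∀ F : HolGen.Family, HolGen.IsPdeFamily F →
      ∃ E : HolGen.Family, HolGen.Extends E F ∧ HolGen.TransformCondition E ∧
        ∀ E' : HolGen.Family, HolGen.Extends E' F → HolGen.TransformCondition E' →
          ∀ n, 1 ≤ n → Set.EqOn (E' n) (E n) (HolGen.puncturedSpace n)) := by
  have hpde := HolGen.isPdeFamily_extFamily
  refine ⟨⟨HolGen.extFamily, hpde, fun F' hF' n hn => HolGen.eqOn_of_isPdeFamily hF' hpde hn⟩,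
    fun F hF => ?_⟩
  have hext : HolGen.Extends HolGen.extFamily F := fun n hn =>
    HolGen.eqOn_of_isPdeFamily hpde hF hn
  refine ⟨HolGen.extFamily, hext, HolGen.transformCondition_extFamily, fun E' hE' hT n hn => ?_⟩
  exact HolGen.eqOn_of_transformCondition (fun k hk => (hE' k hk).trans (hext k hk).symm) hT
    HolGen.transformCondition_extFamily hn
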